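/- **Conventions.** For a signature $\tau$ and a $\tau$-theory $T$, let $T_\forall$ (respectively $T_{\forall\vee\exists}$) be the set of universal $\tau$-sentences (respectively of Boolean combinations of universal $\tau$-sentences) that are consequences of $T$. $T$ is *model complete* if whenever $\mathcal M$ is a substructure of $\mathcal N$ and both are models of $T$, then $\mathcal M\prec\mathcal N$. $T$ is the *model companion* (respectively the *absolute model companion*, AMC) of $S$ if $T$ is model complete and $T_\forall=S_\forall$ (respectively $T_{\forall\vee\exists}=S_{\forall\vee\exists}$). Let $A$ be a set of pairs $(\phi,i)$ with $\phi(x_0,\dots,x_n)$ an $\in$-formula and $i\in\{0,1\}$. The signature $\in_A$ adds to $\{\in\}$ an $(n+1)$-ary relation symbol $R_\phi$ for each $(\phi,0)\in A$, an $n$-ary function symbol $f_\phi$ for each $(\phi,1)\in A$, and a constant $c$ if some $(\phi,1)$ is in $A$. The theory $T_{\in,A}$ has the axioms $\forall\vec x\,(\phi(\vec x)\leftrightarrow R_\phi(\vec x))$ for $(\phi,0)\in A$; for $(\phi,1)\in A$ the axioms saying that for all $x_1,\dots,x_n$, $f_\phi(x_1,\dots,x_n)$ is the unique $y$ such that $\phi(y,x_1,\dots,x_n)$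 if there is exactly one such $y$, and is $c$ otherwise; and the axiom saying that $c$ is the empty set. Let $D$ consist of all $(\phi,0)$ with $\phi$ a $\Delta_0$-formula, together with $(\phi,1)$ for $\phi$ ranging over the $\Delta_0$-formulae defining $\emptyset$, $\omega$ and the graphs of the ten Gödel operations $G_1,\dots,G_{10}$ (as listed in Jech's *Set Theory*); put $\in_{\Delta_0}\;=\;\in_D$. **Theorem.** Let $R$ be an $\in$-theory extending $\mathsf{ZFC}$. (i) Let $A\supseteq D$ (that is, $\in_A\supseteq\in_{\Delta_0}$) be such that $R+T_{\in,A}$ has a model companion $\mathrm{MC}(R,A)$. Then every model $\mathcal M$ of $\mathrm{MC}(R,A)$ is closed under Gödel operations (for each $i$ and all $\vec a\in\mathcal M$, there is exactly one $b\in \mathcal M$ for which the formula defining the graph of $G_i$ holds in $\mathcal M$ of $b,\vec a$, and $b$ is the value at $\vec a$ of the function symbol of $\in_{\Delta_0}$ for $G_i$), and $\mathcal M$ satisfies the Axioms of Extensionality, Foundation, Infinity and Choice (Choice in the form: every set is in bijection with an ordinal). (ii) Let $\kappa$ be an $R$-definable infinite cardinal, i.e. let $\phi_\kappa(x)$ be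 an $\in$-formula such that $R$ proves $\exists!x\,\phi_\kappa(x)$ and $\forall x\,(\phi_\kappa(x)\rightarrow x\text{ is a cardinal and }\omega\subseteq x)$. Then there is $A_\kappa\supseteq D$ such that $R+T_{\in,A_\kappa}$ has an absolute model companion, and the following hold: for every model $\mathcal M$ of $R+T_{\in,A_\kappa}$ the set of those $a\in\mathcal M$ for which $\mathcal M$ satisfies "the transitive closure of $a$ has size at most $\kappa$" is the domain of an $\in_{A_\kappa}$-substructure $H_{\kappa^+}^{\mathcal M}$ of $\mathcal M$; and the set of all $\in_{A_\kappa}$-sentences that hold in $H_{\kappa^+}^{\mathcal M}$ for every model $\mathcal M$ of $R+T_{\in,A_\kappa}$ is the absolute model companion of $R+T_{\in,A_\kappa}$. -/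

import Mathlib

open FirstOrder

namespace AMC

open FirstOrder.Language

noncomputable section

/-! ### Model completeness, model companions, absolute model companions -/

section ModelTheory

variable {L : FirstOrder.Language.{0, 0}}

/-- `T_∀`: the universal sentences that are consequences of `T`. -/
def univConsequences (T : L.Theory) : Set L.Sentence :=
  {σ | BoundedFormula.IsUniversal σ ∧ T ⊨ᵇ σ}

/-- Boolean combinations of universal sentences (`⊥` and `→` generate all Boolean connectives). -/
inductive IsBoolUniversal : L.Sentence → Prop
  | of_isUniversal (σ : L.Sentence) : BoundedFormula.IsUniversal σ → IsBoolUniversal σ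
  | falsum : IsBoolUniversal BoundedFormula.falsum
  | imp (σ τ : L.Sentence) : IsBoolUniversal σ → IsBoolUniversal τ →
      IsBoolUniversal (BoundedFormula.imp σ τ)

/-- `T_{∀∨∃}`: the Boolean combinations of universal sentences that are consequences of `T`. -/
def boolUnivConsequences (T : L.Theory) : Set L.Sentence :=
  {σ | IsBoolUniversal σ ∧ T ⊨ᵇ σ}

/-- `T` is model complete: whenever `S` is a substructure of `N` and both are models of `T`,
`S` is an elementary substructure of `N`. -/
def IsModelComplete (T : L.Theory) : Prop :=
  ∀ (N : Type) [L.Structure N] (S : L.Substructure N) [Nonempty S],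
    N ⊨ T → S ⊨ T → S.IsElementary

/-- `T` is the model companion of `S`. -/
def IsModelCompanion (T S : L.Theory) : Prop :=
  univConsequences T = univConsequences S ∧ IsModelComplete T

/-- `T` is the absolute model companion of `S`. -/
def IsAMC (T S : L.Theory) : Prop :=
  boolUnivConsequences T = boolUnivConsequences S ∧ IsModelComplete T

end ModelTheory

/-! ### Partial Morleyizations -/

section Morleyization

/-- Formulas `φ(x₀,…,xₙ)` presented with a nonempty list of variables. -/
abbrev Form (L : FirstOrder.Language.{0, 0}) : Type := Σ n : ℕ, L.Formula (Fin (n + 1))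

variable {L : FirstOrder.Language.{0, 0}} (A : Set (Form L × Fin 2))

/-- The new function symbols: an `n`-ary `f_φ` for each `(φ(x₀,…,xₙ), 1) ∈ A`, and the constant
`c` if there is at least one such pair in `A`. -/
inductive NewFun : ℕ → Type
  | f {n : ℕ} (φ : L.Formula (Fin (n + 1))) (h : ((⟨n, φ⟩ : Form L), (1 : Fin 2)) ∈ A) : NewFun n
  | c (h : ∃ ψ : Form L, (ψ, (1 : Fin 2)) ∈ A) : NewFun 0

/-- The new relation symbols: an `n+1`-ary `R_φ` for each `(φ(x₀,…,xₙ), 0) ∈ A`. -/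
inductive NewRel : ℕ → Type
  | R {n : ℕ} (φ : L.Formula (Fin (n + 1))) (h : ((⟨n, φ⟩ : Form L), (0 : Fin 2)) ∈ A) :
      NewRel (n + 1)

/-- The signature `τ_A`. -/
abbrev expand : FirstOrder.Language.{0, 0} := L.sum ⟨NewFun A, NewRel A⟩

/-- The inclusion of `τ` in `τ_A`. -/
abbrev incl : L →ᴸ expand A := LHom.sumInl

variable {A}

def fSymb {n : ℕ} (φ : L.Formula (Fin (n + 1))) (h : ((⟨n, φ⟩ : Form L), (1 : Fin 2)) ∈ A) :
    (expand A).Functions n := Sum.inr (NewFun.f φ h)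

def cSymb (h : ∃ ψ : Form L, (ψ, (1 : Fin 2)) ∈ A) : (expand A).Functions 0 :=
  Sum.inr (NewFun.c h)

def rSymb {n : ℕ} (φ : L.Formula (Fin (n + 1))) (h : ((⟨n, φ⟩ : Form L), (0 : Fin 2)) ∈ A) :
    (expand A).Relations (n + 1) := Sum.inr (NewRel.R φ h)

/-- Universal closure. -/
def close {L' : FirstOrder.Language.{0, 0}} {n : ℕ} (φ : L'.Formula (Fin n)) : L'.Sentence :=
  (Formula.relabel Sum.inr φ : L'.Formula (Empty ⊕ Fin n)).iAlls (Fin n)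

/-- `∃! y φ(y, x₁, …, xₙ)`, as a formula in `x₁, …, xₙ`. -/
def exUniqueFirst {L' : FirstOrder.Language.{0, 0}} {n : ℕ} (φ : L'.Formula (Fin (n + 1))) :
    L'.Formula (Fin n) :=
  (φ.relabel (Fin.cons (Sum.inr 0) Sum.inl : Fin (n + 1) → Fin n ⊕ Fin 1)).iExsUnique (Fin 1)

/-- `∀ x⃗ (φ(x⃗) ↔ R_φ(x⃗))`. -/
def ax0 {n : ℕ} (φ : L.Formula (Fin (n + 1))) (h : ((⟨n, φ⟩ : Form L), (0 : Fin 2)) ∈ A) :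
    (expand A).Sentence :=
  close (((incl A).onFormula φ).iff ((rSymb φ h).formula Term.var))

/-- `∀ x⃗ [(∃! y φ(y, x⃗) → φ(f_φ(x⃗), x⃗)) ∧ (¬ ∃! y φ(y, x⃗) → f_φ(x⃗) = c)]`. -/
def ax1 {n : ℕ} (φ : L.Formula (Fin (n + 1))) (h : ((⟨n, φ⟩ : Form L), (1 : Fin 2)) ∈ A) :
    (expand A).Sentence :=
  let φ' : (expand A).Formula (Fin (n + 1)) := (incl A).onFormula φ
  let fx : (expand A).Term (Fin n) := Term.func (fSymb φ h) Term.var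
  let c : (expand A).Term (Fin n) := Term.func (cSymb ⟨_, h⟩) Fin.elim0
  close (((exUniqueFirst φ').imp (BoundedFormula.subst φ' (Fin.cons fx Term.var))) ⊓
    ((exUniqueFirst φ').not.imp (Term.equal fx c)))

variable (A) in
/-- The theory `T_{τ,A}`. -/
def morleyTheory : (expand A).Theory :=
  {σ | ∃ (n : ℕ) (φ : L.Formula (Fin (n + 1))) (h : ((⟨n, φ⟩ : Form L), (0 : Fin 2)) ∈ A),
      σ = ax0 φ h} ∪
  {σ | ∃ (n : ℕ) (φ : L.Formula (Fin (n + 1))) (h : ((⟨n, φ⟩ : Form L), (1 : Fin 2)) ∈ A),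
      σ = ax1 φ h}

end Morleyization

/-! ### The language of set theory; a small toolbox for writing formulas

A variable of a formula in `Lset.BoundedFormula α n` is an element of `α ⊕ Fin n`: either a free
variable `x i`, or the bound variable `b k` introduced by the `k`-th enclosing quantifier
(counted from outside, starting with `0`). `up` views a variable under one more quantifier and
`nw` is the variable bound by the innermost quantifier. -/

inductive SetRel : ℕ → Type
  | mem : SetRel 2

/-- The language `{∈}`. -/
def Lset : FirstOrder.Language.{0, 0} := ⟨fun _ => Empty, SetRel⟩

section Formulas

variable {α : Type} {n : ℕ}

abbrev x (i : α) : α ⊕ Fin n := Sum.inl i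
abbrev b (k : Fin n) : α ⊕ Fin n := Sum.inr k
def up (y : α ⊕ Fin n) : α ⊕ Fin (n + 1) := Sum.map id Fin.castSucc y
def nw : α ⊕ Fin (n + 1) := Sum.inr (Fin.last n)

/-- `y ∈ z` -/
def mem (y z : α ⊕ Fin n) : Lset.BoundedFormula α n :=
  Relations.boundedFormula₂ (L := Lset) SetRel.mem (Term.var y) (Term.var z)

/-- `y = z` -/
def eq (y z : α ⊕ Fin n) : Lset.BoundedFormula α n :=
  Term.bdEqual (L := Lset) (Term.var y) (Term.var z)

/-- `∀ w ∈ y, φ` -/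
def bAll (y : α ⊕ Fin n) (φ : Lset.BoundedFormula α (n + 1)) : Lset.BoundedFormula α n :=
  ((mem nw (up y)).imp φ).all

/-- `∃ w ∈ y, φ` -/
def bEx (y : α ⊕ Fin n) (φ : Lset.BoundedFormula α (n + 1)) : Lset.BoundedFormula α n :=
  (bAll y φ.not).not

/-- `Δ₀`-formulas: generated from atomic formulas by Boolean connectives and bounded
quantification. -/
inductive IsDelta0 : ∀ {n : ℕ}, Lset.BoundedFormula α n → Prop
  | falsum {n : ℕ} : IsDelta0 (BoundedFormula.falsum : Lset.BoundedFormula α n)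
  | mem {n : ℕ} (y z : α ⊕ Fin n) : IsDelta0 (mem y z)
  | eq {n : ℕ} (y z : α ⊕ Fin n) : IsDelta0 (eq y z)
  | imp {n : ℕ} {φ ψ : Lset.BoundedFormula α n} : IsDelta0 φ → IsDelta0 ψ → IsDelta0 (φ.imp ψ)
  | bAll {n : ℕ} (y : α ⊕ Fin n) {φ : Lset.BoundedFormula α (n + 1)} :
      IsDelta0 φ → IsDelta0 (bAll y φ)

/-- `∃ s ∈ y, ∃ a ∈ s, φ` (two bound variables: first `s`, then `a`) -/
def bEx2 (y : α ⊕ Fin n) (φ : Lset.BoundedFormula α (n + 2)) : Lset.BoundedFormula α n :=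
  bEx y (bEx nw φ)

/-- `∀ s ∈ y, ∀ a ∈ s, φ` (two bound variables: first `s`, then `a`) -/
def bAll2 (y : α ⊕ Fin n) (φ : Lset.BoundedFormula α (n + 2)) : Lset.BoundedFormula α n :=
  bAll y (bAll nw φ)

/-- `y = ∅` -/
def isEmpty (y : α ⊕ Fin n) : Lset.BoundedFormula α n := bAll y ⊥

/-- `y ⊆ z` -/
def subset (y z : α ⊕ Fin n) : Lset.BoundedFormula α n := bAll y (mem nw (up z))

/-- `s = {u, v}` -/
def isUPair (s u v : α ⊕ Fin n) : Lset.BoundedFormula α n :=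
  mem u s ⊓ mem v s ⊓ bAll s (eq nw (up u) ⊔ eq nw (up v))

/-- `p = (u, v) = {{u}, {u, v}}` -/
def isPair (p u v : α ⊕ Fin n) : Lset.BoundedFormula α n :=
  bEx p (bEx (up p) (isUPair (up nw) (up (up u)) (up (up u)) ⊓
    isUPair nw (up (up u)) (up (up v)) ⊓ isUPair (up (up p)) (up nw) nw))

/-- `q = ((u, v), w)` -/
def isTriple (q u v w : α ⊕ Fin n) : Lset.BoundedFormula α n :=
  bEx2 q (isPair nw (up (up u)) (up (up v)) ⊓ isPair (up (up q)) nw (up (up w)))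

/-- `y = z ∪ {z}` -/
def isSucc (y z : α ⊕ Fin n) : Lset.BoundedFormula α n :=
  mem z y ⊓ subset z y ⊓ bAll y (mem nw (up z) ⊔ eq nw (up z))

/-- `y` is transitive. -/
def isTrans (y : α ⊕ Fin n) : Lset.BoundedFormula α n := bAll y (subset nw (up y))

/-- `y` is an ordinal: a transitive set of transitive sets. -/
def isOrd (y : α ⊕ Fin n) : Lset.BoundedFormula α n := isTrans y ⊓ bAll y (isTrans nw)

/-- `y = ω`: a nonempty ordinal without a largest element, all of whose elements are `∅` or
successors. -/
def isOmega (y : α ⊕ Fin n) : Lset.BoundedFormula α n :=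
  isOrd y ⊓ (isEmpty y).not ⊓ bAll y (bEx (up y) (mem (up nw) nw)) ⊓
    bAll y (isEmpty nw ⊔ bEx nw (isSucc (up nw) nw))

/-- `(u, v) ∈ f` -/
def pairMem (f u v : α ⊕ Fin n) : Lset.BoundedFormula α n := bEx f (isPair nw (up u) (up v))

/-- `f` is a function from `y` to `z`. -/
def isFun (f y z : α ⊕ Fin n) : Lset.BoundedFormula α n :=
  bAll f (bEx (up y) (bEx (up (up z)) (isPair (up (up nw)) (up nw) nw))) ⊓
  bAll y (bEx (up z) (pairMem (up (up f)) (up nw) nw)) ⊓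
  bAll y (bAll (up z) (bAll (up (up z))
    ((pairMem (up (up (up f))) (up (up nw)) (up nw) ⊓ pairMem (up (up (up f))) (up (up nw)) nw).imp
      (eq (up nw) nw))))

/-- `f` is an injective function from `y` to `z`. -/
def isInj (f y z : α ⊕ Fin n) : Lset.BoundedFormula α n :=
  isFun f y z ⊓
  bAll y (bAll (up y) (bAll (up (up z))
    ((pairMem (up (up (up f))) (up (up nw)) nw ⊓ pairMem (up (up (up f))) (up nw) nw).imp
      (eq (up (up nw)) (up nw)))))

/-- `f` is a bijection from `y` to `z`. -/
def isBij (f y z : α ⊕ Fin n) : Lset.BoundedFormula α n :=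
  isInj f y z ⊓ bAll z (bEx (up y) (pairMem (up (up f)) nw (up nw)))

/-- `y` is a cardinal: an ordinal not in bijection with any of its elements. -/
def isCard (y : α ⊕ Fin n) : Lset.BoundedFormula α n :=
  isOrd y ⊓ bAll y (isBij nw (up nw) (up (up y))).ex.not

/-- `y` is a cardinal and `ω ⊆ y`. -/
def isInfCard (y : α ⊕ Fin n) : Lset.BoundedFormula α n :=
  isCard y ⊓ (isOmega nw ⊓ subset nw (up y)).ex

/-- `y ∈ H_{κ⁺}`: `y` is contained in a transitive set `t` with an injection `f : t → κ`, that is,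
the transitive closure of `y` has size at most `κ`. -/
def isInH (y κ : α ⊕ Fin n) : Lset.BoundedFormula α n :=
  (isTrans nw ⊓ subset (up y) nw ⊓ (isInj nw (up nw) (up (up κ))).ex).ex

end Formulas

/-! ### The theory ZFC -/

section ZFC

/-- `∀ y z (∀ w (w ∈ y ↔ w ∈ z) → y = z)` -/
def extensionality : Lset.Sentence :=
  (((mem (b 2) (b 0)).iff (mem (b 2) (b 1))).all.imp (eq (b 0) (b 1))).all.all

/-- `∀ y (y = ∅ ∨ ∃ z ∈ y ∀ w ∈ y, w ∉ z)` -/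
def foundation : Lset.Sentence :=
  (isEmpty (b 0) ⊔ bEx (b 0) (bAll (b 0) (mem (b 2) (b 1)).not)).all

/-- `∀ y z ∃ s (s = {y, z})` -/
def pairing : Lset.Sentence := (isUPair (b 2) (b 0) (b 1)).ex.all.all

/-- `∀ y ∃ z ∀ w (w ∈ z ↔ ∃ s ∈ y, w ∈ s)` -/
def unionAx : Lset.Sentence :=
  ((mem (b 2) (b 1)).iff (bEx (b 0) (mem (b 2) (b 3)))).all.ex.all

/-- `∀ y ∃ z ∀ w (w ∈ z ↔ w ⊆ y)` -/
def powerset : Lset.Sentence :=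
  ((mem (b 2) (b 1)).iff (subset (b 2) (b 0))).all.ex.all

/-- `∃ y (∃ z ∈ y, z = ∅) ∧ (∀ z ∈ y ∃ w ∈ y, w = z ∪ {z})` -/
def infinity : Lset.Sentence :=
  (bEx (b 0) (isEmpty (b 1)) ⊓ bAll (b 0) (bEx (b 0) (isSucc (b 2) (b 1)))).ex

/-- `∀ y ∃ f ∃ a (a is an ordinal and f is a bijection from y to a)` -/
def choiceAx : Lset.Sentence :=
  (isOrd (b 2) ⊓ isBij (b 1) (b 0) (b 2)).ex.ex.all

/-- `∀ p⃗ ∀ y ∃ z ∀ w (w ∈ z ↔ w ∈ y ∧ φ(w, p⃗))` -/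
def separation {n : ℕ} (φ : Lset.Formula (Fin (n + 1))) : Lset.Sentence :=
  let φ' : Lset.BoundedFormula (Fin n) 3 :=
    BoundedFormula.relabel (Fin.cons (b 2) x : Fin (n + 1) → Fin n ⊕ Fin 3) φ
  close (((mem (b 2) (b 1)).iff (mem (b 2) (b 0) ⊓ φ')).all.ex.all : Lset.Formula (Fin n))

/-- `∀ p⃗ ∀ y [(∀ u ∈ y ∀ v v' (φ(u, v, p⃗) ∧ φ(u, v', p⃗) → v = v')) →`
`∃ z ∀ v (v ∈ z ↔ ∃ u ∈ y, φ(u, v, p⃗))]` -/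
def replacement {n : ℕ} (φ : Lset.Formula (Fin (n + 2))) : Lset.Sentence :=
  let φ' (k : ℕ) (u v : Fin n ⊕ Fin k) : Lset.BoundedFormula (Fin n) k :=
    BoundedFormula.relabel (Fin.cons u (Fin.cons v x) : Fin (n + 2) → Fin n ⊕ Fin k) φ
  close ((((bAll (b 0) (((φ' 4 (b 1) (b 2)) ⊓ (φ' 4 (b 1) (b 3))).imp
      (eq (b 2) (b 3))).all.all).imp
    ((mem (b 2) (b 1)).iff (bEx (b 0) (φ' 4 (b 3) (b 2)))).all.ex).all : Lset.Formula (Fin n)))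

def ZFC : Lset.Theory :=
  {extensionality, foundation, pairing, unionAx, powerset, infinity, choiceAx} ∪
  {σ | ∃ (n : ℕ) (φ : Lset.Formula (Fin (n + 1))), σ = separation φ} ∪
  {σ | ∃ (n : ℕ) (φ : Lset.Formula (Fin (n + 2))), σ = replacement φ}

end ZFC

/-! ### Gödel operations and the signature `∈_{Δ₀}`

In the formulas below the value of the operation is `x 0` and its arguments are `x 1`, `x 2`. -/

section Godel

/-- `x₀ = {x₁, x₂}` -/
def godel1 : Lset.Formula (Fin 3) := isUPair (x 0) (x 1) (x 2)

/-- `x₀ = x₁ × x₂` -/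
def godel2 : Lset.Formula (Fin 3) :=
  bAll (x 0) (bEx (x 1) (bEx (x 2) (isPair (b 0) (b 1) (b 2)))) ⊓
  bAll (x 1) (bAll (x 2) (bEx (x 0) (isPair (b 2) (b 0) (b 1))))

/-- `x₀ = {(u, v) : u ∈ x₁, v ∈ x₂, u ∈ v}` -/
def godel3 : Lset.Formula (Fin 3) :=
  bAll (x 0) (bEx (x 1) (bEx (x 2) (mem (b 1) (b 2) ⊓ isPair (b 0) (b 1) (b 2)))) ⊓
  bAll (x 1) (bAll (x 2) ((mem (b 0) (b 1)).imp (bEx (x 0) (isPair (b 2) (b 0) (b 1)))))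

/-- `x₀ = x₁ \ x₂` -/
def godel4 : Lset.Formula (Fin 3) :=
  bAll (x 0) (mem (b 0) (x 1) ⊓ (mem (b 0) (x 2)).not) ⊓
  bAll (x 1) ((mem (b 0) (x 2)).not.imp (mem (b 0) (x 0)))

/-- `x₀ = x₁ ∩ x₂` -/
def godel5 : Lset.Formula (Fin 3) :=
  bAll (x 0) (mem (b 0) (x 1) ⊓ mem (b 0) (x 2)) ⊓
  bAll (x 1) ((mem (b 0) (x 2)).imp (mem (b 0) (x 0)))

/-- `x₀ = ⋃ x₁` -/
def godel6 : Lset.Formula (Fin 2) :=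
  bAll (x 0) (bEx (x 1) (mem (b 0) (b 1))) ⊓ bAll2 (x 1) (mem (b 1) (x 0))

/-- `x₀ = dom x₁ = {u : ∃ v, (u, v) ∈ x₁}` -/
def godel7 : Lset.Formula (Fin 2) :=
  bAll (x 0) (bEx (x 1) (bEx2 (b 1) (isPair (b 1) (b 0) (b 3)))) ⊓
  bAll (x 1) (bAll2 (b 0) (bAll2 (b 0) ((isPair (b 0) (b 2) (b 4)).imp (mem (b 2) (x 0)))))

/-- `x₀ = {(u, v) : (v, u) ∈ x₁}` -/
def godel8 : Lset.Formula (Fin 2) :=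
  bAll (x 0) (bEx (x 1) (bEx2 (b 0) (bEx2 (b 0)
    (isPair (b 0) (b 3) (b 5) ⊓ isPair (b 1) (b 5) (b 3))))) ⊓
  bAll (x 1) (bAll2 (b 0) (bAll2 (b 0)
    ((isPair (b 0) (b 4) (b 2)).imp (bEx (x 0) (isPair (b 5) (b 2) (b 4))))))

/-- `∃ d, w ∈ ⋃ q, ∃ u, v ∈ ⋃ d, φ(u, v, w)`, where in `φ` the variables bound here, counted from
`b m`, are `b (m+1) = d`, `b (m+3) = w`, `b (m+5) = u`, `b (m+7) = v`. All the components of a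
triple `q = ((u, v), w)` are reached in this way. -/
def exComp {α : Type} {m : ℕ} (q : α ⊕ Fin m) (φ : Lset.BoundedFormula α (m + 8)) :
    Lset.BoundedFormula α m :=
  bEx2 q (bEx2 (up (up q)) (bEx2 (up (up nw)) (bEx2 (up (up (up (up nw)))) φ)))

/-- Dual of `exComp`. -/
def allComp {α : Type} {m : ℕ} (q : α ⊕ Fin m) (φ : Lset.BoundedFormula α (m + 8)) :
    Lset.BoundedFormula α m :=
  bAll2 q (bAll2 (up (up q)) (bAll2 (up (up nw)) (bAll2 (up (up (up (up nw)))) φ)))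

/-- `x₀ = {(u, v, w) : (u, w, v) ∈ x₁}` -/
def godel9 : Lset.Formula (Fin 2) :=
  bAll (x 0) (bEx (x 1) (exComp (b 0)
    (isTriple (b 0) (b 7) (b 9) (b 5) ⊓ isTriple (b 1) (b 7) (b 5) (b 9)))) ⊓
  bAll (x 1) (allComp (b 0)
    ((isTriple (b 0) (b 6) (b 8) (b 4)).imp (bEx (x 0) (isTriple (b 9) (b 6) (b 4) (b 8)))))

/-- `x₀ = {(u, v, w) : (v, w, u) ∈ x₁}` -/
def godel10 : Lset.Formula (Fin 2) :=
  bAll (x 0) (bEx (x 1) (exComp (b 0)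
    (isTriple (b 0) (b 7) (b 9) (b 5) ⊓ isTriple (b 1) (b 9) (b 5) (b 7)))) ⊓
  bAll (x 1) (allComp (b 0)
    ((isTriple (b 0) (b 6) (b 8) (b 4)).imp (bEx (x 0) (isTriple (b 9) (b 4) (b 6) (b 8)))))

/-- The formulas defining the graphs of the Gödel operations `G₁, …, G₁₀`. -/
def godel : Fin 10 → Form Lset :=
  ![⟨2, godel1⟩, ⟨2, godel2⟩, ⟨2, godel3⟩, ⟨2, godel4⟩, ⟨2, godel5⟩,
    ⟨1, godel6⟩, ⟨1, godel7⟩, ⟨1, godel8⟩, ⟨1, godel9⟩, ⟨1, godel10⟩]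

/-- The set `D` with `∈_D = ∈_{Δ₀}`: relation symbols for all `Δ₀`-formulas, constants for `∅`
and `ω`, and function symbols for the Gödel operations. -/
def D : Set (Form Lset × Fin 2) :=
  {p | IsDelta0 p.1.2 ∧ p.2 = 0} ∪
  {((⟨0, isEmpty (x 0)⟩ : Form Lset), (1 : Fin 2)), ((⟨0, isOmega (x 0)⟩ : Form Lset), (1 : Fin 2))} ∪
  Set.range fun i => (godel i, (1 : Fin 2))

end Godel

/-! ### The spectra of a set theory -/

section Spectra

/-- `∀ y ((∀ z, z ∉ y) ↔ c = y)` -/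
def cEmpty {A : Set (Form Lset × Fin 2)} (h : ∃ ψ : Form Lset, (ψ, (1 : Fin 2)) ∈ A) :
    (expand A).Sentence :=
  close (((incl A).onFormula (isEmpty (x 0) : Lset.Formula (Fin 1))).iff
    (Term.equal (Term.func (cSymb h) Fin.elim0) (Term.var 0)))

/-- The `∈_A`-theory `R + T_{∈,A}`, where `T_{∈,A}` says that the symbols of `∈_A` have the
intended meaning and that `c` is the empty set. -/
def setTheory (R : Lset.Theory) (A : Set (Form Lset × Fin 2)) : (expand A).Theory :=
  (incl A).onTheory R ∪ morleyTheory A ∪ {σ | ∃ h, σ = cEmpty h}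

/-- The model companionship spectrum of `R`. -/
def SpecMC (R : Lset.Theory) : Set (Set (Form Lset × Fin 2)) :=
  {A | ∃ T, IsModelCompanion T (setTheory R A)}

/-- The absolute model companionship spectrum of `R`. -/
def SpecAMC (R : Lset.Theory) : Set (Set (Form Lset × Fin 2)) :=
  {A | ∃ T, IsAMC T (setTheory R A)}

/-- An `∈_A`-structure (with `∈_A ⊇ ∈_{Δ₀}`) is closed under Gödel operations: the function symbol
of each Gödel operation `Gᵢ` is interpreted by a total function whose value `Gᵢ(x⃗)` is the one and
only `y` which the formula defining `Gᵢ` relates to `x⃗` in the structure. -/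
def ClosedUnderGodel {A : Set (Form Lset × Fin 2)} (hA : D ⊆ A) (M : Type*)
    [(expand A).Structure M] : Prop :=
  ∀ (i : Fin 10) (v : Fin (godel i).1 → M) (y : M),
    Structure.funMap (fSymb (A := A) (godel i).2 (hA (Or.inr ⟨i, rfl⟩))) v = y ↔
      ((incl A).onFormula (godel i).2).Realize (Fin.cons y v)

/-- `φ(x)` defines an infinite cardinal, provably in `R`. -/
def IsDefinableInfCard (R : Lset.Theory) (φ : Lset.Formula (Fin 1)) : Prop :=
  R ⊨ᵇ ((Formula.relabel Sum.inr φ : Lset.Formula (Empty ⊕ Fin 1)).iExsUnique (Fin 1)) ∧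
  R ⊨ᵇ close (φ.imp (isInfCard (x 0)))

/-- `y ∈ H_{κ⁺}`, where `κ` is defined by `φ`. -/
def inHFormula (φ : Lset.Formula (Fin 1)) : Lset.Formula (Fin 1) :=
  ((BoundedFormula.relabel (fun _ => b 0 : Fin 1 → Fin 1 ⊕ Fin 1) φ :
    Lset.BoundedFormula (Fin 1) 1) ⊓ isInH (x 0) (b 0)).ex

/-- The set `H_{κ⁺}^M` in an `∈_A`-structure `M`. -/
def Hset (A : Set (Form Lset × Fin 2)) (φ : Lset.Formula (Fin 1)) (M : Type*)
    [(expand A).Structure M] : Set M :=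
  {y | ((incl A).onFormula (inHFormula φ)).Realize fun _ => y}

/-- The `∈_A`-theory common to the substructures `H_{κ⁺}^M` of the models `M` of `R + T_{∈,A}`. -/
def HTheory (R : Lset.Theory) (A : Set (Form Lset × Fin 2)) (φ : Lset.Formula (Fin 1)) :
    (expand A).Theory :=
  {σ | ∀ (M : Type) [(expand A).Structure M], M ⊨ setTheory R A →
    ∀ H : (expand A).Substructure M, (H : Set M) = Hset A φ M → H ⊨ σ}

end Spectra

end

end AMC

/-! Part (i) rests on a sandwich. Since `T` and `S = R + T_{∈,A}` have the same universal
consequences, compactness embeds a model `M` of `T` in some `N ⊨ S`, and `N` in some `M' ⊨ T`; model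
completeness makes the composite `M → M'` elementary (`exists_sandwich`). Every `Δ₀`-formula is
named by a relation symbol that has its intended meaning in `N`. If such a symbol has witnesses in
`N` over parameters from `M`, it has them in `M'`, hence in `M` (`reflect`). By induction
`Δ₀`-formulas are absolute between `M` and `N` (`delta0_iff`), and `Σ₁` statements about elements of
`M` descend from `N` to `M`. Closure under Gödel operations, Extensionality and Foundation are `Δ₀`
statements about parameters; Infinity and each instance of Choice are `Σ₁`.

For part (ii), `A_κ` adds to `D` one predicate for each `∈`-formula `ψ`, but a guarded one: it holds
of `(t, f, u)` when `t` is transitive, `f` injects `t` into `κ`, the entries of `u` lie in `t`, and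
`ψ(u)` is true in the whole model `M`. Write `H` for `H_{κ⁺}`.

Model completeness. `H` is definable in `M`, so truth in `H` of any `∈_{A_κ}`-formula `φ(u)` is
expressed by an `∈`-formula `ψ(u)` over `M` (`exists_translation`). Every tuple of `H` has a guard
`(t, f)` in `H` (`exists_guard_witness`). Hence `φ(u)` is equivalent in `H` to `∃ t f, R(t, f, u)`
with `R` the guarded predicate of `ψ`. All formulas being existential modulo the theory of the
structures `H`, inclusions between its models are elementary.

Same universal sentences. `H` is a substructure of `M`, because `κ × κ` injects into `κ` and so `H`
is closed under the Gödel operations. Conversely, suppose a quantifier-free `θ` fails at a tuple `a`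
of `M`. Take a hull `X` of size at most `κ` containing `a` and all of `κ`, closed under Skolem
functions for the finitely many `Δ₀`-formulas involved; its transitive collapse `π` maps `X` into
`H` (`exists_isHull`). `Δ₀`-relations and the function symbols are preserved by `π`. The guarded
predicates are preserved for another reason: if `t, f ∈ X`, each element of `t` is recovered from
its `f`-value in `κ ⊆ X`, so `π` is the identity on `t` and fixes `f`, and the entries of `u` do not
move (`ev_guard`). Thus `θ` fails at `π(a)` in `H`, and Boolean combinations of universal sentences
have the same truth value in `M` and `H` (`realize_iff_of_isBoolUniversal`).

The model `M` is an arbitrary, possibly ill-founded, model of ZFC. Ordinals, recursion, choice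
functions, cardinal comparison and collapses are therefore developed inside it. Separation and
Replacement apply only to classes definable with parameters, and `Def` and `DefF` keep track of
these. -/

namespace AMC

open FirstOrder.Language

noncomputable section

universe u

set_option linter.unusedSectionVars false
set_option synthInstance.maxHeartbeats 200000
set_option synthInstance.maxSize 100000

/-! ### Semantics of the basic formulas -/

section Semantics

variable {M : Type u} [Lset.Structure M] {α : Type} {n : ℕ}

/-- Membership in an `∈`-structure. -/
def E (y z : M) : Prop := Structure.RelMap (L := Lset) (M := M) SetRel.mem ![y, z]

infix:50 " ε " => E

/-- The value of a variable. -/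
def val (v : α → M) (xs : Fin n → M) (y : α ⊕ Fin n) : M := Sum.elim v xs y

@[simp] theorem val_inl (v : α → M) (xs : Fin n → M) (i : α) : val v xs (Sum.inl i) = v i := rfl
@[simp] theorem val_inr (v : α → M) (xs : Fin n → M) (i : Fin n) :
    val v xs (Sum.inr i) = xs i := rfl
@[simp] theorem val_up (v : α → M) (xs : Fin n → M) (a : M) (y : α ⊕ Fin n) :
    val v (Fin.snoc xs a : Fin (n + 1) → M) (up y) = val v xs y := by
  rcases y with y | y <;> simp [up, val]
@[simp] theorem val_nw (v : α → M) (xs : Fin n → M) (a : M) :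
    val v (Fin.snoc xs a : Fin (n + 1) → M) nw = a := by simp [nw, val]

open BoundedFormula

@[simp] theorem realize_mem (v : α → M) (xs : Fin n → M) (y z : α ⊕ Fin n) :
    (mem y z).Realize v xs ↔ val v xs y ε val v xs z := by
  simp only [mem, E, val]
  exact BoundedFormula.realize_rel₂

@[simp] theorem realize_eq (v : α → M) (xs : Fin n → M) (y z : α ⊕ Fin n) :
    (eq y z).Realize v xs ↔ val v xs y = val v xs z := by
  simp [eq, val]

@[simp] theorem realize_bAll (v : α → M) (xs : Fin n → M) (y : α ⊕ Fin n)
    (φ : Lset.BoundedFormula α (n + 1)) :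
    (bAll y φ).Realize v xs ↔ ∀ z, z ε val v xs y → φ.Realize v (Fin.snoc xs z) := by
  simp [bAll]

@[simp] theorem realize_bEx (v : α → M) (xs : Fin n → M) (y : α ⊕ Fin n)
    (φ : Lset.BoundedFormula α (n + 1)) :
    (bEx y φ).Realize v xs ↔ ∃ z, z ε val v xs y ∧ φ.Realize v (Fin.snoc xs z) := by
  simp [bEx]

@[simp] theorem realize_bAll2 (v : α → M) (xs : Fin n → M) (y : α ⊕ Fin n)
    (φ : Lset.BoundedFormula α (n + 2)) :
    (bAll2 y φ).Realize v xs ↔ ∀ s, s ε val v xs y → ∀ a, a ε s →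
      φ.Realize v (Fin.snoc (Fin.snoc xs s : Fin (n + 1) → M) a) := by
  simp [bAll2]

@[simp] theorem realize_bEx2 (v : α → M) (xs : Fin n → M) (y : α ⊕ Fin n)
    (φ : Lset.BoundedFormula α (n + 2)) :
    (bEx2 y φ).Realize v xs ↔ ∃ s, s ε val v xs y ∧ ∃ a, a ε s ∧
      φ.Realize v (Fin.snoc (Fin.snoc xs s : Fin (n + 1) → M) a) := by
  simp [bEx2]

def IsEmp (y : M) : Prop := ∀ z, ¬ z ε y
def Sub (y z : M) : Prop := ∀ w, w ε y → w ε z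
def IsUPair (s a c : M) : Prop := a ε s ∧ c ε s ∧ ∀ z, z ε s → z = a ∨ z = c
def IsPair (p a c : M) : Prop :=
  ∃ s, s ε p ∧ ∃ t, t ε p ∧ IsUPair s a a ∧ IsUPair t a c ∧ IsUPair p s t
def IsTriple (q a c d : M) : Prop :=
  ∃ s, s ε q ∧ ∃ p, p ε s ∧ IsPair p a c ∧ IsPair q p d
def IsSucc (y z : M) : Prop := z ε y ∧ Sub z y ∧ ∀ w, w ε y → w ε z ∨ w = z
def Trans (y : M) : Prop := ∀ z, z ε y → Sub z y
def Ord (y : M) : Prop := Trans y ∧ ∀ z, z ε y → Trans z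
def IsOmega (y : M) : Prop :=
  ((Ord y ∧ ¬ IsEmp y) ∧ ∀ z, z ε y → ∃ w, w ε y ∧ z ε w) ∧
    ∀ z, z ε y → IsEmp z ∨ ∃ w, w ε z ∧ IsSucc z w
def PairMem (f a c : M) : Prop := ∃ p, p ε f ∧ IsPair p a c
def IsFun (f y z : M) : Prop :=
  ((∀ p, p ε f → ∃ a, a ε y ∧ ∃ c, c ε z ∧ IsPair p a c) ∧
    ∀ a, a ε y → ∃ c, c ε z ∧ PairMem f a c) ∧
    ∀ a, a ε y → ∀ c, c ε z → ∀ d, d ε z → PairMem f a c ∧ PairMem f a d → c = d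
def IsInj (f y z : M) : Prop :=
  IsFun f y z ∧ ∀ a, a ε y → ∀ a', a' ε y → ∀ c, c ε z →
    PairMem f a c ∧ PairMem f a' c → a = a'
def IsBij (f y z : M) : Prop := IsInj f y z ∧ ∀ c, c ε z → ∃ a, a ε y ∧ PairMem f a c
def IsCard (y : M) : Prop := Ord y ∧ ∀ β, β ε y → ¬ ∃ f, IsBij f β y
def IsInfCard (y : M) : Prop := IsCard y ∧ ∃ w, IsOmega w ∧ Sub w y
def InH (κ y : M) : Prop := ∃ t, (Trans t ∧ Sub y t) ∧ ∃ f, IsInj f t κ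

variable (v : α → M) (xs : Fin n → M)

@[simp] theorem realize_isEmpty (y : α ⊕ Fin n) :
    (isEmpty y).Realize v xs ↔ IsEmp (val v xs y) := by
  simp [isEmpty, IsEmp]

@[simp] theorem realize_subset (y z : α ⊕ Fin n) :
    (subset y z).Realize v xs ↔ Sub (val v xs y) (val v xs z) := by
  simp [subset, Sub]

@[simp] theorem realize_isUPair (y z w : α ⊕ Fin n) :
    (isUPair y z w).Realize v xs ↔ IsUPair (val v xs y) (val v xs z) (val v xs w) := by
  simp [isUPair, IsUPair, and_assoc]

@[simp] theorem realize_isPair (y z w : α ⊕ Fin n) :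
    (isPair y z w).Realize v xs ↔ IsPair (val v xs y) (val v xs z) (val v xs w) := by
  simp [isPair, IsPair, and_assoc]

@[simp] theorem realize_isTriple (q y z w : α ⊕ Fin n) :
    (isTriple q y z w).Realize v xs ↔
      IsTriple (val v xs q) (val v xs y) (val v xs z) (val v xs w) := by
  simp [isTriple, IsTriple]

@[simp] theorem realize_isSucc (y z : α ⊕ Fin n) :
    (isSucc y z).Realize v xs ↔ IsSucc (val v xs y) (val v xs z) := by
  simp [isSucc, IsSucc, and_assoc]

@[simp] theorem realize_isTrans (y : α ⊕ Fin n) :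
    (isTrans y).Realize v xs ↔ Trans (val v xs y) := by
  simp [isTrans, Trans]

@[simp] theorem realize_isOrd (y : α ⊕ Fin n) :
    (isOrd y).Realize v xs ↔ Ord (val v xs y) := by
  simp [isOrd, Ord]

@[simp] theorem realize_isOmega (y : α ⊕ Fin n) :
    (isOmega y).Realize v xs ↔ IsOmega (val v xs y) := by
  simp [isOmega, IsOmega]

@[simp] theorem realize_pairMem (y z w : α ⊕ Fin n) :
    (pairMem y z w).Realize v xs ↔ PairMem (val v xs y) (val v xs z) (val v xs w) := by
  simp [pairMem, PairMem]

@[simp] theorem realize_isFun (y z w : α ⊕ Fin n) :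
    (isFun y z w).Realize v xs ↔ IsFun (val v xs y) (val v xs z) (val v xs w) := by
  simp [isFun, IsFun]

@[simp] theorem realize_isInj (y z w : α ⊕ Fin n) :
    (isInj y z w).Realize v xs ↔ IsInj (val v xs y) (val v xs z) (val v xs w) := by
  simp [isInj, IsInj]

@[simp] theorem realize_isBij (y z w : α ⊕ Fin n) :
    (isBij y z w).Realize v xs ↔ IsBij (val v xs y) (val v xs z) (val v xs w) := by
  simp [isBij, IsBij]

@[simp] theorem realize_isCard (y : α ⊕ Fin n) :
    (isCard y).Realize v xs ↔ IsCard (val v xs y) := by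
  simp [isCard, IsCard]

@[simp] theorem realize_isInfCard (y : α ⊕ Fin n) :
    (isInfCard y).Realize v xs ↔ IsInfCard (val v xs y) := by
  simp [isInfCard, IsInfCard]

@[simp] theorem realize_isInH (y z : α ⊕ Fin n) :
    (isInH y z).Realize v xs ↔ InH (val v xs z) (val v xs y) := by
  simp [isInH, InH]

theorem realize_close {L : FirstOrder.Language.{0, 0}} {N : Type*} [L.Structure N] {m : ℕ}
    (φ : L.Formula (Fin m)) : N ⊨ close φ ↔ ∀ v : Fin m → N, φ.Realize v := by
  simp [close, Sentence.Realize, Formula.realize_iAlls, Function.comp_def]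

theorem realize_exUniqueFirst {L : FirstOrder.Language.{0, 0}} {N : Type*} [L.Structure N] {m : ℕ}
    (φ : L.Formula (Fin (m + 1))) (v : Fin m → N) :
    (exUniqueFirst φ).Realize v ↔ ∃! y : N, φ.Realize (Fin.cons y v) := by
  have key : ∀ i : Fin 1 → N, (Sum.elim v i ∘
      (Fin.cons (Sum.inr 0) Sum.inl : Fin (m + 1) → Fin m ⊕ Fin 1)) = Fin.cons (i 0) v := by
    intro i; funext j; refine Fin.cases ?_ (fun j => ?_) j <;> simp
  simp only [exUniqueFirst, Formula.realize_iExsUnique, Formula.realize_relabel, key]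
  constructor
  · rintro ⟨i, h, hu⟩
    exact ⟨i 0, h, fun y hy => congrFun (hu (fun _ => y) hy) 0⟩
  · rintro ⟨y, h, hu⟩
    refine ⟨fun _ => y, h, fun i hi => funext fun j => ?_⟩
    rw [Subsingleton.elim j 0]; exact hu _ hi

end Semantics

/-! ### Definability with parameters, by instance search -/

section Definability

variable {M : Type u} [Lset.Structure M] {n k : ℕ}

/-- All entries but the last. -/
def ini (w : Fin (n + 1) → M) : Fin n → M := fun i => w i.castSucc
/-- The last entry. -/
def lst (w : Fin (n + 1) → M) : M := w (Fin.last n)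

@[simp] theorem ini_snoc (v : Fin n → M) (a : M) : ini (Fin.snoc v a : Fin (n + 1) → M) = v := by
  funext i; simp [ini]
@[simp] theorem lst_snoc (v : Fin n → M) (a : M) : lst (Fin.snoc v a : Fin (n + 1) → M) = a := by
  simp [lst]

/-- Relations on `M` definable with parameters. -/
class Def (P : (Fin n → M) → Prop) : Prop where
  out : ∃ φ : Lset.BoundedFormula M n, ∀ v, φ.Realize id v ↔ P v

/-- Functions on `M` definable with parameters. -/
class DefF (f : (Fin n → M) → M) : Prop where
  out : Def fun w : Fin (n + 1) → M => lst w = f (ini w)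

/-- Projections of tuples to an initial segment. -/
class Proj (f : (Fin n → M) → (Fin k → M)) : Prop where
  out : ∃ σ : Fin k → Fin n, ∀ w i, f w i = w (σ i)

class Def1 (P : M → Prop) : Prop where
  out : Def fun w : Fin 1 → M => P (lst w)
class Def2 (P : M → M → Prop) : Prop where
  out : Def fun w : Fin 2 → M => P (lst (ini w)) (lst w)
class Fun1 (f : M → M) : Prop where
  out : DefF fun w : Fin 1 → M => f (lst w)

theorem Def.congr {P Q : (Fin n → M) → Prop} (hP : Def P) (h : ∀ v, P v ↔ Q v) : Def Q :=
  (funext fun v => propext (h v) : P = Q) ▸ hP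

instance Def.const (p : Prop) : Def fun _ : Fin n → M => p := by
  by_cases h : p
  · exact ⟨⊤, by simp [h]⟩
  · exact ⟨⊥, by simp [h]⟩

instance Def.imp (P Q : (Fin n → M) → Prop) [hP : Def P] [hQ : Def Q] :
    Def fun v => P v → Q v := by
  obtain ⟨φ, hφ⟩ := hP; obtain ⟨ψ, hψ⟩ := hQ
  exact ⟨φ.imp ψ, by simp [hφ, hψ]⟩

instance Def.not (P : (Fin n → M) → Prop) [hP : Def P] : Def fun v => ¬ P v := by
  obtain ⟨φ, hφ⟩ := hP
  exact ⟨φ.not, by simp [hφ]⟩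

instance Def.and (P Q : (Fin n → M) → Prop) [hP : Def P] [hQ : Def Q] :
    Def fun v => P v ∧ Q v := by
  obtain ⟨φ, hφ⟩ := hP; obtain ⟨ψ, hψ⟩ := hQ
  exact ⟨φ ⊓ ψ, by simp [hφ, hψ]⟩

instance Def.or (P Q : (Fin n → M) → Prop) [hP : Def P] [hQ : Def Q] :
    Def fun v => P v ∨ Q v := by
  obtain ⟨φ, hφ⟩ := hP; obtain ⟨ψ, hψ⟩ := hQ
  exact ⟨φ ⊔ ψ, by simp [hφ, hψ]⟩

instance Def.iff (P Q : (Fin n → M) → Prop) [hP : Def P] [hQ : Def Q] :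
    Def fun v => (P v ↔ Q v) := by
  obtain ⟨φ, hφ⟩ := hP; obtain ⟨ψ, hψ⟩ := hQ
  exact ⟨φ.iff ψ, by simp [hφ, hψ]⟩

instance Def.all (P : (Fin n → M) → M → Prop)
    [h : Def fun w : Fin (n + 1) → M => P (ini w) (lst w)] : Def fun v => ∀ z, P v z := by
  obtain ⟨φ, hφ⟩ := h
  exact ⟨φ.all, by simp [hφ]⟩

instance Def.ex (P : (Fin n → M) → M → Prop)
    [h : Def fun w : Fin (n + 1) → M => P (ini w) (lst w)] : Def fun v => ∃ z, P v z := by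
  obtain ⟨φ, hφ⟩ := h
  exact ⟨φ.ex, by simp [hφ]⟩

theorem Def.comp {P : (Fin k → M) → Prop} (h : Def P) (σ : Fin k → Fin n) :
    Def fun w : Fin n → M => P (fun i => w (σ i)) := by
  obtain ⟨φ, hφ⟩ := h
  refine ⟨BoundedFormula.relabel (n := n) (k := 0)
    (Sum.elim Sum.inl (fun i => Sum.inr (σ i))) φ.toFormula, fun v => ?_⟩
  rw [← hφ, BoundedFormula.realize_relabel, Formula.boundedFormula_realize_eq_realize,
    BoundedFormula.realize_toFormula]
  rfl

instance : Proj (fun w : Fin n → M => w) := ⟨id, fun _ _ => rfl⟩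
instance (f : (Fin n → M) → (Fin (k + 1) → M)) [h : Proj f] : Proj fun w => ini (f w) := by
  obtain ⟨σ, hσ⟩ := h
  exact ⟨fun i => σ i.castSucc, fun w i => hσ w _⟩

instance : Proj (ini : (Fin (n + 1) → M) → (Fin n → M)) := ⟨fun i => i.castSucc, fun _ _ => rfl⟩

theorem Def.eq_var (i j : Fin n) : Def fun w : Fin n → M => w i = w j :=
  ⟨(Term.var (Sum.inr i)).bdEqual (Term.var (Sum.inr j)), fun v => by simp⟩

instance DefF.proj (f : (Fin n → M) → (Fin (k + 1) → M)) [h : Proj f] :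
    DefF fun w => lst (f w) := by
  obtain ⟨σ, hσ⟩ := h
  refine ⟨(Def.eq_var (Fin.last n) (σ (Fin.last k)).castSucc).congr fun w => ?_⟩
  rw [lst, lst, hσ]; rfl

instance DefF.last : DefF (lst : (Fin (n + 1) → M) → M) := DefF.proj fun w => w

instance DefF.const (a : M) : DefF fun _ : Fin n → M => a :=
  ⟨⟨(Term.var (Sum.inr (Fin.last n))).bdEqual (Term.var (Sum.inl a)), fun v => by simp [lst]⟩⟩

theorem Proj.def {P : (Fin k → M) → Prop} (h : Def P) (p : (Fin n → M) → (Fin k → M))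
    [hp : Proj p] : Def fun w => P (p w) := by
  obtain ⟨σ, hσ⟩ := hp
  exact (h.comp σ).congr fun w => by rw [← funext (hσ w)]

instance (priority := low) Def.proj (P : (Fin k → M) → Prop) (p : (Fin n → M) → (Fin k → M))
    [h : Def P] [hp : Proj p] : Def fun w => P (p w) := Proj.def h p

instance DefF.comp_proj (f : (Fin k → M) → M) (p : (Fin n → M) → (Fin k → M))
    [h : DefF f] [hp : Proj p] : DefF fun w => f (p w) := by
  obtain ⟨σ, hσ⟩ := hp
  refine ⟨(h.out.comp (n := n + 1)
    (Fin.snoc (fun i => (σ i).castSucc) (Fin.last _))).congr fun w => ?_⟩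
  have : ini (fun i => w ((Fin.snoc (fun i => (σ i).castSucc) (Fin.last _) :
      Fin (k + 1) → Fin (n + 1)) i)) = p (ini w) := by
    funext i; rw [hσ]; simp [ini]
  rw [this]; simp [lst]

/-- A definable function is not a term, so it is substituted by quantifying over its value: `∃ z, z
= f v ∧ P v z`. -/
theorem Def.subst {P : (Fin n → M) → M → Prop}
    (h : Def fun w : Fin (n + 1) → M => P (ini w) (lst w)) {f : (Fin n → M) → M} (hf : DefF f) :
    Def fun v => P v (f v) := by
  have := hf.out
  have : Def fun v => ∃ z, z = f v ∧ P v z :=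
    Def.ex _ (h := Def.and (fun w => lst w = f (ini w)) _)
  exact this.congr fun v => by simp

theorem Def.subst₂ {P : M → M → Prop} (h : Def2 P)
    {f g : (Fin n → M) → M} (hf : DefF f) (hg : DefF g) :
    Def fun v => P (f v) (g v) := by
  refine Def.subst (P := fun v z => P (f v) z) ?_ hg
  refine Def.subst (n := n + 1) (P := fun v z => P z (lst v)) ?_ (DefF.comp_proj f ini)
  refine (h.out.comp (n := n + 2) ![Fin.last _, (Fin.last _).castSucc]).congr fun w => ?_
  rfl

instance Def.mem (f g : (Fin n → M) → M) [hf : DefF f] [hg : DefF g] :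
    Def fun v => f v ε g v := by
  refine Def.subst₂ ⟨⟨Relations.boundedFormula₂ (L := Lset) SetRel.mem (Term.var (Sum.inr 0))
    (Term.var (Sum.inr 1)), fun v => ?_⟩⟩ hf hg
  exact BoundedFormula.realize_rel₂

instance Def.eq (f g : (Fin n → M) → M) [hf : DefF f] [hg : DefF g] :
    Def fun v => f v = g v :=
  Def.subst₂ ⟨Def.eq_var 0 1⟩ hf hg

instance (priority := low) Def.app1 (P : M → Prop) (f : (Fin n → M) → M) [h : Def1 P]
    [hf : DefF f] : Def fun v => P (f v) := by
  refine Def.subst (P := fun _ z => P z) ?_ hf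
  exact h.out.comp (n := n + 1) (fun _ => Fin.last n)

instance (priority := low) Def.app2 (P : M → M → Prop) (f g : (Fin n → M) → M) [h : Def2 P]
    [hf : DefF f] [hg : DefF g] : Def fun v => P (f v) (g v) := Def.subst₂ h hf hg

instance (P : M → Prop) [h : Def fun w : Fin 1 → M => P (lst w)] : Def1 P := ⟨h⟩
instance (P : M → M → Prop) [h : Def fun w : Fin 2 → M => P (lst (ini w)) (lst w)] :
    Def2 P := ⟨h⟩
instance (f : M → M) [h : DefF fun w : Fin 1 → M => f (lst w)] : Fun1 f := ⟨h⟩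

theorem DefF.of_graph {f : (Fin n → M) → M} {Q : (Fin n → M) → M → Prop}
    (h : Def fun w : Fin (n + 1) → M => Q (ini w) (lst w)) (hQ : ∀ v z, Q v z ↔ z = f v) :
    DefF f := ⟨h.congr fun _ => hQ _ _⟩

instance (priority := low) DefF.app1 (g : M → M) (f : (Fin n → M) → M) [h : Fun1 g]
    [hf : DefF f] : DefF fun v => g (f v) := by
  have h2 : Def2 fun y z : M => z = g y := ⟨h.out.out⟩
  exact ⟨Def.app2 (fun y z => z = g y) (fun w => f (ini w)) lst⟩

instance (priority := low) Def.app_proj (P : (Fin k → M) → M → Prop)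
    (p : (Fin n → M) → (Fin k → M)) (f : (Fin n → M) → M)
    [h : Def fun w : Fin (k + 1) → M => P (ini w) (lst w)] [hp : Proj p] [hf : DefF f] :
    Def fun v => P (p v) (f v) := by
  refine Def.subst (P := fun v z => P (p v) z) ?_ hf
  obtain ⟨σ, hσ⟩ := hp
  refine (h.comp (n := n + 1) (Fin.snoc (fun i => (σ i).castSucc) (Fin.last _))).congr fun w => ?_
  have : ini (fun i => w ((Fin.snoc (fun i => (σ i).castSucc) (Fin.last _) :
      Fin (k + 1) → Fin (n + 1)) i)) = p (ini w) := by
    funext i; rw [hσ]; simp [ini]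
  rw [this]; simp [lst]

instance (priority := low) DefF.app_proj (g : (Fin k → M) → M → M)
    (p : (Fin n → M) → (Fin k → M)) (f : (Fin n → M) → M)
    [h : DefF fun w : Fin (k + 1) → M => g (ini w) (lst w)] [hp : Proj p] [hf : DefF f] :
    DefF fun v => g (p v) (f v) := by
  refine ⟨Def.subst (n := n + 1) (P := fun w z => lst w = g (p (ini w)) z) ?_
    (DefF.comp_proj f ini)⟩
  obtain ⟨σ, hσ⟩ := hp
  refine (h.out.comp (n := n + 2) (Fin.snoc (Fin.snoc (fun i => (σ i).castSucc.castSucc)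
    (Fin.last _)) (Fin.last _).castSucc)).congr fun w => ?_
  have : ini (ini (fun i => w ((Fin.snoc (Fin.snoc (fun i => (σ i).castSucc.castSucc)
      (Fin.last _)) (Fin.last _).castSucc : Fin (k + 2) → Fin (n + 2)) i))) = p (ini (ini w)) := by
    funext i; rw [hσ]; simp [ini]
  rw [this]; simp [lst, ini]

theorem Def.substs {P : (Fin k → M) → Prop} (h : Def P) (f : Fin k → (Fin n → M) → M)
    (hf : ∀ i, DefF (f i)) : Def fun v => P (fun i => f i v) := by
  -- `Q` must also see the original tuple: once the last function has been substituted, its value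
  -- depends on that tuple.
  suffices H : ∀ (Q : (Fin n → M) → (Fin k → M) → Prop),
      Def (fun w : Fin (n + k) → M => Q (fun i => w (i.castAdd k)) (fun i => w (i.natAdd n))) →
      Def fun v => Q v (fun i => f i v) from
    H (fun _ => P) (h.comp _)
  clear h P
  induction k with
  | zero =>
    intro Q h
    exact (h.comp (n := n) id).congr fun v => by
      rw [iff_iff_eq]; congr; funext i; exact i.elim0
  | succ k ih =>
    intro Q h
    have := ih (fun i => f i.castSucc) (fun i => hf _)
      (fun v zs => Q v (Fin.snoc zs (f (Fin.last k) v))) ?_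
    · refine this.congr fun v => ?_
      rw [iff_iff_eq]; congr; funext i
      refine Fin.lastCases ?_ (fun i => ?_) i <;> simp
    · have : Proj fun (w : Fin (n + k) → M) (i : Fin n) => w (i.castAdd k) :=
        ⟨fun i => i.castAdd k, fun _ _ => rfl⟩
      have := hf (Fin.last k)
      have hw : DefF fun w : Fin (n + k) → M => f (Fin.last k) (fun i => w (i.castAdd k)) :=
        DefF.comp_proj _ _
      refine Def.subst (P := fun (w : Fin (n + k) → M) z =>
        Q (fun i => w (i.castAdd k)) (Fin.snoc (fun i => w (i.natAdd n)) z)) ?_ hw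
      refine h.congr fun w => ?_
      rw [iff_iff_eq]; congr; funext i
      refine Fin.lastCases ?_ (fun i => ?_) i
      · simp [lst]
      · simp [ini]

variable (f g : (Fin n → M) → M) [DefF f] [DefF g]

instance : Def fun v => IsEmp (f v) := by unfold IsEmp; infer_instance
instance : Def fun v => Sub (f v) (g v) := by unfold Sub; infer_instance
instance : Def fun v => IsSucc (f v) (g v) := by unfold IsSucc; infer_instance
instance : Def fun v => Trans (f v) := by unfold Trans; infer_instance
instance : Def fun v => Ord (f v) := by unfold Ord; infer_instance

end Definability

/-! ### The axioms of ZFC, semantically -/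

section Axioms

variable {M : Type u} [Lset.Structure M]

/-- A formula with parameters from `M` mentions only finitely many of them. Listing these gives the
finite tuple of parameters over which the schemas of Separation and Replacement quantify. -/
theorem Def.exists_formula {k : ℕ} {P : (Fin k → M) → Prop} (h : Def P) :
    ∃ (n : ℕ) (φ : Lset.Formula (Fin n ⊕ Fin k)) (p : Fin n → M),
      ∀ v, φ.Realize (Sum.elim p v) ↔ P v := by
  classical
  obtain ⟨φ, hφ⟩ := h
  let e := φ.freeVarFinset.equivFin
  refine ⟨_, (φ.restrictFreeVar e).toFormula, fun i => (e.symm i : M), fun v => ?_⟩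
  rw [BoundedFormula.realize_toFormula, ← hφ]
  exact BoundedFormula.realize_restrictFreeVar id (by simp)

variable [hM : ZFC.Model M]

theorem ext {y z : M} (h : ∀ w, w ε y ↔ w ε z) : y = z := by
  have : M ⊨ extensionality := ZFC.realize_sentence_of_mem (by simp [ZFC])
  simp [extensionality, Sentence.Realize, Formula.Realize, Fin.snoc] at this
  exact this y z h

theorem found (y : M) : IsEmp y ∨ ∃ z, z ε y ∧ ∀ w, w ε y → ¬ w ε z := by
  have : M ⊨ foundation := ZFC.realize_sentence_of_mem (by simp [ZFC])
  simp [foundation, Sentence.Realize, Formula.Realize, Fin.snoc] at this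
  exact this y

theorem pairing_ax (y z : M) : ∃ s, IsUPair s y z := by
  have : M ⊨ pairing := ZFC.realize_sentence_of_mem (by simp [ZFC])
  simp [pairing, Sentence.Realize, Formula.Realize, Fin.snoc] at this
  exact this y z

theorem union_ax (y : M) : ∃ z, ∀ w, w ε z ↔ ∃ s, s ε y ∧ w ε s := by
  have : M ⊨ unionAx := ZFC.realize_sentence_of_mem (by simp [ZFC])
  simp [unionAx, Sentence.Realize, Formula.Realize, Fin.snoc] at this
  exact this y

theorem power_ax (y : M) : ∃ z, ∀ w, w ε z ↔ Sub w y := by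
  have : M ⊨ powerset := ZFC.realize_sentence_of_mem (by simp [ZFC])
  simp [powerset, Sentence.Realize, Formula.Realize, Fin.snoc] at this
  exact this y

variable (M) in
theorem infinity_ax : ∃ y : M, (∃ z, z ε y ∧ IsEmp z) ∧ ∀ z, z ε y → ∃ w, w ε y ∧ IsSucc w z := by
  have : M ⊨ infinity := ZFC.realize_sentence_of_mem (by simp [ZFC])
  simp [infinity, Sentence.Realize, Formula.Realize, Fin.snoc] at this
  exact this

theorem choice_ax (y : M) : ∃ f a, Ord a ∧ IsBij f y a := by
  have : M ⊨ choiceAx := ZFC.realize_sentence_of_mem (by simp [ZFC])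
  simp [choiceAx, Sentence.Realize, Formula.Realize, Fin.snoc] at this
  exact this y

theorem sep_ax (y : M) (P : M → Prop) [h : Def1 P] : ∃ z, ∀ w, w ε z ↔ w ε y ∧ P w := by
  obtain ⟨n, φ, p, hφ⟩ := h.out.exists_formula
  let ψ : Lset.Formula (Fin (n + 1)) := φ.relabel (Sum.elim Fin.succ (fun _ => 0))
  have : M ⊨ separation ψ := ZFC.realize_sentence_of_mem (Or.inl (Or.inr ⟨n, ψ, rfl⟩))
  rw [separation, realize_close] at this
  have := this p
  simp only [Formula.Realize, BoundedFormula.realize_all, BoundedFormula.realize_ex,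
    BoundedFormula.realize_iff, BoundedFormula.realize_inf, realize_mem] at this
  obtain ⟨z, hz⟩ := this y
  refine ⟨z, fun w => ?_⟩
  have := hz w
  simp only [val_inr] at this
  refine this.trans (and_congr Iff.rfl ?_)
  refine BoundedFormula.realize_relabel.trans ?_
  rw [Formula.boundedFormula_realize_eq_realize, Formula.realize_relabel]
  have := hφ (fun _ => w)
  simp only [lst] at this
  rw [← this]
  refine iff_of_eq (congrArg φ.Realize (funext fun i => ?_))
  rcases i with i | i
  · simp
  · simp [Fin.snoc]

theorem repl_ax (y : M) (P : M → M → Prop) [h : Def2 P]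
    (hP : ∀ a, a ε y → ∀ c d, P a c → P a d → c = d) :
    ∃ z, ∀ w, w ε z ↔ ∃ a, a ε y ∧ P a w := by
  obtain ⟨n, φ, p, hφ⟩ := h.out.exists_formula
  let ψ : Lset.Formula (Fin (n + 2)) := φ.relabel (Sum.elim (fun i => i.succ.succ) ![0, 1])
  have key : ∀ (m : ℕ) (a c : Fin n ⊕ Fin m) (xs : Fin m → M),
      (BoundedFormula.relabel (Fin.cons a (Fin.cons c x) : Fin (n + 2) → Fin n ⊕ Fin m) ψ).Realize
        p xs
        ↔ P (val p xs a) (val p xs c) := by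
    intro m a c xs
    refine BoundedFormula.realize_relabel.trans ?_
    rw [Formula.boundedFormula_realize_eq_realize, Formula.realize_relabel]
    have := hφ ![val p xs a, val p xs c]
    simp only [lst, ini] at this
    refine Iff.trans (iff_of_eq (congrArg φ.Realize (funext fun i => ?_))) this
    rcases i with i | i
    · simp
    · refine Fin.cases ?_ (fun i => ?_) i
      · simp [val]
      · rw [Subsingleton.elim i 0]; simp [val]
  have : M ⊨ replacement ψ := ZFC.realize_sentence_of_mem (Or.inr ⟨n, ψ, rfl⟩)
  rw [replacement, realize_close] at this
  have := this p
  simp only [Formula.Realize, BoundedFormula.realize_all, BoundedFormula.realize_ex,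
    BoundedFormula.realize_iff, BoundedFormula.realize_inf, BoundedFormula.realize_imp, realize_mem,
    realize_eq, realize_bEx, realize_bAll] at this
  obtain ⟨z, hz⟩ := this y (by
    intro a ha c d ⟨h1, h2⟩
    have h1 := (key _ _ _ _).1 h1
    have h2 := (key _ _ _ _).1 h2
    simp [Fin.snoc] at h1 h2 ha ⊢
    exact hP a ha c d h1 h2)
  refine ⟨z, fun w => (hz w).trans ?_⟩
  refine exists_congr fun a => and_congr Iff.rfl ((key _ _ _ _).trans ?_)
  simp [Fin.snoc]

end Axioms

/-! ### Set-theoretic operations in a model of ZFC -/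

section Operations

variable {M : Type u} [Lset.Structure M] [hM : ZFC.Model M] {n : ℕ}

variable (M) in
theorem exists_isEmp : ∃ y : M, IsEmp y := by
  obtain ⟨-, ⟨z, -, hz⟩, -⟩ := infinity_ax M
  exact ⟨z, hz⟩

/-- The empty set. -/
def emp : M := (exists_isEmp M).choose

@[simp] theorem not_mem_emp (z : M) : ¬ z ε (emp : M) := (exists_isEmp M).choose_spec z

def IsSet (P : M → Prop) : Prop := ∃ y, ∀ z, z ε y ↔ P z

open Classical in
/-- The set `{z : P z}`, if there is one. -/
def mk (P : M → Prop) : M := if h : IsSet P then h.choose else emp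

theorem mem_mk {P : M → Prop} (h : IsSet P) {z : M} : z ε mk P ↔ P z := by
  rw [mk, dif_pos h]; exact h.choose_spec z

open Classical in
/-- The unique `y` with `P y`, if there is one. -/
def the (P : M → Prop) : M := if h : ∃! y, P y then h.choose else emp

theorem the_spec {P : M → Prop} (h : ∃! y, P y) : P (the P) := by
  rw [the, dif_pos h]; exact h.choose_spec.1

theorem the_eq {P : M → Prop} {y : M} (h : P y) (hu : ∀ z, P z → z = y) : the P = y :=
  hu _ (the_spec ⟨y, h, hu⟩)

theorem the_eq_emp {P : M → Prop} (h : ¬ ∃! y, P y) : the P = emp := by rw [the, dif_neg h]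

/-- The default value `emp` is one more definable case, so the description operator is definable
without any hypothesis of existence or uniqueness. -/
instance defF_the (P : (Fin n → M) → M → Prop)
    [h : Def fun w : Fin (n + 1) → M => P (ini w) (lst w)] : DefF fun v => the (P v) := by
  refine DefF.of_graph (Q := fun v y => (P v y ∧ ∀ z, P v z → z = y) ∨
    ((¬ ∃ y, P v y ∧ ∀ z, P v z → z = y) ∧ y = emp)) ?_ fun v y => ?_
  · infer_instance
  · constructor
    · rintro (⟨h, hu⟩ | ⟨h, rfl⟩)
      · exact (the_eq h hu).symm
      · exact (the_eq_emp h).symm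
    · rintro rfl
      by_cases h : ∃! y, P v y
      · exact Or.inl ⟨the_spec h, fun z hz => h.unique hz (the_spec h)⟩
      · exact Or.inr ⟨h, the_eq_emp h⟩

theorem mk_eq_the (P : M → Prop) : mk P = the fun y => ∀ z, z ε y ↔ P z := by
  by_cases h : IsSet P
  · refine (the_eq (fun z => mem_mk h) fun y hy => ext fun w => ?_).symm
    rw [hy, mem_mk h]
  · rw [mk, dif_neg h, the_eq_emp]
    exact fun ⟨y, hy, _⟩ => h ⟨y, hy⟩

instance defF_mk (P : (Fin n → M) → M → Prop)
    [h : Def fun w : Fin (n + 1) → M => P (ini w) (lst w)] : DefF fun v => mk (P v) := by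
  simp only [mk_eq_the]
  infer_instance

/-- `{a, c}` -/
def upair (a c : M) : M := mk fun z => z = a ∨ z = c
/-- `(a, c)` -/
def pr (a c : M) : M := upair (upair a a) (upair a c)
def sUnion (a : M) : M := mk fun z => ∃ s, s ε a ∧ z ε s
def union (a c : M) : M := sUnion (upair a c)
def pow (a : M) : M := mk fun z => Sub z a
def sep (a : M) (P : M → Prop) : M := mk fun z => z ε a ∧ P z
/-- `{f x : x ∈ a}` -/
def img (f : M → M) (a : M) : M := mk fun y => ∃ x, x ε a ∧ y = f x
def prod (a c : M) : M := sUnion (img (fun x => img (fun y => pr x y) c) a)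
/-- The value of the function `f` at `x`. -/
def app (f x : M) : M := the fun y => pr x y ε f
/-- The function `x ↦ g x` with domain `s`. -/
def lam (s : M) (g : M → M) : M := img (fun x => pr x (g x)) s
def fst (p : M) : M := the fun a => ∃ c, p = pr a c
def snd (p : M) : M := the fun c => ∃ a, p = pr a c
def suc (a : M) : M := union a (upair a a)
/-- `a` if `p` holds, `c` otherwise. -/
def cond (p : Prop) (a c : M) : M := the fun y => (p ∧ y = a) ∨ (¬ p ∧ y = c)

section Instances

variable (f g : (Fin n → M) → M) [hf : DefF f] [hg : DefF g]

instance : DefF fun v => upair (f v) (g v) := by unfold upair; infer_instance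
instance : DefF fun v => pr (f v) (g v) := by unfold pr; infer_instance
instance : DefF fun v => sUnion (f v) := by unfold sUnion; infer_instance
instance : DefF fun v => union (f v) (g v) := by unfold union; infer_instance
instance defF_sep (P : (Fin n → M) → M → Prop)
    [Def fun w : Fin (n + 1) → M => P (ini w) (lst w)] : DefF fun v => sep (f v) (P v) := by
  unfold sep; infer_instance
instance defF_img (h : (Fin n → M) → M → M)
    [DefF fun w : Fin (n + 1) → M => h (ini w) (lst w)] :
    DefF fun v => img (h v) (f v) := by
  unfold img; infer_instance
instance : DefF fun v => prod (f v) (g v) := by unfold prod; infer_instance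
instance : DefF fun v => app (f v) (g v) := by unfold app; infer_instance
instance defF_lam (h : (Fin n → M) → M → M)
    [DefF fun w : Fin (n + 1) → M => h (ini w) (lst w)] :
    DefF fun v => lam (f v) (h v) := by
  unfold lam; infer_instance
instance : DefF fun v => fst (f v) := by unfold fst; infer_instance
instance : DefF fun v => snd (f v) := by unfold snd; infer_instance
instance : DefF fun v => suc (f v) := by unfold suc; infer_instance
instance defF_cond (P : (Fin n → M) → Prop) [Def P] :
    DefF fun v => cond (P v) (f v) (g v) := by unfold cond; infer_instance

end Instances

end Operations

/-! ### Elementary operations on sets. -/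

section Basic

variable {M : Type u} [Lset.Structure M] [hM : ZFC.Model M] {n : ℕ}

theorem IsSet.of_sub {P Q : M → Prop} [h : Def1 P] (hQ : IsSet Q) (hPQ : ∀ z, P z → Q z) :
    IsSet P := by
  obtain ⟨y, hy⟩ := hQ
  obtain ⟨z, hz⟩ := sep_ax y P
  exact ⟨z, fun w => (hz w).trans ⟨fun h => h.2, fun h => ⟨(hy w).2 (hPQ w h), h⟩⟩⟩

@[simp] theorem mem_upair {a c z : M} : z ε upair a c ↔ z = a ∨ z = c := by
  refine mem_mk ?_
  obtain ⟨s, h1, h2, h3⟩ := pairing_ax a c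
  exact ⟨s, fun z => ⟨h3 z, by rintro (rfl | rfl) <;> assumption⟩⟩

@[simp] theorem mem_sUnion {a z : M} : z ε sUnion a ↔ ∃ s, s ε a ∧ z ε s := mem_mk (union_ax a)

@[simp] theorem mem_union {a c z : M} : z ε union a c ↔ z ε a ∨ z ε c := by simp [union]

@[simp] theorem mem_pow {a z : M} : z ε pow a ↔ Sub z a := mem_mk (power_ax a)

@[simp] theorem mem_sep {a z : M} {P : M → Prop} [h : Def1 P] : z ε sep a P ↔ z ε a ∧ P z :=
  mem_mk (sep_ax a P)

@[simp] theorem mem_img {a y : M} {f : M → M} [h : Fun1 f] :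
    y ε img f a ↔ ∃ x, x ε a ∧ y = f x := by
  have : Def2 fun x y => y = f x := ⟨h.out.out⟩
  exact mem_mk (repl_ax a _ fun _ _ c d hc hd => hc.trans hd.symm)

theorem mem_img_of {a x : M} {f : M → M} [h : Fun1 f] (hx : x ε a) : f x ε img f a :=
  mem_img.2 ⟨x, hx, rfl⟩

theorem img_congr {f g : M → M} {a : M} (h : ∀ x, x ε a → f x = g x) : img f a = img g a := by
  unfold img
  congr; funext y; apply propext
  exact exists_congr fun x => and_congr_right fun hx => by rw [h x hx]

@[simp] theorem mem_suc {a z : M} : z ε suc a ↔ z ε a ∨ z = a := by simp [suc]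

theorem sub_refl (a : M) : Sub a a := fun _ h => h
theorem Sub.trans {a c d : M} (h : Sub a c) (h' : Sub c d) : Sub a d := fun z hz => h' z (h z hz)
theorem Sub.antisymm {a c : M} (h : Sub a c) (h' : Sub c a) : a = c := ext fun w => ⟨h w, h' w⟩

theorem eq_upair_iff {s a c : M} : IsUPair s a c ↔ s = upair a c := by
  constructor
  · rintro ⟨h1, h2, h3⟩
    refine ext fun z => ⟨fun h => by simpa using h3 z h, fun h => ?_⟩
    rcases mem_upair.1 h with rfl | rfl <;> assumption
  · rintro rfl
    simp [IsUPair]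

theorem upair_self_inj {a c : M} (h : upair a a = upair c c) : a = c := by
  have : a ε upair c c := h ▸ (by simp)
  simpa using this

theorem pr_inj {a c a' c' : M} : pr a c = pr a' c' ↔ a = a' ∧ c = c' := by
  constructor
  · intro h
    have h1 : ∀ z, z = upair a a ∨ z = upair a c ↔ z = upair a' a' ∨ z = upair a' c' := fun z => by
      simpa [pr] using (iff_of_eq (congrArg (E z) h))
    have ha : a = a' := by
      rcases (h1 _).1 (Or.inl rfl) with h | h
      · exact upair_self_inj h
      · have : a' ε upair a a := h ▸ (by simp)
        simpa [eq_comm] using this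
    subst ha
    refine ⟨rfl, ?_⟩
    have h2 : c ε upair a c' ∨ c = a := by
      rcases (h1 _).1 (Or.inr rfl) with h | h
      · have : c ε upair a a := h ▸ (by simp)
        exact Or.inr (by simpa using this)
      · exact Or.inl (h ▸ (by simp))
    have h3 : c' ε upair a c ∨ c' = a := by
      rcases (h1 _).2 (Or.inr rfl) with h | h
      · have : c' ε upair a a := h ▸ (by simp)
        exact Or.inr (by simpa using this)
      · exact Or.inl (h ▸ (by simp))
    simp only [mem_upair] at h2 h3
    rcases h2 with (rfl | rfl) | rfl <;> rcases h3 with (h3 | h3) | h3 <;> simp_all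
  · rintro ⟨rfl, rfl⟩; rfl

@[simp] theorem isPair_iff {p a c : M} : IsPair p a c ↔ p = pr a c := by
  constructor
  · rintro ⟨s, -, t, -, h1, h2, h3⟩
    rw [eq_upair_iff] at h1 h2 h3
    subst h1 h2; exact h3
  · rintro rfl
    exact ⟨upair a a, by simp [pr], upair a c, by simp [pr], eq_upair_iff.2 rfl,
      eq_upair_iff.2 rfl, eq_upair_iff.2 rfl⟩

@[simp] theorem pairMem_iff {f a c : M} : PairMem f a c ↔ pr a c ε f := by
  simp [PairMem]

@[simp] theorem isSucc_iff {y z : M} : IsSucc y z ↔ y = suc z := by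
  constructor
  · rintro ⟨h1, h2, h3⟩
    refine ext fun w => ⟨fun h => by simpa using h3 w h, fun h => ?_⟩
    rcases mem_suc.1 h with h | rfl
    · exact h2 w h
    · exact h1
  · rintro rfl
    simp [IsSucc, Sub]
    tauto

@[simp] theorem fst_pr (a c : M) : fst (pr a c) = a :=
  the_eq ⟨c, rfl⟩ fun _ ⟨_, hd⟩ => (pr_inj.1 hd).1.symm

@[simp] theorem snd_pr (a c : M) : snd (pr a c) = c :=
  the_eq ⟨a, rfl⟩ fun _ ⟨_, hd⟩ => (pr_inj.1 hd).2.symm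

@[simp] theorem mem_prod {a c p : M} : p ε prod a c ↔ ∃ x, x ε a ∧ ∃ y, y ε c ∧ p = pr x y := by
  simp only [prod, mem_sUnion, mem_img]
  constructor
  · rintro ⟨s, ⟨x, hx, rfl⟩, h⟩
    obtain ⟨y, hy, rfl⟩ := mem_img.1 h
    exact ⟨x, hx, y, hy, rfl⟩
  · rintro ⟨x, hx, y, hy, rfl⟩
    exact ⟨_, ⟨x, hx, rfl⟩, mem_img.2 ⟨y, hy, rfl⟩⟩

theorem pr_mem_prod {a c x y : M} : pr x y ε prod a c ↔ x ε a ∧ y ε c := by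
  simp only [mem_prod, pr_inj]
  constructor
  · rintro ⟨x, hx, y, hy, rfl, rfl⟩; exact ⟨hx, hy⟩
  · rintro ⟨hx, hy⟩; exact ⟨x, hx, y, hy, rfl, rfl⟩

theorem pr_mem_lam {s x y : M} {g : M → M} [h : Fun1 g] :
    pr x y ε lam s g ↔ x ε s ∧ y = g x := by
  simp only [lam, mem_img, pr_inj]
  constructor
  · rintro ⟨x, hx, rfl, rfl⟩; exact ⟨hx, rfl⟩
  · rintro ⟨hx, rfl⟩; exact ⟨x, hx, rfl, rfl⟩

theorem app_lam {s x : M} {g : M → M} [h : Fun1 g] (hx : x ε s) : app (lam s g) x = g x :=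
  the_eq (pr_mem_lam.2 ⟨hx, rfl⟩) fun _ hz => (pr_mem_lam.1 hz).2

theorem cond_pos {p : Prop} (h : p) (a c : M) : cond p a c = a :=
  the_eq (Or.inl ⟨h, rfl⟩) fun _ _ => by tauto

theorem cond_neg {p : Prop} (h : ¬ p) (a c : M) : cond p a c = c :=
  the_eq (Or.inr ⟨h, rfl⟩) fun _ _ => by tauto

/-! ### Foundation -/

/-- Foundation applied to the subset of `s` cut out by `P`; definability of `P` is what makes this
subset an element of `M`. -/
theorem exists_min (s : M) (P : M → Prop) [Def1 P] (h : ∃ z, z ε s ∧ P z) :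
    ∃ z, z ε s ∧ P z ∧ ∀ w, w ε s → P w → ¬ w ε z := by
  obtain ⟨z, hz⟩ := h
  rcases found (sep s P) with h | ⟨m, hm, h⟩
  · exact absurd (mem_sep.2 hz) (h z)
  · have := mem_sep.1 hm
    exact ⟨m, this.1, this.2, fun w hw hP => h w (mem_sep.2 ⟨hw, hP⟩)⟩

theorem not_mem_self (a : M) : ¬ a ε a := by
  intro h
  obtain ⟨z, hz, -, hm⟩ := exists_min (upair a a) (fun z => z = a) ⟨a, by simp⟩
  simp at hz; subst hz
  exact hm z (by simp) rfl h

theorem mem_asymm {a c : M} (h : a ε c) : ¬ c ε a := by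
  intro h'
  obtain ⟨z, hz, -, hm⟩ := exists_min (upair a c) (fun z => z ε upair a c) ⟨a, by simp⟩
  rcases mem_upair.1 hz with rfl | rfl
  · exact hm c (by simp) (by simp) h'
  · exact hm a (by simp) (by simp) h

theorem trans_induction {t : M} (ht : Trans t) (P : M → Prop) [h1 : Def1 P]
    (h : ∀ x, x ε t → (∀ y, y ε x → P y) → P x) : ∀ x, x ε t → P x := by
  intro x hx
  by_contra hP
  obtain ⟨z, hz, hPz, hm⟩ := exists_min t (fun z => ¬ P z) ⟨x, hx, hP⟩
  refine hPz (h z hz fun y hy => ?_)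
  by_contra hy'
  exact hm y (ht z hz y hy) hy' hy

/-! ### Ordinals -/

theorem Ord.mem {a x : M} (h : Ord a) (hx : x ε a) : Ord x :=
  ⟨h.2 x hx, fun z hz => h.2 z (h.1 x hx z hz)⟩

theorem Ord.trans {a x y : M} (h : Ord a) (hx : x ε a) (hy : y ε x) : y ε a := h.1 x hx y hy

theorem Trans.suc {a : M} (h : Trans a) : Trans (suc a) := by
  intro z hz w hw
  rw [mem_suc] at hz ⊢
  rcases hz with hz | rfl
  · exact Or.inl (h z hz w hw)
  · exact Or.inl hw

theorem Ord.suc {a : M} (h : Ord a) : Ord (suc a) := by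
  refine ⟨h.1.suc, fun z hz => ?_⟩
  rcases mem_suc.1 hz with hz | rfl
  · exact h.2 z hz
  · exact h.1

/-- Take an `∈`-minimal `x ≤ a` that is incomparable with some `y ≤ c`, and then a minimal such `y`.
Every element of either one is comparable with the other, and transitivity puts it inside, so `x =
y` by extensionality. Working below the successors lets `x` and `y` range up to `a` and `c`
themselves. -/
theorem Ord.linear {a c : M} (ha : Ord a) (hc : Ord c) : a ε c ∨ a = c ∨ c ε a := by
  by_contra hn
  let Q : M → M → Prop := fun x y => ¬ (x ε y ∨ x = y ∨ y ε x)
  have : Def2 Q := by infer_instance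
  obtain ⟨x, hx, hPx, hmx⟩ := exists_min (AMC.suc a) (fun x => ∃ y, y ε AMC.suc c ∧ Q x y)
    ⟨a, by simp, c, by simp, hn⟩
  obtain ⟨y, hy, hQ, hmy⟩ := exists_min (AMC.suc c) (fun y => Q x y) hPx
  have hxy : x = y := by
    refine ext fun z => ⟨fun hz => ?_, fun hz => ?_⟩
    · by_contra hzy
      refine hmx z (ha.suc.trans hx hz) ⟨y, hy, ?_⟩ hz
      rintro (h | rfl | h)
      · exact hzy h
      · exact hQ (Or.inr (Or.inr hz))
      · exact hQ (Or.inr (Or.inr ((ha.suc.mem hx).trans hz h)))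
    · by_contra hzx
      refine hmy z (hc.suc.trans hy hz) ?_ hz
      rintro (h | rfl | h)
      · exact hQ (Or.inl ((hc.suc.mem hy).trans hz h))
      · exact hQ (Or.inl hz)
      · exact hzx h
  exact hQ (Or.inr (Or.inl hxy))

theorem Ord.sub_or_mem {a c : M} (ha : Ord a) (hc : Ord c) : Sub a c ∨ c ε a := by
  rcases ha.linear hc with h | rfl | h
  · exact Or.inl (hc.1 a h)
  · exact Or.inl (sub_refl _)
  · exact Or.inr h

theorem Ord.mem_of_sub_mem {a c d : M} (ha : Ord a) (hd : Ord d) (h : Sub a c) (hc : c ε d) :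
    a ε d := by
  rcases ha.linear hd with h' | rfl | h'
  · exact h'
  · exact absurd (h c hc) (not_mem_self c)
  · exact absurd (h d h') (mem_asymm hc)

theorem Ord.of_trans {a : M} (h : Trans a) (h' : ∀ z, z ε a → Ord z) : Ord a :=
  ⟨h, fun z hz => (h' z hz).1⟩

theorem Ord.suc_sub {a c : M} (hc : Ord c) (h : a ε c) : Sub (AMC.suc a) c := by
  intro z hz
  rcases mem_suc.1 hz with hz | rfl
  · exact hc.trans h hz
  · exact h

theorem Ord.exists_least {a : M} (ha : Ord a) (P : M → Prop) [Def1 P] (h : ∃ z, z ε a ∧ P z) :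
    ∃ z, z ε a ∧ P z ∧ ∀ w, w ε a → P w → Sub z w := by
  obtain ⟨z, hz, hP, hm⟩ := exists_min a P h
  refine ⟨z, hz, hP, fun w hw hPw => ?_⟩
  rcases (ha.mem hz).sub_or_mem (ha.mem hw) with h | h
  · exact h
  · exact absurd h (hm w hw hPw)

/-! ### The set of natural numbers -/

theorem isEmp_iff {a : M} : IsEmp a ↔ a = emp :=
  ⟨fun h => ext fun w => ⟨fun hw => absurd hw (h w), fun hw => absurd hw (not_mem_emp w)⟩,
    by rintro rfl; exact not_mem_emp⟩

theorem suc_inj {a c : M} (h : suc a = suc c) : a = c := by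
  have h1 : a ε suc c := h ▸ (by simp)
  have h2 : c ε suc a := h ▸ (by simp)
  rw [mem_suc] at h1 h2
  rcases h1 with h1 | h1
  · rcases h2 with h2 | h2
    · exact absurd h2 (mem_asymm h1)
    · exact h2.symm
  · exact h1

variable (M) in
-- The Axiom of Infinity only provides an inductive set `I`, possibly too large. The natural numbers
-- are the ordinals `z` such that every element of `suc z` is empty or a successor. By `∈`-induction
-- they all lie in `I`, so Separation collects them.
theorem exists_isOmega : ∃ w : M, IsOmega w := by
  obtain ⟨I, ⟨e, he, hee⟩, hI⟩ := infinity_ax M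
  rw [isEmp_iff] at hee; subst hee
  let N : M → Prop := fun z => IsEmp z ∨ ∃ w, w ε z ∧ IsSucc z w
  have : Def1 N := by infer_instance
  let P : M → Prop := fun z => Ord z ∧ ∀ y, y ε suc z → N y
  have : Def1 P := by infer_instance
  have hP : ∀ z, P z → z ε I := by
    intro z hz
    refine trans_induction hz.1.suc.1 (fun y => y ε I) (fun y hy ih => ?_) z (by simp)
    rcases hz.2 y hy with h | ⟨w, hw, h⟩
    · rw [isEmp_iff] at h; subst h; exact he
    · obtain ⟨s, hs, hs'⟩ := hI w (ih w hw)
      rw [isSucc_iff] at h hs'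
      rw [h, ← hs']; exact hs
  have hmem : ∀ z, z ε sep I P ↔ P z := fun z => by
    rw [mem_sep]; exact ⟨fun h => h.2, fun h => ⟨hP z h, h⟩⟩
  have htr : Trans (sep I P) := by
    intro z hz w hw
    rw [hmem] at hz ⊢
    refine ⟨hz.1.mem hw, fun y hy => hz.2 y ?_⟩
    exact mem_suc.2 (Or.inl ((hz.1.suc_sub hw) y hy))
  refine ⟨sep I P, ⟨⟨Ord.of_trans htr fun z hz => ((hmem z).1 hz).1, ?_⟩, ?_⟩, ?_⟩
  · intro h
    refine h emp ((hmem _).2 ⟨⟨fun z hz => absurd hz (not_mem_emp z),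
      fun z hz => absurd hz (not_mem_emp z)⟩, fun y hy => ?_⟩)
    simp at hy; subst hy; exact Or.inl not_mem_emp
  · intro z hz
    refine ⟨suc z, (hmem _).2 ?_, by simp⟩
    rw [hmem] at hz
    refine ⟨hz.1.suc, fun y hy => ?_⟩
    rcases mem_suc.1 hy with hy | rfl
    · exact hz.2 y hy
    · exact Or.inr ⟨z, by simp, isSucc_iff.2 rfl⟩
  · intro z hz
    exact ((hmem z).1 hz).2 z (by simp)

/-- By linearity it suffices that neither is an element of the other: an element of `ω` is empty or
a successor, while `ω` is nonempty and has no largest element. -/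
theorem IsOmega.eq {w w' : M} (h : IsOmega w) (h' : IsOmega w') : w = w' := by
  have key : ∀ {w w' : M}, IsOmega w → IsOmega w' → ¬ w ε w' := by
    intro w w' h h' hm
    rcases h'.2 w hm with he | ⟨z, hz, hs⟩
    · exact h.1.1.2 he
    · obtain ⟨y, hy, hzy⟩ := h.1.2 z hz
      rw [isSucc_iff] at hs
      rw [hs, mem_suc] at hy
      rcases hy with hy | rfl
      · exact mem_asymm hy hzy
      · exact not_mem_self _ hzy
  rcases h.1.1.1.linear h'.1.1.1 with h1 | h1 | h1
  · exact absurd h1 (key h h')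
  · exact h1
  · exact absurd h1 (key h' h)

/-- The set of natural numbers. -/
def omega : M := (exists_isOmega M).choose

theorem isOmega_omega : IsOmega (omega : M) := (exists_isOmega M).choose_spec

theorem ord_omega : Ord (omega : M) := isOmega_omega.1.1.1

theorem emp_mem_omega : (emp : M) ε omega := by
  obtain ⟨z, hz, -, hm⟩ := exists_min (omega : M) (fun z => z ε omega) (by
    have := (isOmega_omega (M := M)).1.1.2
    simp only [IsEmp, not_forall, not_not] at this
    obtain ⟨z, hz⟩ := this; exact ⟨z, hz, hz⟩)
  have : IsEmp z := fun w hw => hm w (ord_omega.trans hz hw) (ord_omega.trans hz hw) hw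
  rwa [isEmp_iff.1 this] at hz

theorem suc_mem_omega {z : M} (hz : z ε omega) : suc z ε omega := by
  obtain ⟨w, hw, hzw⟩ := isOmega_omega.1.2 z hz
  exact (ord_omega.mem hz).suc.mem_of_sub_mem ord_omega ((ord_omega.mem hw).suc_sub hzw) hw

theorem omega_cases {z : M} (hz : z ε omega) : z = emp ∨ ∃ w, w ε omega ∧ z = suc w := by
  rcases isOmega_omega.2 z hz with h | ⟨w, hw, h⟩
  · exact Or.inl (isEmp_iff.1 h)
  · exact Or.inr ⟨w, ord_omega.trans hz hw, isSucc_iff.1 h⟩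

theorem omega_induction (P : M → Prop) [Def1 P] (h0 : P emp)
    (hs : ∀ z, z ε omega → P z → P (suc z)) : ∀ z, z ε omega → P z := by
  refine trans_induction ord_omega.1 P fun x hx ih => ?_
  rcases omega_cases hx with rfl | ⟨w, hw, rfl⟩
  · exact h0
  · exact hs w hw (ih w (by simp))

end Basic

/-! ### Recursion on well-founded relations -/

section Recursion

variable {M : Type u} [Lset.Structure M] [hM : ZFC.Model M] {n : ℕ}

/-- Well-foundedness as `M` sees it: only subsets of `X` that are elements of `M` are tested. Minima
are thus available for definable properties, not for arbitrary external ones. -/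
def WfOn (X : M) (r : M → M → Prop) : Prop :=
  ∀ s, Sub s X → (∃ z, z ε s) → ∃ z, z ε s ∧ ∀ w, w ε s → ¬ r w z

theorem WfOn.exists_min {X : M} {r : M → M → Prop} (wf : WfOn X r) (P : M → Prop) [Def1 P]
    (h : ∃ x, x ε X ∧ P x) : ∃ x, x ε X ∧ P x ∧ ∀ y, y ε X → r y x → ¬ P y := by
  obtain ⟨x, hx, hP⟩ := h
  obtain ⟨z, hz, hm⟩ := wf (sep X P) (fun z hz => (mem_sep.1 hz).1) ⟨x, mem_sep.2 ⟨hx, hP⟩⟩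
  rw [mem_sep] at hz
  exact ⟨z, hz.1, hz.2, fun y hy hr hPy => hm y (mem_sep.2 ⟨hy, hPy⟩) hr⟩

theorem WfOn.induction {X : M} {r : M → M → Prop} (wf : WfOn X r) (P : M → Prop) [Def1 P]
    (h : ∀ x, x ε X → (∀ y, y ε X → r y x → P y) → P x) : ∀ x, x ε X → P x := by
  intro x hx
  by_contra hP
  obtain ⟨z, hz, hPz, hm⟩ := wf.exists_min (fun x => ¬ P x) ⟨x, hx, hP⟩
  exact hPz (h z hz fun y hy hr => not_not.1 (hm y hy hr))

/-- An approximation is a pair of an `r`-closed set `d` and a function obeying the recursion on `d`.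
Two approximations agree wherever both are defined, so they glue to a function `F` on `D`. If `D`
were not all of `X`, adding a value at an `r`-minimal point outside `D` would give a larger
approximation. -/
theorem exists_rec (X : M) (r : M → M → Prop) [Def2 r] (G : M → M) [Fun1 G] (wf : WfOn X r) :
    ∃ F, ∀ x, x ε X → app F x = G (img (app F) (sep X fun y => r y x)) := by
  let A : M → M → Prop := fun d g => Sub d X ∧ (∀ x, x ε d → ∀ y, y ε X → r y x → y ε d) ∧
    ∀ x, x ε d → app g x = G (img (app g) (sep X fun y => r y x))
  have : Def2 A := by infer_instance
  have uniq : ∀ d g d' g', A d g → A d' g' → ∀ x, x ε X → x ε d → x ε d' → app g x = app g' x := by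
    intro d g d' g' h h'
    refine wf.induction (fun x => x ε d → x ε d' → app g x = app g' x) fun x hx ih hd hd' => ?_
    rw [h.2.2 x hd, h'.2.2 x hd']
    refine congrArg G (img_congr fun y hy => ?_)
    rw [mem_sep] at hy
    exact ih y hy.1 hy.2 (h.2.1 x hd y hy.1 hy.2) (h'.2.1 x hd' y hy.1 hy.2)
  let D : M := sep X fun x => ∃ d g, A d g ∧ x ε d
  let value : M → M := fun x => the fun y => ∃ d g, A d g ∧ x ε d ∧ y = app g x
  have : Fun1 value := by infer_instance
  let F : M := lam D value
  have hF : ∀ x, x ε X → ∀ d g, A d g → x ε d → app F x = app g x := by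
    intro x hX d g h hx
    have hxD : x ε D := mem_sep.2 ⟨hX, d, g, h, hx⟩
    rw [show app F x = value x from app_lam hxD]
    refine the_eq ⟨d, g, h, hx, rfl⟩ ?_
    rintro z ⟨d', g', h', hx', rfl⟩
    exact uniq _ _ _ _ h' h x hX hx' hx
  have hAD : A D F := by
    refine ⟨fun z hz => (mem_sep.1 hz).1, fun x hx y hy hr => ?_, fun x hx => ?_⟩
    · obtain ⟨-, d, g, h, hd⟩ := mem_sep.1 hx
      exact mem_sep.2 ⟨hy, d, g, h, h.2.1 x hd y hy hr⟩
    · obtain ⟨hX, d, g, h, hd⟩ := mem_sep.1 hx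
      rw [hF x hX d g h hd, h.2.2 x hd]
      refine congrArg G (img_congr fun y hy => ?_)
      rw [mem_sep] at hy
      exact (hF y hy.1 d g h (h.2.1 x hd y hy.1 hy.2)).symm
  refine ⟨F, fun x hx => hAD.2.2 x ?_⟩
  by_contra hxD
  obtain ⟨x₀, hx₀, hn, hm⟩ := wf.exists_min (fun x => ¬ x ε D) ⟨x, hx, hxD⟩
  simp only [not_not] at hm
  let g₁ : M := lam (union D (upair x₀ x₀))
    fun x => cond (x = x₀) (G (img (app F) (sep X fun y => r y x₀))) (app F x)
  have hg : ∀ x, x ε D → app g₁ x = app F x := by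
    intro x hx
    refine (app_lam (by simp [hx])).trans (cond_neg ?_ _ _)
    rintro rfl; exact hn hx
  have hg₀ : app g₁ x₀ = G (img (app F) (sep X fun y => r y x₀)) :=
    (app_lam (by simp)).trans (cond_pos rfl _ _)
  refine hn (mem_sep.2 ⟨hx₀, union D (upair x₀ x₀), g₁, ⟨?_, ?_, ?_⟩, by simp⟩)
  · intro z hz
    simp at hz
    rcases hz with hz | rfl
    · exact hAD.1 z hz
    · exact hx₀
  · intro x hx y hy hr
    simp at hx ⊢
    rcases hx with hx | rfl
    · exact Or.inl (hAD.2.1 x hx y hy hr)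
    · exact Or.inl (hm y hy hr)
  · intro x hx
    have hx : x ε D ∨ x = x₀ := by simpa using hx
    rcases hx with hx | rfl
    · rw [hg x hx, hAD.2.2 x hx]
      refine congrArg G (img_congr fun y hy => ?_)
      rw [mem_sep] at hy
      exact (hg y (hAD.2.1 x hx y hy.1 hy.2)).symm
    · rw [hg₀]
      refine congrArg G (img_congr fun y hy => ?_)
      rw [mem_sep] at hy
      exact (hg y (hm y hy.1 hy.2)).symm

theorem wfOn_mem (X : M) : WfOn X E := by
  intro s _ ⟨z, hz⟩
  obtain ⟨m, hm, -, h⟩ := exists_min s (fun _ => True) ⟨z, hz, trivial⟩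
  exact ⟨m, hm, fun w hw => h w hw trivial⟩

instance : Def2 (E : M → M → Prop) := ⟨inferInstance⟩

/-- A well-order is isomorphic to an ordinal. -/
theorem exists_collapse (X : M) (r : M → M → Prop) [Def2 r] (wf : WfOn X r)
    (tr : ∀ x, x ε X → ∀ y, y ε X → ∀ z, z ε X → r x y → r y z → r x z)
    (tot : ∀ x, x ε X → ∀ y, y ε X → r x y ∨ x = y ∨ r y x) :
    ∃ F, (∀ x, x ε X → app F x = img (app F) (sep X fun y => r y x)) ∧
      (∀ x, x ε X → ∀ y, y ε X → app F x = app F y → x = y) ∧ Ord (img (app F) X) := by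
  -- With the identity for `G`, the recursion says that `F x` is the set of all `F y` with `r y x`,
  -- which is the Mostowski collapse.
  obtain ⟨F, hF⟩ := exists_rec X r (fun s => s) wf
  have hmem : ∀ x, x ε X → ∀ z, z ε app F x ↔ ∃ y, y ε X ∧ r y x ∧ z = app F y := by
    intro x hx z
    rw [hF x hx, mem_img]
    simp [and_assoc]
  have hord : ∀ x, x ε X → Ord (app F x) := by
    refine wf.induction (fun x => Ord (app F x)) fun x hx ih => Ord.of_trans ?_ ?_
    · intro z hz w hw
      obtain ⟨y, hy, hyx, rfl⟩ := (hmem x hx z).1 hz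
      obtain ⟨u, hu, huy, rfl⟩ := (hmem y hy w).1 hw
      exact (hmem x hx _).2 ⟨u, hu, tr _ hu _ hy _ hx huy hyx, rfl⟩
    · intro z hz
      obtain ⟨y, hy, hyx, rfl⟩ := (hmem x hx z).1 hz
      exact ih y hy hyx
  refine ⟨F, hF, ?_, Ord.of_trans ?_ ?_⟩
  · intro x hx y hy h
    rcases tot x hx y hy with h' | h' | h'
    · exact absurd ((hmem y hy _).2 ⟨x, hx, h', rfl⟩) (h ▸ not_mem_self (app F x))
    · exact h'
    · exact absurd ((hmem x hx _).2 ⟨y, hy, h', rfl⟩) (h ▸ not_mem_self (app F y))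
  · intro z hz w hw
    obtain ⟨x, hx, rfl⟩ := mem_img.1 hz
    obtain ⟨y, hy, -, rfl⟩ := (hmem x hx w).1 hw
    exact mem_img.2 ⟨y, hy, rfl⟩
  · intro z hz
    obtain ⟨x, hx, rfl⟩ := mem_img.1 hz
    exact hord x hx

/-- Iteration of `G` along the natural numbers, starting from `X₀`. -/
theorem exists_iter (X₀ : M) (G : M → M) [Fun1 G] : ∃ F, ∀ n, n ε omega → ∀ z,
    z ε app F n ↔ z ε X₀ ∨ ∃ m, m ε n ∧ (z ε app F m ∨ z ε G (app F m)) := by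
  -- The recursion step sees only the set of earlier values, not their indices. It therefore
  -- collects `c ∪ G c` over all earlier values `c`, which also makes the stages increasing.
  obtain ⟨F, hF⟩ := exists_rec omega E
    (fun s => union X₀ (sUnion (img (fun c => union c (G c)) s))) (wfOn_mem _)
  refine ⟨F, fun n hn z => ?_⟩
  rw [hF n hn, mem_union, mem_sUnion]
  refine or_congr Iff.rfl ⟨?_, ?_⟩
  · rintro ⟨s, hs, hz⟩
    obtain ⟨c, hc, rfl⟩ := mem_img.1 hs
    obtain ⟨m, hm, rfl⟩ := mem_img.1 hc
    exact ⟨m, (mem_sep.1 hm).2, mem_union.1 hz⟩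
  · rintro ⟨m, hm, hz⟩
    exact ⟨_, mem_img.2 ⟨app F m, mem_img.2 ⟨m, mem_sep.2 ⟨ord_omega.trans hn hm, hm⟩, rfl⟩, rfl⟩,
      mem_union.2 hz⟩

/-! ### Choice -/

theorem IsInj.app {f y z : M} (h : IsInj f y z) {x : M} (hx : x ε y) :
    app f x ε z ∧ pr x (app f x) ε f := by
  obtain ⟨c, hc, hp⟩ := h.1.1.2 x hx
  rw [pairMem_iff] at hp
  have : AMC.app f x = c := the_eq hp fun d hd => by
    obtain ⟨a, ha, e, he, h'⟩ := h.1.1.1 _ hd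
    rw [isPair_iff, pr_inj] at h'
    obtain ⟨rfl, rfl⟩ := h'
    exact (h.1.2 x hx c hc d he ⟨by simpa, by simpa⟩).symm
  rw [this]; exact ⟨hc, hp⟩

theorem IsInj.app_inj {f y z : M} (h : IsInj f y z) {x x' : M} (hx : x ε y) (hx' : x' ε y)
    (he : AMC.app f x = AMC.app f x') : x = x' := by
  refine h.2 x hx x' hx' _ (h.app hx).1 ⟨?_, ?_⟩
  · rw [pairMem_iff]; exact (h.app hx).2
  · rw [pairMem_iff, he]; exact (h.app hx').2

/-- A bijection of `W` with an ordinal well-orders `W`, and `c x` is the least witness in this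
order. The choice function is a definable function on all of `M`, not a set, so no domain has to be
fixed in advance. -/
theorem exists_choice (W : M) (P : M → M → Prop) [Def2 P] :
    ∃ c : M → M, Fun1 c ∧ (∀ x, (∃ w, w ε W ∧ P x w) → c x ε W ∧ P x (c x)) ∧
      ∀ x, (¬ ∃ w, w ε W ∧ P x w) → c x = emp := by
  obtain ⟨f, a, ha, hf⟩ := choice_ax W
  let Q : M → M → Prop := fun x w => w ε W ∧ P x w ∧ ∀ w', w' ε W → P x w' →
    Sub (app f w) (app f w')
  have : Def2 Q := by infer_instance
  refine ⟨fun x => the (Q x), ⟨inferInstance⟩, ?_, ?_⟩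
  · intro x ⟨w, hw, hP⟩
    have hQ : Q x (the (Q x)) := by
      apply the_spec
      obtain ⟨z, -, ⟨w, hw, hP, rfl⟩, hm⟩ := ha.exists_least
        (fun z => ∃ w, w ε W ∧ P x w ∧ app f w = z) ⟨_, (hf.1.app hw).1, w, hw, hP, rfl⟩
      refine ⟨w, ⟨hw, hP, fun w' hw' hP' => hm _ (hf.1.app hw').1 ⟨w', hw', hP', rfl⟩⟩, ?_⟩
      rintro w' ⟨hw', hP', hm'⟩
      refine hf.1.app_inj hw' hw ((hm' w hw hP).antisymm ?_)
      exact hm _ (hf.1.app hw').1 ⟨w', hw', hP', rfl⟩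
    exact ⟨hQ.1, hQ.2.1⟩
  · intro x h
    refine the_eq_emp ?_
    rintro ⟨w, hw, -⟩
    exact h ⟨w, hw.1, hw.2.1⟩

/-! ### Comparing sizes -/

/-- There is an injection from `s` to `t`. -/
def Le (s t : M) : Prop :=
  ∃ f, ∀ x, x ε s → app f x ε t ∧ ∀ y, y ε s → app f x = app f y → x = y

theorem Le.of_fun {s t : M} (g : M → M) [Fun1 g] (h : ∀ x, x ε s → g x ε t)
    (hi : ∀ x, x ε s → ∀ y, y ε s → g x = g y → x = y) : Le s t := by
  refine ⟨lam s g, fun x hx => ?_⟩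
  rw [app_lam hx]
  refine ⟨h x hx, fun y hy he => ?_⟩
  rw [app_lam hy] at he
  exact hi x hx y hy he

theorem le_iff_isInj {s t : M} : Le s t ↔ ∃ f, IsInj f s t := by
  constructor
  · rintro ⟨f, hf⟩
    refine ⟨lam s (app f), ⟨⟨?_, ?_⟩, ?_⟩, ?_⟩
    · intro p hp
      obtain ⟨x, hx, rfl⟩ := mem_img.1 hp
      exact ⟨x, hx, _, (hf x hx).1, isPair_iff.2 rfl⟩
    · exact fun x hx => ⟨_, (hf x hx).1, pairMem_iff.2 (pr_mem_lam.2 ⟨hx, rfl⟩)⟩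
    · intro x hx c hc d hd ⟨h1, h2⟩
      rw [pairMem_iff, pr_mem_lam] at h1 h2
      rw [h1.2, h2.2]
    · intro x hx y hy c hc ⟨h1, h2⟩
      rw [pairMem_iff, pr_mem_lam] at h1 h2
      exact (hf x hx).2 y hy (h1.2.symm.trans h2.2)
  · rintro ⟨f, hf⟩
    exact ⟨f, fun x hx => ⟨(hf.app hx).1, fun y hy he => hf.app_inj hx hy he⟩⟩

instance (f g : (Fin n → M) → M) [DefF f] [DefF g] : Def fun v => Le (f v) (g v) := by
  unfold Le; infer_instance

theorem Le.of_sub {s t : M} (h : Sub s t) : Le s t := Le.of_fun (fun x => x) h fun _ _ _ _ h => h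

theorem Le.trans {s t a : M} (h : Le s t) (h' : Le t a) : Le s a := by
  obtain ⟨f, hf⟩ := h
  obtain ⟨g, hg⟩ := h'
  refine Le.of_fun (fun x => app g (app f x)) (fun x hx => (hg _ (hf x hx).1).1)
    fun x hx y hy h => ?_
  exact (hf x hx).2 y hy ((hg _ (hf x hx).1).2 _ (hf y hy).1 h)

theorem le_img (s : M) (g : M → M) [Fun1 g] : Le (img g s) s := by
  obtain ⟨c, hc, hc', -⟩ := exists_choice s (fun y x => y = g x)
  refine Le.of_fun c (fun y hy => (hc' y (mem_img.1 hy)).1) fun y hy z hz h => ?_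
  rw [(hc' y (mem_img.1 hy)).2, (hc' z (mem_img.1 hz)).2, h]

theorem le_prod {s t s' t' : M} (h : Le s s') (h' : Le t t') : Le (prod s t) (prod s' t') := by
  obtain ⟨f, hf⟩ := h
  obtain ⟨g, hg⟩ := h'
  refine Le.of_fun (fun p => pr (app f (fst p)) (app g (snd p))) ?_ ?_
  · intro p hp
    obtain ⟨x, hx, y, hy, rfl⟩ := mem_prod.1 hp
    rw [fst_pr, snd_pr, pr_mem_prod]
    exact ⟨(hf x hx).1, (hg y hy).1⟩
  · intro p hp q hq h
    obtain ⟨x, hx, y, hy, rfl⟩ := mem_prod.1 hp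
    obtain ⟨x', hx', y', hy', rfl⟩ := mem_prod.1 hq
    simp only [fst_pr, snd_pr, pr_inj] at h
    exact pr_inj.2 ⟨(hf x hx).2 _ hx' h.1, (hg y hy).2 _ hy' h.2⟩

end Recursion

/-! ### Infinite ordinals absorb products -/

section Arithmetic

variable {M : Type u} [Lset.Structure M] [hM : ZFC.Model M] {n : ℕ}

/-- From an injection `f` of `ω` into `k + 1` one gets an injection into `k`: shift to `x ↦ f (x +
1)` and, if the value `k` occurs, replace it by the freed value `f 0`. -/
theorem not_le_omega {n : M} (hn : n ε omega) : ¬ Le omega n := by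
  refine omega_induction (fun n => ¬ Le omega n) ?_ ?_ n hn
  · rintro ⟨f, hf⟩
    exact not_mem_emp _ (hf emp emp_mem_omega).1
  · rintro k hk ih ⟨f, hf⟩
    have h0 : ∀ x, x ε omega → app f (suc x) ≠ app f emp := fun x hx h =>
      not_mem_emp x (((hf _ (suc_mem_omega hx)).2 _ emp_mem_omega h) ▸ mem_suc.2 (Or.inr rfl))
    refine ih (Le.of_fun
      (fun x => cond (app f (suc x) = k) (app f emp) (app f (suc x))) ?_ ?_)
    · intro x hx
      by_cases h : app f (suc x) = k
      · rw [cond_pos h]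
        rcases mem_suc.1 (hf emp emp_mem_omega).1 with h' | h'
        · exact h'
        · exact absurd (h.trans h'.symm) (h0 x hx)
      · rw [cond_neg h]
        exact (mem_suc.1 (hf _ (suc_mem_omega hx)).1).resolve_right h
    · intro x hx y hy he
      by_cases h : app f (suc x) = k <;> by_cases h' : app f (suc y) = k
      · exact suc_inj ((hf _ (suc_mem_omega hx)).2 _ (suc_mem_omega hy) (h.trans h'.symm))
      · rw [cond_pos h, cond_neg h'] at he
        exact absurd he.symm (h0 y hy)
      · rw [cond_neg h, cond_pos h'] at he
        exact absurd he (h0 x hx)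
      · rw [cond_neg h, cond_neg h'] at he
        exact suc_inj ((hf _ (suc_mem_omega hx)).2 _ (suc_mem_omega hy) he)

def IsFinite (s : M) : Prop := ∃ n, n ε omega ∧ Le s n

instance (f : (Fin n → M) → M) [DefF f] : Def fun v => IsFinite (f v) := by
  unfold IsFinite; infer_instance

theorem le_insert {s n : M} (h : Le s n) (a : M) : Le (union s (upair a a)) (suc n) := by
  obtain ⟨f, hf⟩ := h
  refine Le.of_fun (fun x => cond (x = a) n (app f x)) ?_ ?_
  · intro x hx
    by_cases h : x = a
    · rw [cond_pos h]; simp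
    · rw [cond_neg h]
      exact mem_suc.2 (Or.inl (hf x (by simpa [h] using hx)).1)
  · intro x hx y hy he
    by_cases h : x = a <;> by_cases h' : y = a
    · rw [h, h']
    · rw [cond_pos h, cond_neg h'] at he
      exact absurd (he ▸ (hf y (by simpa [h'] using hy)).1) (not_mem_self _)
    · rw [cond_neg h, cond_pos h'] at he
      exact absurd (he ▸ (hf x (by simpa [h] using hx)).1) (not_mem_self _)
    · rw [cond_neg h, cond_neg h'] at he
      exact (hf x (by simpa [h] using hx)).2 y (by simpa [h'] using hy) he

theorem IsFinite.of_le {s t : M} (h : IsFinite t) (h' : Le s t) : IsFinite s := by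
  obtain ⟨n, hn, h⟩ := h
  exact ⟨n, hn, h'.trans h⟩

/-- Induction on a bound for the size of `t`, over all `t` at once: deleting from `t` the one point
sent to the top element `k` lowers the bound, and `le_insert` puts that point back. -/
theorem isFinite_union {s t : M} (hs : IsFinite s) (ht : IsFinite t) : IsFinite (union s t) := by
  obtain ⟨n, hn, ht⟩ := ht
  suffices H : ∀ n, n ε omega → ∀ t, Le t n → IsFinite (union s t) from H n hn t ht
  refine omega_induction (fun n => ∀ t, Le t n → IsFinite (union s t)) ?_ ?_
  · rintro t ⟨f, hf⟩
    refine hs.of_le (Le.of_sub fun z hz => ?_)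
    rcases mem_union.1 hz with h | h
    · exact h
    · exact absurd (hf z h).1 (not_mem_emp _)
  · rintro k hk ih t ⟨f, hf⟩
    have h' : Le (sep t fun x => app f x ≠ k) k := by
      refine Le.of_fun (app f) (fun x hx => ?_) fun x hx y hy h => ?_
      · rw [mem_sep] at hx
        exact (mem_suc.1 (hf x hx.1).1).resolve_right hx.2
      · exact (hf x (mem_sep.1 hx).1).2 y (mem_sep.1 hy).1 h
    obtain ⟨m, hm, hle⟩ := ih _ h'
    by_cases ha : ∃ a, a ε t ∧ app f a = k
    · obtain ⟨a, ha, hak⟩ := ha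
      refine ⟨suc m, suc_mem_omega hm, Le.trans (Le.of_sub fun z hz => ?_) (le_insert hle a)⟩
      rw [mem_union, mem_union, mem_sep, mem_upair, or_self]
      rcases mem_union.1 hz with h | h
      · exact Or.inl (Or.inl h)
      · by_cases hz : app f z = k
        · exact Or.inr ((hf z h).2 a ha (hz.trans hak.symm))
        · exact Or.inl (Or.inr ⟨h, hz⟩)
    · refine ⟨m, hm, Le.trans (Le.of_sub fun z hz => ?_) hle⟩
      rw [mem_union, mem_sep]
      rcases mem_union.1 hz with h | h
      · exact Or.inl h
      · exact Or.inr ⟨h, fun hk => ha ⟨z, h, hk⟩⟩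

theorem IsFinite.prod_self {n : M} (hn : n ε omega) : IsFinite (prod n n) := by
  refine omega_induction (fun n => IsFinite (prod n n)) ?_ ?_ n hn
  · refine ⟨emp, emp_mem_omega, Le.of_sub fun z hz => ?_⟩
    obtain ⟨x, hx, -⟩ := mem_prod.1 hz
    exact absurd hx (not_mem_emp x)
  · intro k hk ih
    have h1 : IsFinite (img (fun x => pr x k) (suc k)) := ⟨_, suc_mem_omega hk, le_img _ _⟩
    have h2 : IsFinite (img (fun x => pr k x) (suc k)) := ⟨_, suc_mem_omega hk, le_img _ _⟩
    refine (isFinite_union (isFinite_union ih h1) h2).of_le (Le.of_sub fun z hz => ?_)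
    obtain ⟨x, hx, y, hy, rfl⟩ := mem_prod.1 hz
    rw [mem_union, mem_union, mem_img, mem_img, pr_mem_prod]
    rcases mem_suc.1 hx with hx' | rfl
    · rcases mem_suc.1 hy with hy' | rfl
      · exact Or.inl (Or.inl ⟨hx', hy'⟩)
      · exact Or.inl (Or.inr ⟨x, hx, rfl⟩)
    · exact Or.inr ⟨y, hy, rfl⟩

/-- Hilbert's hotel: the new element `a` goes to `0`, each natural number to its successor, and
every other element stays. -/
theorem le_of_infinite {a : M} (h : Sub omega a) : Le (suc a) a := by
  have hne : ∀ x : M, x ε omega → suc x ≠ emp := fun x _ h => by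
    have : x ε suc x := mem_suc.2 (Or.inr rfl)
    rw [h] at this
    exact not_mem_emp _ this
  have key : ∀ x, x ε suc a → (x = a ∧ cond (x = a) emp (cond (x ε omega) (suc x) x) = emp) ∨
      (x ≠ a ∧ x ε a ∧ x ε omega ∧ cond (x = a) emp (cond (x ε omega) (suc x) x) = suc x) ∨
      (x ≠ a ∧ x ε a ∧ ¬ x ε omega ∧ cond (x = a) emp (cond (x ε omega) (suc x) x) = x) := by
    intro x hx
    by_cases h : x = a
    · exact Or.inl ⟨h, cond_pos h _ _⟩
    · rw [cond_neg h]
      have hxa := (mem_suc.1 hx).resolve_right h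
      by_cases h' : x ε omega
      · exact Or.inr (Or.inl ⟨h, hxa, h', cond_pos h' _ _⟩)
      · exact Or.inr (Or.inr ⟨h, hxa, h', cond_neg h' _ _⟩)
  refine Le.of_fun (fun x => cond (x = a) emp (cond (x ε omega) (suc x) x)) ?_ ?_
  · intro x hx
    rcases key x hx with ⟨-, h1⟩ | ⟨-, hx, ho, h1⟩ | ⟨-, hx, ho, h1⟩ <;> rw [h1]
    · exact h _ emp_mem_omega
    · exact h _ (suc_mem_omega ho)
    · exact hx
  · intro x hx y hy he
    rcases key x hx with ⟨hxa, h1⟩ | ⟨-, -, ho, h1⟩ | ⟨-, -, ho, h1⟩ <;>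
    rcases key y hy with ⟨hya, h2⟩ | ⟨-, -, ho', h2⟩ | ⟨-, -, ho', h2⟩ <;>
    rw [h1, h2] at he
    · rw [hxa, hya]
    · exact absurd he.symm (hne y ho')
    · exact absurd (he ▸ emp_mem_omega) ho'
    · exact absurd he (hne x ho)
    · exact suc_inj he
    · exact absurd (he ▸ suc_mem_omega ho) ho'
    · exact absurd (he ▸ emp_mem_omega) ho
    · exact absurd (he ▸ suc_mem_omega ho') ho
    · exact he

theorem union_eq_left {a c : M} (h : Sub c a) : union a c = a :=
  ext fun w => by rw [mem_union]; exact ⟨fun h' => h'.elim id (h w), Or.inl⟩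

theorem union_eq_right {a c : M} (h : Sub a c) : union a c = c :=
  ext fun w => by rw [mem_union]; exact ⟨fun h' => h'.elim (h w) id, Or.inr⟩

theorem Ord.union_mem {a c d : M} (ha : Ord a) (hc : Ord c)
    (had : a ε d) (hcd : c ε d) : union a c ε d := by
  rcases ha.sub_or_mem hc with h | h
  · rwa [union_eq_right h]
  · rwa [union_eq_left (ha.1 c h)]

/-- Gödel's ordering of pairs of ordinals. -/
def gLt (p q : M) : Prop :=
  union (fst p) (snd p) ε union (fst q) (snd q) ∨
    union (fst p) (snd p) = union (fst q) (snd q) ∧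
      (fst p ε fst q ∨ fst p = fst q ∧ snd p ε snd q)

instance (f g : (Fin n → M) → M) [DefF f] [DefF g] : Def fun v => gLt (f v) (g v) := by
  unfold gLt; infer_instance

/-- Order `a × a` by maximum, then lexicographically, and collapse it to an ordinal. If this ordinal
were not contained in `a`, then `a` would be the image of some pair `p`, hence the image of the set
of predecessors of `p`. With `m` the maximum of `p`, those predecessors lie in `(m + 1) × (m + 1)`,
which injects into an element of `a`, contrary to `h1`. -/
theorem Ord.prod_le_of {a : M} (ha : Ord a) (h1 : ∀ c, c ε a → ¬ Le a c)
    (h2 : ∀ m, m ε a → ∃ c, c ε a ∧ Le (prod (AMC.suc m) (AMC.suc m)) c) : Le (prod a a) a := by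
  have hp : ∀ p, p ε prod a a → fst p ε a ∧ snd p ε a ∧ p = pr (fst p) (snd p) ∧
      union (fst p) (snd p) ε a := by
    intro p hp
    obtain ⟨x, hx, y, hy, rfl⟩ := mem_prod.1 hp
    rw [fst_pr, snd_pr]
    exact ⟨hx, hy, rfl, (ha.mem hx).union_mem (ha.mem hy) hx hy⟩
  have wf : WfOn (prod a a) gLt := by
    intro s hs ⟨p, hps⟩
    -- A minimal pair has the least maximum, then the least first coordinate among those, then the
    -- least second coordinate.
    obtain ⟨m, -, ⟨p, hps, rfl⟩, hm⟩ := ha.exists_least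
      (fun m => ∃ p, p ε s ∧ union (fst p) (snd p) = m) ⟨_, (hp p (hs p hps)).2.2.2, p, hps, rfl⟩
    obtain ⟨x, -, ⟨q, hqs, hqm, rfl⟩, hx⟩ := ha.exists_least
      (fun x => ∃ q, q ε s ∧ union (fst q) (snd q) = union (fst p) (snd p) ∧ fst q = x)
      ⟨_, (hp p (hs p hps)).1, p, hps, rfl, rfl⟩
    obtain ⟨y, -, ⟨t, hts, htm, htq, rfl⟩, hy⟩ := ha.exists_least
      (fun y => ∃ t, t ε s ∧ union (fst t) (snd t) = union (fst p) (snd p) ∧ fst t = fst q ∧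
        snd t = y) ⟨_, (hp q (hs q hqs)).2.1, q, hqs, hqm, rfl, rfl⟩
    refine ⟨t, hts, fun w hw hlt => ?_⟩
    have hwa := hp w (hs w hw)
    rcases hlt with h | ⟨h, h' | ⟨h', h''⟩⟩
    · rw [htm] at h
      exact not_mem_self _ (hm _ hwa.2.2.2 ⟨w, hw, rfl⟩ _ h)
    · rw [htq] at h'
      exact not_mem_self _ (hx _ hwa.1 ⟨w, hw, h.trans htm, rfl⟩ _ h')
    · exact not_mem_self _ (hy _ hwa.2.1 ⟨w, hw, h.trans htm, h'.trans htq, rfl⟩ _ h'')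
  have tr : ∀ x, x ε prod a a → ∀ y, y ε prod a a → ∀ z, z ε prod a a →
      gLt x y → gLt y z → gLt x z := by
    intro x hx y hy z hz hxy hyz
    have hz := hp z hz
    have o1 := (ha.mem hz.1).1
    have o2 := (ha.mem hz.2.1).1
    have o3 := (ha.mem hz.2.2.2).1
    rcases hxy with h | ⟨h, h'⟩ <;> rcases hyz with k | ⟨k, k'⟩
    · exact Or.inl (o3 _ k _ h)
    · exact Or.inl (k ▸ h)
    · exact Or.inl (h ▸ k)
    · refine Or.inr ⟨h.trans k, ?_⟩
      rcases h' with h' | ⟨h', h''⟩ <;> rcases k' with k' | ⟨k', k''⟩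
      · exact Or.inl (o1 _ k' _ h')
      · exact Or.inl (k' ▸ h')
      · exact Or.inl (h' ▸ k')
      · exact Or.inr ⟨h'.trans k', o2 _ k'' _ h''⟩
  have tot : ∀ x, x ε prod a a → ∀ y, y ε prod a a → gLt x y ∨ x = y ∨ gLt y x := by
    intro x hx y hy
    have hx := hp x hx
    have hy := hp y hy
    rcases (ha.mem hx.2.2.2).linear (ha.mem hy.2.2.2) with h | h | h
    · exact Or.inl (Or.inl h)
    · rcases (ha.mem hx.1).linear (ha.mem hy.1) with h' | h' | h'
      · exact Or.inl (Or.inr ⟨h, Or.inl h'⟩)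
      · rcases (ha.mem hx.2.1).linear (ha.mem hy.2.1) with h'' | h'' | h''
        · exact Or.inl (Or.inr ⟨h, Or.inr ⟨h', h''⟩⟩)
        · exact Or.inr (Or.inl (by rw [hx.2.2.1, hy.2.2.1, h', h'']))
        · exact Or.inr (Or.inr (Or.inr ⟨h.symm, Or.inr ⟨h'.symm, h''⟩⟩))
      · exact Or.inr (Or.inr (Or.inr ⟨h.symm, Or.inl h'⟩))
    · exact Or.inr (Or.inr (Or.inl h))
  obtain ⟨F, hF, hinj, hord⟩ := exists_collapse (prod a a) gLt wf tr tot
  rcases hord.sub_or_mem ha with h | h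
  · exact Le.of_fun (app F) (fun x hx => h _ (mem_img_of hx)) hinj
  · obtain ⟨p, hpa, he⟩ := mem_img.1 h
    have hpp := hp p hpa
    obtain ⟨c, hc, hle⟩ := h2 _ hpp.2.2.2
    refine absurd ?_ (h1 c hc)
    have : Le a (sep (prod a a) fun y => gLt y p) := by
      conv => arg 1; rw [he, hF p hpa]
      exact le_img _ _
    refine (this.trans (Le.of_sub fun q hq => ?_)).trans hle
    obtain ⟨hq, hlt⟩ := mem_sep.1 hq
    have hqq := hp q hq
    have ho := ha.mem hpp.2.2.2
    have hsub : Sub (union (fst q) (snd q)) (union (fst p) (snd p)) := by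
      rcases hlt with h | ⟨h, -⟩
      · exact ho.1 _ h
      · rw [h]; exact sub_refl _
    rw [hqq.2.2.1, pr_mem_prod]
    exact ⟨(ha.mem hqq.1).mem_of_sub_mem ho.suc
        (fun z hz => hsub z (mem_union.2 (Or.inl hz))) (by simp),
      (ha.mem hqq.2.1).mem_of_sub_mem ho.suc
        (fun z hz => hsub z (mem_union.2 (Or.inr hz))) (by simp)⟩

/-- Induction on the ordinal. If `x` injects into a smaller `c`, the claim for `c` suffices.
Otherwise `x` is initial and `prod_le_of` applies: for `m ∈ x`, the square of `m + 1` is finite when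
`x = ω`, and otherwise injects into `max(m, ω) ∈ x` by the induction hypothesis. -/
theorem Ord.prod_le {a : M} (ha : Ord a) (hω : Sub omega a) : Le (prod a a) a := by
  revert hω
  refine trans_induction ha.suc.1 (fun x => Sub omega x → Le (prod x x) x) ?_ a (by simp)
  intro x hx ih hω
  have hxo : Ord x := ha.suc.mem hx
  by_cases h1 : ∃ c, c ε x ∧ Le x c
  · obtain ⟨c, hc, hle⟩ := h1
    have hcω : Sub omega c := by
      rcases ord_omega.sub_or_mem (hxo.mem hc) with h | h
      · exact h
      · exact absurd ((Le.of_sub hω).trans hle) (not_le_omega h)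
    exact ((le_prod hle hle).trans (ih c hc hcω)).trans (Le.of_sub (hxo.1 c hc))
  · refine hxo.prod_le_of (fun c hc hle => h1 ⟨c, hc, hle⟩) fun m hm => ?_
    rcases ord_omega.linear hxo with h | rfl | h
    · have hmo := hxo.mem hm
      have hu : union m omega ε x := hmo.union_mem ord_omega hm h
      have huω : Sub omega (union m omega) := fun z hz => mem_union.2 (Or.inr hz)
      have hle : Le (AMC.suc m) (union m omega) := by
        refine Le.trans (Le.of_sub ?_) (le_of_infinite huω)
        refine (hxo.mem hu).suc.suc_sub (hmo.mem_of_sub_mem (hxo.mem hu).suc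
          (c := union m omega) (fun z hz => mem_union.2 (Or.inl hz)) (by simp))
      exact ⟨_, hu, (le_prod hle hle).trans (ih _ hu huω)⟩
    · exact IsFinite.prod_self (suc_mem_omega hm)
    · exact absurd (hω x h) (not_mem_self x)

/-! ### Unions of small families of small sets -/

section Small

variable {κ : M}

/-- The injections must be chosen uniformly and definably. Restricted to `I x`, each is a subset of
`(⋃ I x) × κ`, so all candidates lie in one power set and `exists_choice` picks among them. -/
theorem Le.exists_injections {X : M} (I : M → M) [Fun1 I] (hI : ∀ x, x ε X → Le (I x) κ) :
    ∃ c : M → M, Fun1 c ∧ ∀ x, x ε X → ∀ y, y ε I x → app (c x) y ε κ ∧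
      ∀ z, z ε I x → app (c x) y = app (c x) z → y = z := by
  obtain ⟨c, hc, hc', -⟩ := exists_choice (pow (prod (sUnion (img I X)) κ))
    (fun x f => ∀ y, y ε I x → app f y ε κ ∧ ∀ z, z ε I x → app f y = app f z → y = z)
  refine ⟨c, hc, fun x hx => (hc' x ?_).2⟩
  obtain ⟨f, hf⟩ := hI x hx
  refine ⟨lam (I x) (app f), ?_, fun y hy => ?_⟩
  · rw [mem_pow]
    intro p hp
    obtain ⟨y, hy, rfl⟩ := mem_img.1 hp
    exact pr_mem_prod.2 ⟨mem_sUnion.2 ⟨_, mem_img_of hx, hy⟩, (hf y hy).1⟩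
  · rw [app_lam hy]
    refine ⟨(hf y hy).1, fun z hz he => ?_⟩
    rw [app_lam hz] at he
    exact (hf y hy).2 z hz he

/-- Send `z` to the index in `κ` of a chosen `x` with `z ∈ I x`, paired with the position of `z`
under the chosen injection of `I x` into `κ`; then absorb `κ × κ` into `κ`. -/
theorem le_biUnion (hκ : Ord κ) (hω : Sub omega κ) {X : M} (hX : Le X κ) (I : M → M) [Fun1 I]
    (hI : ∀ x, x ε X → Le (I x) κ) :
    Le (sUnion (img I X)) κ := by
  obtain ⟨c, hc, hc'⟩ := Le.exists_injections I hI
  obtain ⟨h, hh⟩ := hX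
  obtain ⟨d, hd, hd', -⟩ := exists_choice X (fun z x => z ε I x)
  have hd'' : ∀ z, z ε sUnion (img I X) → d z ε X ∧ z ε I (d z) := by
    intro z hz
    obtain ⟨s, hs, hz⟩ := mem_sUnion.1 hz
    obtain ⟨x, hx, rfl⟩ := mem_img.1 hs
    exact hd' z ⟨x, hx, hz⟩
  refine Le.trans (Le.of_fun (fun z => pr (app h (d z)) (app (c (d z)) z)) (t := prod κ κ)
    ?_ ?_) (hκ.prod_le hω)
  · intro z hz
    obtain ⟨h1, h2⟩ := hd'' z hz
    exact pr_mem_prod.2 ⟨(hh _ h1).1, (hc' _ h1 _ h2).1⟩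
  · intro z hz y hy he
    obtain ⟨h1, h2⟩ := hd'' z hz
    obtain ⟨h3, h4⟩ := hd'' y hy
    obtain ⟨e1, e2⟩ := pr_inj.1 he
    have e := (hh _ h1).2 _ h3 e1
    rw [← e] at e2 h4
    exact (hc' _ h1 _ h2).2 _ h4 e2

theorem le_upair (hω : Sub omega κ) (a c : M) : Le (upair a c) κ := by
  have h1 : suc (emp : M) ε κ := hω _ (suc_mem_omega emp_mem_omega)
  have hne : (emp : M) ≠ suc emp := fun h => by
    have := mem_suc.2 (Or.inr (rfl : (emp : M) = emp))
    rw [← h] at this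
    exact not_mem_emp _ this
  refine Le.of_fun (fun z => cond (z = a) emp (suc emp)) ?_ ?_
  · intro z hz
    by_cases h : z = a
    · rw [cond_pos h]; exact hω _ emp_mem_omega
    · rw [cond_neg h]; exact h1
  · intro z hz y hy he
    rw [mem_upair] at hz hy
    by_cases h : z = a <;> by_cases h' : y = a
    · rw [h, h']
    · rw [cond_pos h, cond_neg h'] at he; exact absurd he hne
    · rw [cond_neg h, cond_pos h'] at he; exact absurd he.symm hne
    · rw [hz.resolve_left h, hy.resolve_left h']

theorem le_union (hκ : Ord κ) (hω : Sub omega κ) {s t : M} (hs : Le s κ) (ht : Le t κ) :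
    Le (union s t) κ := by
  have := le_biUnion hκ hω (le_upair hω s t) (fun x => x) fun x hx => by
    rcases mem_upair.1 hx with rfl | rfl <;> assumption
  refine Le.trans (Le.of_sub fun z hz => ?_) this
  rw [mem_sUnion]
  rcases mem_union.1 hz with h | h
  · exact ⟨s, mem_img.2 ⟨s, by simp, rfl⟩, h⟩
  · exact ⟨t, mem_img.2 ⟨t, by simp, rfl⟩, h⟩

theorem le_prod_small (hκ : Ord κ) (hω : Sub omega κ) {s t : M} (hs : Le s κ) (ht : Le t κ) :
    Le (prod s t) κ :=
  (le_prod hs ht).trans (hκ.prod_le hω)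

end Small

end Arithmetic

/-! ### Transitive closures and `H_{κ⁺}` -/

section Hereditary

variable {M : Type u} [Lset.Structure M] [hM : ZFC.Model M] {n : ℕ}

/-- The union of the stages obtained by iterating `⋃` along `ω`. -/
theorem exists_trans_superset (s : M) : ∃ t, Trans t ∧ Sub s t := by
  obtain ⟨F, hF⟩ := exists_iter s sUnion
  refine ⟨sUnion (img (app F) omega), ?_, ?_⟩
  · intro z hz w hw
    obtain ⟨c, hc, hz⟩ := mem_sUnion.1 hz
    obtain ⟨m, hm, rfl⟩ := mem_img.1 hc
    exact mem_sUnion.2 ⟨_, mem_img_of (suc_mem_omega hm),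
      (hF _ (suc_mem_omega hm) w).2 (Or.inr ⟨m, by simp, Or.inr (mem_sUnion.2 ⟨z, hz, hw⟩)⟩)⟩
  · intro z hz
    exact mem_sUnion.2 ⟨_, mem_img_of emp_mem_omega, (hF _ emp_mem_omega z).2 (Or.inl hz)⟩

/-- The transitive closure. -/
def tc (s : M) : M := mk fun w => ∀ t, Trans t → Sub s t → w ε t

instance (f : (Fin n → M) → M) [DefF f] : DefF fun v => tc (f v) := by
  unfold tc; infer_instance

theorem mem_tc {s w : M} : w ε tc s ↔ ∀ t, Trans t → Sub s t → w ε t := by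
  refine mem_mk (IsSet.of_sub (Q := fun w => w ε (exists_trans_superset s).choose)
    ⟨_, fun _ => Iff.rfl⟩ fun z hz => ?_)
  exact hz _ (exists_trans_superset s).choose_spec.1 (exists_trans_superset s).choose_spec.2

theorem trans_tc (s : M) : Trans (tc s) := by
  intro z hz w hw
  rw [mem_tc] at hz ⊢
  exact fun t ht hs => ht z (hz t ht hs) w hw

theorem sub_tc (s : M) : Sub s (tc s) := fun z hz => mem_tc.2 fun _ _ hs => hs z hz

theorem tc_sub {s t : M} (ht : Trans t) (h : Sub s t) : Sub (tc s) t :=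
  fun _ hz => mem_tc.1 hz t ht h

variable {κ : M}

theorem inH_iff_le {y : M} : InH κ y ↔ Le (tc y) κ := by
  constructor
  · rintro ⟨t, ⟨ht, hy⟩, hf⟩
    exact (Le.of_sub (tc_sub ht hy)).trans (le_iff_isInj.2 hf)
  · exact fun h => ⟨tc y, ⟨trans_tc y, sub_tc y⟩, le_iff_isInj.1 h⟩

theorem InH.sub {y z : M} (h : InH κ y) (hz : Sub z y) : InH κ z := by
  obtain ⟨t, ⟨ht, hy⟩, hf⟩ := h
  exact ⟨t, ⟨ht, hz.trans hy⟩, hf⟩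

theorem InH.mem {y z : M} (h : InH κ y) (hz : z ε y) : InH κ z := by
  obtain ⟨t, ⟨ht, hy⟩, hf⟩ := h
  exact ⟨t, ⟨ht, ht z (hy z hz)⟩, hf⟩

theorem InH.le {y : M} (h : InH κ y) : Le y κ :=
  (Le.of_sub (sub_tc y)).trans (inH_iff_le.1 h)

theorem InH.tc {y : M} (h : InH κ y) : InH κ (tc y) := by
  obtain ⟨t, ⟨ht, hy⟩, hf⟩ := h
  exact ⟨t, ⟨ht, tc_sub ht hy⟩, hf⟩

theorem InH.sUnion {y : M} (h : InH κ y) : InH κ (sUnion y) := by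
  obtain ⟨t, ⟨ht, hy⟩, hf⟩ := h
  refine ⟨t, ⟨ht, fun z hz => ?_⟩, hf⟩
  obtain ⟨s, hs, hz⟩ := mem_sUnion.1 hz
  exact ht s (hy s hs) z hz

theorem InH.of_trans_sub {y t : M} (ht : Trans t) (hle : Le t κ) (h : Sub y t) : InH κ y :=
  ⟨t, ⟨ht, h⟩, le_iff_isInj.1 hle⟩

/-- The transitive closure of `y` is contained in `y` together with the transitive closures of its
elements, a union of at most `κ` sets of size at most `κ`. -/
theorem InH.of_le (hκ : Ord κ) (hω : Sub omega κ) {y : M} (h : Le y κ)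
    (h' : ∀ z, z ε y → InH κ z) : InH κ y := by
  refine inH_iff_le.2 (Le.trans (Le.of_sub
    (tc_sub (t := union y (AMC.sUnion (img AMC.tc y))) ?_ ?_))
    (le_union hκ hω h (le_biUnion hκ hω h AMC.tc fun x hx => inH_iff_le.1 (h' x hx))))
  · intro z hz w hw
    rw [mem_union, mem_sUnion] at hz ⊢
    refine Or.inr ?_
    rcases hz with hz | ⟨s, hs, hz⟩
    · exact ⟨_, mem_img_of hz, sub_tc z w hw⟩
    · obtain ⟨x, hx, rfl⟩ := mem_img.1 hs
      exact ⟨_, mem_img_of hx, trans_tc x z hz w hw⟩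
  · exact fun z hz => mem_union.2 (Or.inl hz)

theorem inH_upair (hκ : Ord κ) (hω : Sub omega κ) {a c : M} (ha : InH κ a) (hc : InH κ c) :
    InH κ (upair a c) := by
  refine InH.of_le hκ hω (le_upair hω a c) fun z hz => ?_
  rcases mem_upair.1 hz with rfl | rfl <;> assumption

theorem inH_pr (hκ : Ord κ) (hω : Sub omega κ) {a c : M} (ha : InH κ a) (hc : InH κ c) :
    InH κ (pr a c) :=
  inH_upair hκ hω (inH_upair hκ hω ha ha) (inH_upair hκ hω ha hc)

theorem inH_prod (hκ : Ord κ) (hω : Sub omega κ) {a c : M} (ha : InH κ a) (hc : InH κ c) :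
    InH κ (prod a c) := by
  refine InH.of_le hκ hω (le_prod_small hκ hω ha.le hc.le) fun z hz => ?_
  obtain ⟨x, hx, y, hy, rfl⟩ := mem_prod.1 hz
  exact inH_pr hκ hω (ha.mem hx) (hc.mem hy)

theorem inH_omega (hω : Sub omega κ) : InH κ omega :=
  InH.of_trans_sub ord_omega.1 (Le.of_sub hω) (sub_refl _)

theorem inH_emp (hω : Sub omega κ) : InH κ emp := (inH_omega hω).mem emp_mem_omega

/-! ### The Gödel operations -/

@[simp] theorem isTriple_iff {q a c d : M} : IsTriple q a c d ↔ q = pr (pr a c) d := by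
  constructor
  · rintro ⟨s, -, p, -, h1, h2⟩
    rw [isPair_iff] at h1 h2
    subst h1; exact h2
  · rintro rfl
    exact ⟨upair (pr a c) (pr a c), by simp [pr], pr a c, by simp, isPair_iff.2 rfl,
      isPair_iff.2 rfl⟩

theorem eq_iff_of_mem {y z : M} {P : M → Prop} (hy : ∀ w, w ε y ↔ P w) :
    z = y ↔ ∀ w, w ε z ↔ P w := by
  constructor
  · rintro rfl; exact hy
  · exact fun h => ext fun w => (h w).trans (hy w).symm


theorem inH_of_pr {a c : M} (h : InH κ (pr a c)) : InH κ a ∧ InH κ c :=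
  ⟨(h.mem (mem_upair.2 (Or.inl rfl))).mem (mem_upair.2 (Or.inl rfl)),
    (h.mem (mem_upair.2 (Or.inr rfl))).mem (mem_upair.2 (Or.inr rfl))⟩

theorem upair_mem_pr (a c : M) : upair a c ε pr a c := mem_upair.2 (Or.inr rfl)
theorem left_mem_upair (a c : M) : a ε upair a c := mem_upair.2 (Or.inl rfl)
theorem right_mem_upair (a c : M) : c ε upair a c := mem_upair.2 (Or.inr rfl)

variable (v : Fin 2 → M) (z : M)

theorem cons_two : (Fin.cons z v : Fin 3 → M) 2 = v 1 := rfl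

theorem realize_godel1 : godel1.Realize (Fin.cons z v : Fin 3 → M) ↔
    ∀ w, w ε z ↔ w = v 0 ∨ w = v 1 := by
  simp only [godel1, Formula.Realize, realize_isUPair, val_inl, cons_two]
  constructor
  · rintro ⟨h1, h2, h3⟩ w
    exact ⟨h3 w, by rintro (rfl | rfl) <;> assumption⟩
  · exact fun h => ⟨(h _).2 (Or.inl rfl), (h _).2 (Or.inr rfl), fun w => (h w).1⟩

theorem realize_godel2 : godel2.Realize (Fin.cons z v : Fin 3 → M) ↔
    ∀ w, w ε z ↔ ∃ a, a ε v 0 ∧ ∃ c, c ε v 1 ∧ w = pr a c := by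
  simp [godel2, Formula.Realize, Fin.snoc, cons_two]
  constructor
  · rintro ⟨h1, h2⟩ w
    refine ⟨h1 w, ?_⟩
    rintro ⟨a, ha, c, hc, rfl⟩
    exact h2 a ha c hc
  · intro h
    exact ⟨fun w hw => (h w).1 hw, fun a ha c hc => (h _).2 ⟨a, ha, c, hc, rfl⟩⟩

theorem realize_godel3 : godel3.Realize (Fin.cons z v : Fin 3 → M) ↔
    ∀ w, w ε z ↔ ∃ a, a ε v 0 ∧ ∃ c, c ε v 1 ∧ a ε c ∧ w = pr a c := by
  simp [godel3, Formula.Realize, Fin.snoc, cons_two]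
  constructor
  · rintro ⟨h1, h2⟩ w
    refine ⟨h1 w, ?_⟩
    rintro ⟨a, ha, c, hc, hac, rfl⟩
    exact h2 a ha c hc hac
  · intro h
    exact ⟨fun w hw => (h w).1 hw, fun a ha c hc hac => (h _).2 ⟨a, ha, c, hc, hac, rfl⟩⟩

theorem realize_godel4 : godel4.Realize (Fin.cons z v : Fin 3 → M) ↔
    ∀ w, w ε z ↔ w ε v 0 ∧ ¬ w ε v 1 := by
  simp [godel4, Formula.Realize, Fin.snoc, cons_two]
  constructor
  · rintro ⟨h1, h2⟩ w
    exact ⟨h1 w, fun h => h2 w h.1 h.2⟩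
  · intro h
    exact ⟨fun w hw => (h w).1 hw, fun w h1 h2 => (h w).2 ⟨h1, h2⟩⟩

theorem realize_godel5 : godel5.Realize (Fin.cons z v : Fin 3 → M) ↔
    ∀ w, w ε z ↔ w ε v 0 ∧ w ε v 1 := by
  simp [godel5, Formula.Realize, Fin.snoc, cons_two]
  constructor
  · rintro ⟨h1, h2⟩ w
    exact ⟨h1 w, fun h => h2 w h.1 h.2⟩
  · intro h
    exact ⟨fun w hw => (h w).1 hw, fun w h1 h2 => (h w).2 ⟨h1, h2⟩⟩

variable (v : Fin 1 → M)

theorem realize_godel6 : godel6.Realize (Fin.cons z v : Fin 2 → M) ↔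
    ∀ w, w ε z ↔ ∃ s, s ε v 0 ∧ w ε s := by
  simp [godel6, Formula.Realize, Fin.snoc]
  constructor
  · rintro ⟨h1, h2⟩ w
    exact ⟨h1 w, fun ⟨s, hs, hw⟩ => h2 s hs w hw⟩
  · intro h
    exact ⟨fun w hw => (h w).1 hw, fun s hs w hw => (h w).2 ⟨s, hs, hw⟩⟩

theorem realize_godel7 : godel7.Realize (Fin.cons z v : Fin 2 → M) ↔
    ∀ w, w ε z ↔ ∃ c, pr w c ε v 0 := by
  simp [godel7, Formula.Realize, Fin.snoc]
  constructor
  · rintro ⟨h1, h2⟩ w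
    refine ⟨fun hw => ?_, fun ⟨c, hc⟩ => ?_⟩
    · obtain ⟨s, c, h, -⟩ := h1 w hw
      exact ⟨c, h⟩
    · exact h2 _ hc _ (upair_mem_pr w c) _ (left_mem_upair w c) _ (upair_mem_pr w c) _
        (right_mem_upair w c) rfl
  · intro h
    refine ⟨fun w hw => ?_, ?_⟩
    · obtain ⟨c, hc⟩ := (h w).1 hw
      exact ⟨_, c, hc, upair_mem_pr w c, right_mem_upair w c⟩
    · rintro _ hp s - a - t - c - rfl
      exact (h a).2 ⟨c, hp⟩

theorem realize_godel8 : godel8.Realize (Fin.cons z v : Fin 2 → M) ↔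
    ∀ w, w ε z ↔ ∃ a c, pr a c ε v 0 ∧ w = pr c a := by
  simp [godel8, Formula.Realize, Fin.snoc]
  constructor
  · rintro ⟨h1, h2⟩ w
    refine ⟨fun hw => ?_, ?_⟩
    · obtain ⟨-, a, -, c, h, -, -, -, -, rfl⟩ := h1 w hw
      exact ⟨c, a, h, rfl⟩
    · rintro ⟨a, c, hc, rfl⟩
      exact h2 _ hc _ (upair_mem_pr a c) _ (right_mem_upair a c) _ (upair_mem_pr a c) _
        (left_mem_upair a c) rfl
  · intro h
    refine ⟨fun w hw => ?_, ?_⟩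
    · obtain ⟨a, c, hc, rfl⟩ := (h w).1 hw
      exact ⟨_, c, _, a, hc, upair_mem_pr c a, left_mem_upair c a, upair_mem_pr c a,
        right_mem_upair c a, rfl⟩
    · rintro _ hp s - a - t - c - rfl
      exact (h _).2 ⟨c, a, hp, rfl⟩

theorem realize_godel9 : godel9.Realize (Fin.cons z v : Fin 2 → M) ↔
    ∀ w, w ε z ↔ ∃ a c d, pr (pr a c) d ε v 0 ∧ w = pr (pr a d) c := by
  simp [godel9, Formula.Realize, Fin.snoc, exComp, allComp]
  constructor
  · rintro ⟨h1, h2⟩ w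
    refine ⟨fun hw => ?_, ?_⟩
    · obtain ⟨-, -, -, c, -, a, -, d, h, -, -, -, -, -, -, -, -, rfl⟩ := h1 w hw
      exact ⟨_, _, _, h, rfl⟩
    · rintro ⟨a, c, d, h, rfl⟩
      exact h2 _ h _ (upair_mem_pr _ _) _ (left_mem_upair _ _) _ (upair_mem_pr _ _) _
        (right_mem_upair _ _) _ (upair_mem_pr _ _) _ (left_mem_upair _ _) _ (upair_mem_pr _ _) _
        (right_mem_upair _ _) rfl
  · intro h
    refine ⟨fun w hw => ?_, ?_⟩
    · obtain ⟨a, c, d, hq, rfl⟩ := (h w).1 hw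
      exact ⟨_, _, _, c, _, a, _, d, hq, upair_mem_pr _ _, left_mem_upair _ _, upair_mem_pr _ _,
        right_mem_upair _ _, upair_mem_pr _ _, left_mem_upair _ _, upair_mem_pr _ _,
        right_mem_upair _ _, rfl⟩
    · rintro _ hq s - p - s - d - s - a - s - c - rfl
      exact (h _).2 ⟨a, c, d, hq, rfl⟩

theorem realize_godel10 : godel10.Realize (Fin.cons z v : Fin 2 → M) ↔
    ∀ w, w ε z ↔ ∃ a c d, pr (pr a c) d ε v 0 ∧ w = pr (pr d a) c := by
  simp [godel10, Formula.Realize, Fin.snoc, exComp, allComp]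
  constructor
  · rintro ⟨h1, h2⟩ w
    refine ⟨fun hw => ?_, ?_⟩
    · obtain ⟨-, -, -, c, -, a, -, d, h, -, -, -, -, -, -, -, -, rfl⟩ := h1 w hw
      exact ⟨_, _, _, h, rfl⟩
    · rintro ⟨a, c, d, h, rfl⟩
      exact h2 _ h _ (upair_mem_pr _ _) _ (left_mem_upair _ _) _ (upair_mem_pr _ _) _
        (right_mem_upair _ _) _ (upair_mem_pr _ _) _ (left_mem_upair _ _) _ (upair_mem_pr _ _) _
        (right_mem_upair _ _) rfl
  · intro h
    refine ⟨fun w hw => ?_, ?_⟩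
    · obtain ⟨a, c, d, hq, rfl⟩ := (h w).1 hw
      exact ⟨_, _, _, c, _, d, _, a, hq, upair_mem_pr _ _, left_mem_upair _ _, upair_mem_pr _ _,
        right_mem_upair _ _, upair_mem_pr _ _, left_mem_upair _ _, upair_mem_pr _ _,
        right_mem_upair _ _, rfl⟩
    · rintro _ hq s - p - s - d - s - a - s - c - rfl
      exact (h _).2 ⟨a, c, d, hq, rfl⟩

/-- The set operation defined by `φ`, under which `H_{κ⁺}` is closed. -/
def IsOp {m : ℕ} (φ : Lset.Formula (Fin (m + 1))) (v : Fin m → M) : Prop :=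
  ∃ y : M, (∀ z, φ.Realize (Fin.cons z v : Fin (m + 1) → M) ↔ z = y) ∧
    ∀ κ, Ord κ → Sub omega κ → (∀ i, InH κ (v i)) → InH κ y

theorem isOp_of {m : ℕ} {φ : Lset.Formula (Fin (m + 1))} {v : Fin m → M} {P : M → Prop} {y : M}
    (hy : ∀ w, w ε y ↔ P w)
    (hφ : ∀ z, φ.Realize (Fin.cons z v : Fin (m + 1) → M) ↔ ∀ w, w ε z ↔ P w)
    (h : ∀ κ, Ord κ → Sub omega κ → (∀ i, InH κ (v i)) → InH κ y) : IsOp φ v :=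
  ⟨y, fun z => by rw [hφ, eq_iff_of_mem hy], h⟩

/-- Operations given by a rearrangement of the elements of a set. -/
theorem isOp_of_img {m : ℕ} {φ : Lset.Formula (Fin (m + 1))} {v : Fin m → M} {P : M → Prop}
    [Def1 P] {i : Fin m}
    (hφ : ∀ z, φ.Realize (Fin.cons z v : Fin (m + 1) → M) ↔ ∀ w, w ε z ↔ P w)
    (F : M → M) [Fun1 F] (hF : ∀ w, P w → ∃ p, p ε v i ∧ w = F p ∧
      ∀ κ, Ord κ → Sub omega κ → InH κ p → InH κ w) : IsOp φ v := by
  have hsub : ∀ w, P w → w ε img F (v i) := fun w hw => by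
    obtain ⟨p, hp, rfl, -⟩ := hF w hw
    exact mem_img_of hp
  have hmem : ∀ w, w ε sep (img F (v i)) P ↔ P w := fun w => by
    rw [mem_sep]; exact ⟨fun h => h.2, fun h => ⟨hsub w h, h⟩⟩
  refine isOp_of hmem hφ fun κ hκ hω hv => ?_
  refine InH.of_le hκ hω ?_ fun w hw => ?_
  · exact (Le.of_sub fun w hw => hsub w ((hmem w).1 hw)).trans ((le_img _ _).trans (hv i).le)
  · obtain ⟨p, hp, -, h⟩ := hF w ((hmem w).1 hw)
    exact h κ hκ hω ((hv i).mem hp)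

theorem isOp_godel (i : Fin 10) (v : Fin (godel i).1 → M) : IsOp (godel i).2 v := by
  fin_cases i
  · change Fin 2 → M at v
    change IsOp godel1 v
    exact isOp_of (y := upair (v 0) (v 1)) (fun w => mem_upair) (fun z => realize_godel1 v z)
      fun κ hκ hω hv => inH_upair hκ hω (hv _) (hv _)
  · change Fin 2 → M at v
    change IsOp godel2 v
    exact isOp_of (y := prod (v 0) (v 1)) (fun w => mem_prod) (fun z => realize_godel2 v z)
      fun κ hκ hω hv => inH_prod hκ hω (hv _) (hv _)
  · change Fin 2 → M at v
    change IsOp godel3 v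
    refine isOp_of (y := sep (prod (v 0) (v 1)) fun p => fst p ε snd p) (fun w => ?_)
      (fun z => realize_godel3 v z)
      fun κ hκ hω hv => (inH_prod hκ hω (hv _) (hv _)).sub fun z hz => (mem_sep.1 hz).1
    rw [mem_sep, mem_prod]
    constructor
    · rintro ⟨⟨a, ha, c, hc, rfl⟩, h⟩
      rw [fst_pr, snd_pr] at h
      exact ⟨a, ha, c, hc, h, rfl⟩
    · rintro ⟨a, ha, c, hc, h, rfl⟩
      exact ⟨⟨a, ha, c, hc, rfl⟩, by rwa [fst_pr, snd_pr]⟩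
  · change Fin 2 → M at v
    change IsOp godel4 v
    exact isOp_of (y := sep (v 0) fun w => ¬ w ε v 1) (fun w => mem_sep)
      (fun z => realize_godel4 v z) fun κ hκ hω hv => (hv 0).sub fun z hz => (mem_sep.1 hz).1
  · change Fin 2 → M at v
    change IsOp godel5 v
    exact isOp_of (y := sep (v 0) fun w => w ε v 1) (fun w => mem_sep)
      (fun z => realize_godel5 v z) fun κ hκ hω hv => (hv 0).sub fun z hz => (mem_sep.1 hz).1
  · change Fin 1 → M at v
    change IsOp godel6 v
    exact isOp_of (y := sUnion (v 0)) (fun w => mem_sUnion)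
      (fun z => realize_godel6 z v) fun κ hκ hω hv => (hv 0).sUnion
  · change Fin 1 → M at v
    change IsOp godel7 v
    refine isOp_of_img (P := fun w => ∃ c, pr w c ε v 0) (i := 0) (fun z => realize_godel7 z v)
      fst ?_
    rintro w ⟨c, hc⟩
    exact ⟨_, hc, (fst_pr ..).symm, fun κ _ _ h => (inH_of_pr h).1⟩
  · change Fin 1 → M at v
    change IsOp godel8 v
    refine isOp_of_img (P := fun w => ∃ a c, pr a c ε v 0 ∧ w = pr c a) (i := 0)
      (fun z => realize_godel8 z v) (fun p => pr (snd p) (fst p)) ?_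
    rintro _ ⟨a, c, hc, rfl⟩
    exact ⟨_, hc, by simp only [fst_pr, snd_pr], fun κ hκ hω h =>
      inH_pr hκ hω (inH_of_pr h).2 (inH_of_pr h).1⟩
  · change Fin 1 → M at v
    change IsOp godel9 v
    refine isOp_of_img (P := fun w => ∃ a c d, pr (pr a c) d ε v 0 ∧ w = pr (pr a d) c) (i := 0)
      (fun z => realize_godel9 z v) (fun p => pr (pr (fst (fst p)) (snd p)) (snd (fst p))) ?_
    rintro _ ⟨a, c, d, h, rfl⟩
    refine ⟨_, h, by simp only [fst_pr, snd_pr], fun κ hκ hω h => ?_⟩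
    have h1 := (inH_of_pr h).1
    exact inH_pr hκ hω (inH_pr hκ hω (inH_of_pr h1).1 (inH_of_pr h).2) (inH_of_pr h1).2
  · change Fin 1 → M at v
    change IsOp godel10 v
    refine isOp_of_img (P := fun w => ∃ a c d, pr (pr a c) d ε v 0 ∧ w = pr (pr d a) c) (i := 0)
      (fun z => realize_godel10 z v) (fun p => pr (pr (snd p) (fst (fst p))) (snd (fst p))) ?_
    rintro _ ⟨a, c, d, h, rfl⟩
    refine ⟨_, h, by simp only [fst_pr, snd_pr], fun κ hκ hω h => ?_⟩
    have h1 := (inH_of_pr h).1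
    exact inH_pr hκ hω (inH_pr hκ hω (inH_of_pr h).2 (inH_of_pr h1).1) (inH_of_pr h1).2

/-- Every function symbol of `∈_{Δ₀}` denotes an operation under which `H_{κ⁺}` is closed. -/
theorem isOp_of_mem_D {m : ℕ} {φ : Lset.Formula (Fin (m + 1))}
    (h : ((⟨m, φ⟩ : Form Lset), (1 : Fin 2)) ∈ D) (v : Fin m → M) : IsOp φ v := by
  rcases h with (h | h | h) | ⟨i, hi⟩
  · exact absurd h.2 one_ne_zero
  · obtain ⟨rfl, h⟩ := Sigma.mk.inj (Prod.mk.inj h).1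
    obtain rfl := eq_of_heq h
    exact ⟨emp, fun z => by simp [Formula.Realize, isEmp_iff], fun κ _ hω _ => inH_emp hω⟩
  · obtain ⟨rfl, h⟩ := Sigma.mk.inj (Prod.mk.inj h).1
    obtain rfl := eq_of_heq h
    refine ⟨omega, fun z => ?_, fun κ _ hω _ => inH_omega hω⟩
    simp only [Formula.Realize, realize_isOmega, val_inl, Fin.cons_zero]
    exact ⟨fun h => h.eq isOmega_omega, by rintro rfl; exact isOmega_omega⟩
  · have h := (Prod.mk.inj hi).1
    have := isOp_godel (M := M) i
    rw [h] at this
    exact this v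

end Hereditary

/-! ### Hulls and their collapses -/

section Hull

variable {M : Type u} [Lset.Structure M] [hM : ZFC.Model M] {n : ℕ}

/-- `T` is the union of the stages `U ↦ U ∪ G U` iterated `ω` times from `X₀`. Since `G` acts on
whole stages, closure of `T` is phrased through a stage `U`. Any two elements share a stage because
the stages increase, and two are what closure under unordered pairs requires. -/
theorem exists_closure (X₀ : M) (G : M → M) [Fun1 G] : ∃ T, Sub X₀ T ∧
    (∀ a c, a ε T → c ε T → ∃ U, a ε U ∧ c ε U ∧ Sub U T ∧ Sub (G U) T) ∧
    (∀ W, Sub X₀ W → (∀ U, Sub U W → Sub (G U) W) → Sub T W) ∧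
    ∀ κ, Ord κ → Sub omega κ → Le X₀ κ → (∀ U, Le U κ → Le (G U) κ) → Le T κ := by
  obtain ⟨F, hF⟩ := exists_iter X₀ G
  have hmono : ∀ k m, m ε omega → k ε m → Sub (app F k) (app F m) := fun k m hm hk z hz =>
    (hF m hm z).2 (Or.inr ⟨k, hk, Or.inl hz⟩)
  have hT : ∀ m, m ε omega → Sub (app F m) (sUnion (img (app F) omega)) := fun m hm z hz =>
    mem_sUnion.2 ⟨_, mem_img_of hm, hz⟩
  have hG : ∀ m, m ε omega → Sub (G (app F m)) (sUnion (img (app F) omega)) := fun m hm z hz =>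
    hT _ (suc_mem_omega hm) _
      ((hF _ (suc_mem_omega hm) z).2 (Or.inr ⟨m, mem_suc.2 (Or.inr rfl), Or.inr hz⟩))
  refine ⟨sUnion (img (app F) omega), ?_, ?_, ?_, ?_⟩
  · intro z hz
    exact hT _ emp_mem_omega _ ((hF _ emp_mem_omega z).2 (Or.inl hz))
  · intro a c ha hc
    obtain ⟨_, h1, ha⟩ := mem_sUnion.1 ha
    obtain ⟨k, hk, rfl⟩ := mem_img.1 h1
    obtain ⟨_, h1, hc⟩ := mem_sUnion.1 hc
    obtain ⟨m, hm, rfl⟩ := mem_img.1 h1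
    rcases (ord_omega.mem hk).linear (ord_omega.mem hm) with h | rfl | h
    · exact ⟨_, hmono k m hm h a ha, hc, hT m hm, hG m hm⟩
    · exact ⟨_, ha, hc, hT k hm, hG k hm⟩
    · exact ⟨_, ha, hmono m k hk h c hc, hT k hk, hG k hk⟩
  · intro W hW hGW z hz
    obtain ⟨_, h1, hz⟩ := mem_sUnion.1 hz
    obtain ⟨m, hm, rfl⟩ := mem_img.1 h1
    refine trans_induction ord_omega.1 (fun m => Sub (app F m) W) ?_ m hm z hz
    intro m hm ih z hz
    rcases (hF m hm z).1 hz with h | ⟨k, hk, h | h⟩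
    · exact hW z h
    · exact ih k hk z h
    · exact hGW _ (ih k hk) z h
  · intro κ hκ hω h0 hGκ
    refine le_biUnion hκ hω (Le.of_sub hω) (app F) ?_
    refine trans_induction ord_omega.1 (fun m => Le (app F m) κ) ?_
    intro m hm ih
    refine (Le.of_sub
      (t := union X₀ (sUnion (img (fun k => union (app F k) (G (app F k))) m))) ?_).trans
      (le_union hκ hω h0 (le_biUnion hκ hω (Le.of_sub ((ord_omega.1 m hm).trans hω)) _ fun k hk =>
        le_union hκ hω (ih k hk) (hGκ _ (ih k hk))))
    intro z hz
    rw [mem_union, mem_sUnion]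
    rcases (hF m hm z).1 hz with h | ⟨k, hk, h⟩
    · exact Or.inl h
    · exact Or.inr ⟨_, mem_img_of hk, mem_union.2 h⟩

/-- A set of pairs' unordered pairs. -/
def upairs (U : M) : M := img (fun p => upair (fst p) (snd p)) (prod U U)

instance (f : (Fin n → M) → M) [DefF f] : DefF fun v => upairs (f v) := by
  unfold upairs; infer_instance

theorem upair_mem_upairs {U a c : M} (ha : a ε U) (hc : c ε U) : upair a c ε upairs U :=
  mem_img.2 ⟨pr a c, pr_mem_prod.2 ⟨ha, hc⟩, by rw [fst_pr, snd_pr]⟩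

theorem mem_upairs {U z : M} : z ε upairs U ↔ ∃ a c, a ε U ∧ c ε U ∧ z = upair a c := by
  constructor
  · intro h
    obtain ⟨p, hp, rfl⟩ := mem_img.1 h
    obtain ⟨a, ha, c, hc, rfl⟩ := mem_prod.1 hp
    exact ⟨a, c, ha, hc, by rw [fst_pr, snd_pr]⟩
  · rintro ⟨a, c, ha, hc, rfl⟩; exact upair_mem_upairs ha hc

/-- Closed under unordered pairs and containing `∅`. -/
def PairClosed (X : M) : Prop := emp ε X ∧ ∀ a c, a ε X → c ε X → upair a c ε X

theorem PairClosed.pr {X : M} (h : PairClosed X) {a c : M} (ha : a ε X) (hc : c ε X) :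
    pr a c ε X := h.2 _ _ (h.2 _ _ ha ha) (h.2 _ _ ha hc)

/-- A set-sized stand-in for the universe. Truth of all formulas in `M` cannot be handled inside
`M`, but bounded quantifiers over elements of a transitive `T` never leave `T`, so Skolem functions
with values in `T` are enough. -/
theorem exists_ambient (Y : M) : ∃ T, Sub Y T ∧ Trans T ∧ PairClosed T := by
  obtain ⟨T, hY, hT, -, -⟩ := exists_closure (union Y (upair emp emp))
    (fun U => union (sUnion U) (upairs U))
  refine ⟨T, fun z hz => hY z (mem_union.2 (Or.inl hz)), fun z hz w hw => ?_, ?_,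
    fun a c ha hc => ?_⟩
  · obtain ⟨U, hz, -, -, h⟩ := hT z z hz hz
    exact h w (mem_union.2 (Or.inl (mem_sUnion.2 ⟨z, hz, hw⟩)))
  · exact hY _ (mem_union.2 (Or.inr (mem_upair.2 (Or.inl rfl))))
  · obtain ⟨U, ha, hc, -, h⟩ := hT a c ha hc
    exact h _ (mem_union.2 (Or.inr (upair_mem_upairs ha hc)))

/-- Set-valued closure operations with small values in `T`. -/
structure IsClos (T κ : M) (g : M → M) : Prop where
  fun1 : Fun1 g
  sub : ∀ x, Sub (g x) T
  le : ∀ x, Le (g x) κ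

variable {T κ : M}

theorem IsClos.union (hκ : Ord κ) (hω : Sub omega κ) {g h : M → M} (hg : IsClos T κ g)
    (hh : IsClos T κ h) : IsClos T κ fun x => union (g x) (h x) := by
  have := hg.fun1
  have := hh.fun1
  refine ⟨inferInstance, fun x z hz => ?_, fun x => le_union hκ hω (hg.le x) (hh.le x)⟩
  exact (mem_union.1 hz).elim (hg.sub x z) (hh.sub x z)

/-- A Skolem function for `P` on `T`. -/
theorem exists_skolem (hω : Sub omega κ) (hT : PairClosed T) (P : M → M → Prop) [Def2 P] :
    ∃ g, IsClos T κ g ∧ ∀ x, (∃ z, z ε T ∧ P x z) → ∃ z, z ε g x ∧ P x z := by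
  obtain ⟨c, hc, h1, h2⟩ := exists_choice T P
  refine ⟨fun x => upair (c x) (c x), ⟨inferInstance, fun x z hz => ?_, fun x => le_upair hω _ _⟩,
    fun x hx => ⟨c x, mem_upair.2 (Or.inl rfl), (h1 x hx).2⟩⟩
  obtain rfl : z = c x := by simpa using hz
  by_cases hx : ∃ w, w ε T ∧ P x w
  · exact (h1 x hx).1
  · rw [h2 x hx]; exact hT.1

/-- The downward Löwenheim–Skolem argument: close `Y ∪ {∅}` under `g` and unordered pairs. The size
bound passes through every stage, and the hull stays inside `T` because `T` is closed under both. -/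
theorem exists_clos (hκ : Ord κ) (hω : Sub omega κ) (hT : PairClosed T) {Y : M} (hYT : Sub Y T)
    (hY : Le Y κ) {g : M → M} (hg : IsClos T κ g) :
    ∃ X, Sub Y X ∧ Sub X T ∧ Le X κ ∧ PairClosed X ∧ ∀ x, x ε X → Sub (g x) X := by
  have := hg.fun1
  obtain ⟨X, hYX, hX, hW, hle⟩ := exists_closure (AMC.union Y (upair emp emp))
    (fun U => AMC.union (sUnion (img g U)) (upairs U))
  refine ⟨X, fun z hz => hYX z (mem_union.2 (Or.inl hz)), ?_, ?_, ⟨?_, fun a c ha hc => ?_⟩,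
    fun x hx z hz => ?_⟩
  · refine hW T (fun z hz => ?_) fun U hU z hz => ?_
    · rcases mem_union.1 hz with h | h
      · exact hYT z h
      · obtain rfl : z = emp := by simpa using h
        exact hT.1
    · rcases mem_union.1 hz with h | h
      · obtain ⟨_, h1, hz⟩ := mem_sUnion.1 h
        obtain ⟨x, -, rfl⟩ := mem_img.1 h1
        exact hg.sub x z hz
      · obtain ⟨a, c, ha, hc, rfl⟩ := mem_upairs.1 h
        exact hT.2 a c (hU a ha) (hU c hc)
  · exact hle κ hκ hω (le_union hκ hω hY (le_upair hω _ _)) fun U hU =>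
      le_union hκ hω (le_biUnion hκ hω hU g fun x _ => hg.le x)
        ((le_img _ _).trans (le_prod_small hκ hω hU hU))
  · exact hYX _ (mem_union.2 (Or.inr (mem_upair.2 (Or.inl rfl))))
  · obtain ⟨U, ha, hc, -, h⟩ := hX a c ha hc
    exact h _ (mem_union.2 (Or.inr (upair_mem_upairs ha hc)))
  · obtain ⟨U, hx, -, -, h⟩ := hX x x hx hx
    exact h z (mem_union.2 (Or.inl (mem_sUnion.2 ⟨_, mem_img_of hx, hz⟩)))

/-- `π` is an injective transitive collapse of `X`. -/
structure IsCollapse (X π : M) : Prop where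
  pair : PairClosed X
  eq : ∀ x, x ε X → app π x = img (app π) (sep X fun z => z ε x)
  inj : ∀ x y, x ε X → y ε X → app π x = app π y → x = y

/-- As `X` need not be transitive, the collapse sees only the elements of `x` that lie in `X`. It is
injective because distinct members of `X` already differ at some element of `X`; the proof is by
`∈`-induction on one of the two points. -/
theorem exists_isCollapse {X : M} (hX : PairClosed X)
    (he : ∀ x y, x ε X → y ε X → x ≠ y → ∃ z, z ε X ∧ ¬ (z ε x ↔ z ε y)) :
    ∃ π, IsCollapse X π := by
  obtain ⟨π, hπ⟩ := exists_rec X E (fun s => s) (wfOn_mem X)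
  refine ⟨π, hX, hπ, fun x y hx hy hxy => ?_⟩
  refine (wfOn_mem X).induction (fun x => ∀ y, y ε X → app π x = app π y → x = y) ?_ x hx y hy hxy
  intro x hx ih y hy hxy
  by_contra hne
  have hm : ∀ z, (∃ w, w ε sep X (fun y => y ε x) ∧ z = app π w) ↔
      ∃ w, w ε sep X (fun z => z ε y) ∧ z = app π w := fun z => by
    rw [← mem_img, ← mem_img, ← hπ x hx, ← hπ y hy, hxy]
  obtain ⟨z, hz, hzn⟩ := he x y hx hy hne
  by_cases hzx : z ε x
  · obtain ⟨w, hw, hzw⟩ := (hm (app π z)).1 ⟨z, mem_sep.2 ⟨hz, hzx⟩, rfl⟩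
    rw [mem_sep] at hw
    obtain rfl := ih z hz hzx w hw.1 hzw
    tauto
  · have hzy : z ε y := by tauto
    obtain ⟨w, hw, hzw⟩ := (hm (app π z)).2 ⟨z, mem_sep.2 ⟨hz, hzy⟩, rfl⟩
    rw [mem_sep] at hw
    obtain rfl := ih w hw.1 hw.2 z hz hzw.symm
    exact hzx hw.2

namespace IsCollapse

variable {X π : M}

theorem mem_app (h : IsCollapse X π) {x z : M} (hx : x ε X) :
    z ε app π x ↔ ∃ w, w ε X ∧ w ε x ∧ z = app π w := by
  rw [h.eq x hx, mem_img]
  simp only [mem_sep, and_assoc]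

theorem mem_iff (h : IsCollapse X π) {x y : M} (hx : x ε X) (hy : y ε X) :
    app π x ε app π y ↔ x ε y := by
  rw [h.mem_app hy]
  constructor
  · rintro ⟨w, hw, hwy, he⟩
    rwa [h.inj x w hx hw he]
  · exact fun hxy => ⟨x, hx, hxy, rfl⟩

theorem fix (h : IsCollapse X π) {x : M} (hx : x ε X) (hz : ∀ z, z ε x → z ε X ∧ app π z = z) :
    app π x = x := by
  refine ext fun w => ?_
  rw [h.mem_app hx]
  constructor
  · rintro ⟨z, -, hzx, rfl⟩
    rwa [(hz z hzx).2]
  · exact fun hw => ⟨w, (hz w hw).1, hw, (hz w hw).2.symm⟩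

theorem fix_trans (h : IsCollapse X π) {t : M} (ht : Trans t) (htX : Sub t X) :
    ∀ x, x ε t → app π x = x :=
  trans_induction ht (fun x => app π x = x) fun x hx ih =>
    h.fix (htX x hx) fun z hz => ⟨htX z (ht x hx z hz), ih z hz⟩

theorem fix_upair (h : IsCollapse X π) {a c : M} (ha : a ε X) (hc : c ε X) (ha' : app π a = a)
    (hc' : app π c = c) :
    app π (upair a c) = upair a c := by
  refine h.fix (h.pair.2 a c ha hc) fun z hz => ?_
  rcases mem_upair.1 hz with rfl | rfl <;> exact ⟨‹_›, ‹_›⟩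

theorem fix_pr (h : IsCollapse X π) {a c : M} (ha : a ε X) (hc : c ε X) (ha' : app π a = a)
    (hc' : app π c = c) :
    app π (pr a c) = pr a c :=
  h.fix_upair (h.pair.2 _ _ ha ha) (h.pair.2 _ _ ha hc) (h.fix_upair ha ha ha' ha')
    (h.fix_upair ha hc ha' hc')

/-- The range of the collapse is transitive and is an image of `X`, so it witnesses the size bound
for each of its subsets. -/
theorem inH (h : IsCollapse X π) (hX : Le X κ) {x : M} (hx : x ε X) : InH κ (app π x) := by
  refine InH.of_trans_sub (t := img (app π) X) ?_ ((le_img _ _).trans hX) ?_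
  · intro z hz w hw
    obtain ⟨y, hy, rfl⟩ := mem_img.1 hz
    obtain ⟨u, hu, -, rfl⟩ := (h.mem_app hy).1 hw
    exact mem_img_of hu
  · intro z hz
    obtain ⟨u, hu, -, rfl⟩ := (h.mem_app hx).1 hz
    exact mem_img_of hu

end IsCollapse

end Hull

/-! ### Collapsed hulls reflect `Δ₀`-formulas -/

section Hull

variable {M : Type u} [Lset.Structure M] [hM : ZFC.Model M] {n k m : ℕ}

/-- Tuples as iterated pairs. -/
def code : ∀ {k : ℕ}, (Fin k → M) → M
  | 0, _ => emp
  | _ + 1, v => pr (v 0) (code fun i => v i.succ)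

/-- Entries of a tuple. -/
def nth : ℕ → M → M
  | 0, p => fst p
  | i + 1, p => nth i (snd p)

instance (i : ℕ) (f : (Fin n → M) → M) [DefF f] : DefF fun v => nth i (f v) := by
  induction i generalizing f with
  | zero => unfold nth; infer_instance
  | succ i ih => unfold nth; exact ih _

theorem nth_code : ∀ {k : ℕ} (v : Fin k → M) (i : Fin k), nth i (code v) = v i
  | k + 1, v, i => by
    refine Fin.cases ?_ (fun i => ?_) i
    · simp [code, nth, fst_pr]
    · simpa [code, nth, snd_pr] using nth_code (fun i => v i.succ) i

theorem code_mem {X : M} (hX : PairClosed X) : ∀ {k : ℕ} (v : Fin k → M), (∀ i, v i ε X) →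
    code v ε X
  | 0, _, _ => hX.1
  | _ + 1, _, h => hX.pr (h 0) (code_mem hX _ fun i => h i.succ)

theorem Def.realize (φ : Lset.BoundedFormula (Fin k) m) (f : Fin k → (Fin n → M) → M)
    (g : Fin m → (Fin n → M) → M) (hf : ∀ i, DefF (f i)) (hg : ∀ i, DefF (g i)) :
    Def fun w => φ.Realize (fun i => f i w) (fun j => g j w) := by
  have h : Def fun w : Fin (k + m) → M =>
      φ.Realize (fun i => w (i.castAdd m)) (fun j => w (j.natAdd k)) := by
    refine ⟨BoundedFormula.relabel (n := k + m) (k := 0)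
      (fun i => Sum.inr (Sum.elim (Fin.castAdd m) (Fin.natAdd k) i)) φ.toFormula, fun v => ?_⟩
    rw [BoundedFormula.realize_relabel, Formula.boundedFormula_realize_eq_realize,
      BoundedFormula.realize_toFormula]
    rfl
  refine (h.substs (fun i => Fin.addCases f g i) fun i => ?_).congr fun w => ?_
  · refine Fin.addCases (fun i => ?_) (fun i => ?_) i
    · rw [Fin.addCases_left]; exact hf i
    · rw [Fin.addCases_right]; exact hg i
  · simp only [Fin.addCases_left, Fin.addCases_right]

/-- `φ` is preserved by the collapse `π` of `X`. -/
def Pres (X π : M) (φ : Lset.BoundedFormula (Fin k) m) : Prop :=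
  ∀ v xs, (∀ i, v i ε X) → (∀ i, xs i ε X) →
    (φ.Realize v xs ↔ φ.Realize (fun i => app π (v i)) (fun i => app π (xs i)))

variable {T κ : M}

/-- A property of `X` and its collapse that holds as soon as `X` is closed under some function. -/
def ByClos (T κ : M) (P : M → M → Prop) : Prop :=
  ∃ g, IsClos T κ g ∧ ∀ X π, IsCollapse X π → Sub X T → (∀ x, x ε X → Sub (g x) X) → P X π

theorem ByClos.and (hκ : Ord κ) (hω : Sub omega κ) {P Q : M → M → Prop} (hP : ByClos T κ P)
    (hQ : ByClos T κ Q) : ByClos T κ fun X π => P X π ∧ Q X π := by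
  obtain ⟨g, hg, hgP⟩ := hP
  obtain ⟨h, hh, hhQ⟩ := hQ
  exact ⟨_, hg.union hκ hω hh, fun X π hπ hX hc =>
    ⟨hgP X π hπ hX fun x hx z hz => hc x hx z (mem_union.2 (Or.inl hz)),
      hhQ X π hπ hX fun x hx z hz => hc x hx z (mem_union.2 (Or.inr hz))⟩⟩

theorem ByClos.mono {P Q : M → M → Prop} (hP : ByClos T κ P)
    (h : ∀ X π, IsCollapse X π → Sub X T → P X π → Q X π) : ByClos T κ Q := by
  obtain ⟨g, hg, hgP⟩ := hP
  exact ⟨g, hg, fun X π hπ hX hc => h X π hπ hX (hgP X π hπ hX hc)⟩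

theorem ByClos.skolem (hω : Sub omega κ) (hT : PairClosed T) (P : M → M → Prop) [Def2 P] :
    ByClos T κ fun X _ => ∀ x, x ε X → (∃ z, z ε T ∧ P x z) → ∃ z, z ε X ∧ P x z := by
  obtain ⟨g, hg, h⟩ := exists_skolem hω hT P
  refine ⟨g, hg, fun X π _ _ hc x hx hz => ?_⟩
  obtain ⟨z, hz, hP⟩ := h x hz
  exact ⟨z, hc x hx z hz, hP⟩

theorem ByClos.true (hω : Sub omega κ) (hT : PairClosed T) {P : M → M → Prop}
    (h : ∀ X π, IsCollapse X π → P X π) : ByClos T κ P :=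
  (ByClos.skolem hω hT fun x z => x = z).mono fun X π hπ _ _ => h X π hπ

theorem val_app {X π : M} {v : Fin k → M} {xs : Fin m → M} (hv : ∀ i, v i ε X)
    (hxs : ∀ i, xs i ε X) (y : Fin k ⊕ Fin m) :
    val (fun i => app π (v i)) (fun i => app π (xs i)) y = app π (val v xs y) ∧
      val v xs y ε X := by
  rcases y with y | y
  · exact ⟨rfl, hv y⟩
  · exact ⟨rfl, hxs y⟩

/-- Only the bounded quantifier needs closure. Every element of `π(y)` is `π(z)` for some `z ∈ X ∩
y`, which gives one direction. For the other, a counterexample `z ∈ y` lies in the transitive set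
`T`, and a Skolem function supplies one in `X`. -/
theorem byClos_pres (hκ : Ord κ) (hω : Sub omega κ) (ht : Trans T) (hT : PairClosed T)
    {φ : Lset.BoundedFormula (Fin k) m} (hφ : IsDelta0 φ) :
    ByClos T κ fun X π => Pres X π φ := by
  induction hφ with
  | falsum => exact ByClos.true hω hT fun X π _ v xs _ _ => Iff.rfl
  | mem y z =>
    refine ByClos.true hω hT fun X π hπ v xs hv hxs => ?_
    have hy := val_app (π := π) hv hxs y
    have hz := val_app (π := π) hv hxs z
    rw [realize_mem, realize_mem, hy.1, hz.1, hπ.mem_iff hy.2 hz.2]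
  | eq y z =>
    refine ByClos.true hω hT fun X π hπ v xs hv hxs => ?_
    have hy := val_app (π := π) hv hxs y
    have hz := val_app (π := π) hv hxs z
    rw [realize_eq, realize_eq, hy.1, hz.1]
    exact ⟨fun h => by rw [h], fun h => hπ.inj _ _ hy.2 hz.2 h⟩
  | imp _ _ ih1 ih2 =>
    refine (ih1.and hκ hω ih2).mono fun X π _ _ h v xs hv hxs => ?_
    rw [BoundedFormula.realize_imp, BoundedFormula.realize_imp, h.1 v xs hv hxs,
      h.2 v xs hv hxs]
  | @bAll m y φ _ ih =>
    -- Skolem functions here are unary, so both tuples of variables are packed into a single `p`.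
    let P : M → M → Prop := fun p z =>
      z ε val (fun i : Fin k => nth i (fst p)) (fun i : Fin m => nth i (snd p)) y ∧
        ¬ φ.Realize (fun i : Fin k => nth i (fst p))
          (Fin.snoc (fun i : Fin m => nth i (snd p)) z : Fin (m + 1) → M)
    have hP : Def2 P := by
      have h1 : DefF fun w : Fin 2 → M =>
          val (fun i : Fin k => nth i (fst (lst (ini w))))
            (fun i : Fin m => nth i (snd (lst (ini w)))) y := by
        rcases y with y | y <;> simp only [val_inl, val_inr] <;> infer_instance
      have h2 : Def fun w : Fin 2 → M => φ.Realize (fun i : Fin k => nth i (fst (lst (ini w))))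
          (Fin.snoc (fun i : Fin m => nth i (snd (lst (ini w)))) (lst w) : Fin (m + 1) → M) := by
        refine (Def.realize φ (fun i w => nth i (fst (lst (ini w))))
          (Fin.snoc (fun (i : Fin m) w => nth i (snd (lst (ini w)))) lst) (fun i => inferInstance)
          (fun i => ?_)).congr fun w => ?_
        · refine Fin.lastCases ?_ (fun i => ?_) i
          · rw [Fin.snoc_last]; infer_instance
          · rw [Fin.snoc_castSucc]; infer_instance
        · rw [iff_iff_eq]; congr; funext i
          refine Fin.lastCases ?_ (fun i => ?_) i <;> simp
      exact ⟨Def.and _ _⟩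
    refine (ih.and hκ hω (ByClos.skolem hω hT P)).mono fun X π hπ hXT h v xs hv hxs => ?_
    obtain ⟨h1, h2⟩ := h
    have hy := val_app (π := π) hv hxs y
    have hsn : ∀ z, z ε X → ∀ i, (Fin.snoc xs z : Fin (m + 1) → M) i ε X := fun z hz i => by
      refine Fin.lastCases ?_ (fun i => ?_) i
      · simpa using hz
      · simpa using hxs i
    have hsn' : ∀ z, (fun i => app π ((Fin.snoc xs z : Fin (m + 1) → M) i)) =
        Fin.snoc (fun i => app π (xs i)) (app π z) := fun z => by
      funext i
      refine Fin.lastCases ?_ (fun i => ?_) i <;> simp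
    rw [realize_bAll, realize_bAll, hy.1]
    constructor
    · intro h w hw
      obtain ⟨z, hz, hzy, rfl⟩ := (hπ.mem_app hy.2).1 hw
      rw [← hsn', ← h1 v _ hv (hsn z hz)]
      exact h z hzy
    · intro h
      by_contra hn
      push Not at hn
      obtain ⟨z, hzy, hz⟩ := hn
      have hcode : ∀ z, P (pr (code v) (code xs)) z ↔
          z ε val v xs y ∧ ¬ φ.Realize v (Fin.snoc xs z : Fin (m + 1) → M) := fun z => by
        simp only [P, fst_pr, snd_pr, nth_code]
      -- The code of the tuple belongs to `X` because `X` is closed under pairs and contains `∅`.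
      obtain ⟨z, hzX, hP⟩ := h2 (pr (code v) (code xs))
        (hπ.pair.pr (code_mem hπ.pair v hv) (code_mem hπ.pair xs hxs))
        ⟨z, ht _ (hXT _ hy.2) z hzy, (hcode z).2 ⟨hzy, hz⟩⟩
      obtain ⟨hzy, hz⟩ := (hcode z).1 hP
      rw [h1 v _ hv (hsn z hzX), hsn'] at hz
      exact hz (h _ ((hπ.mem_iff hzX hy.2).2 hzy))

/-- A formula with arbitrarily many variables. -/
abbrev AnyForm : Type := Σ k : ℕ, Lset.Formula (Fin k)

theorem byClos_pres_list (hκ : Ord κ) (hω : Sub omega κ) (ht : Trans T) (hT : PairClosed T)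
    (Φ : List AnyForm) (hΦ : ∀ φ ∈ Φ, IsDelta0 φ.2) :
    ByClos T κ fun X π => ∀ φ ∈ Φ, Pres X π φ.2 := by
  induction Φ with
  | nil => exact ByClos.true hω hT fun X π _ φ hφ => by simp at hφ
  | cons φ Φ ih =>
    rw [List.forall_mem_cons] at hΦ
    exact ((byClos_pres hκ hω ht hT hΦ.1).and hκ hω (ih hΦ.2)).mono fun X π _ _ h => by
      rwa [List.forall_mem_cons]

/-- `X` is a hull with collapse `π` into `H_{κ⁺}`, fixing `κ` and everything that is explicitly
coded by a subset of `κ`. -/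
structure IsHull (κ X π : M) : Prop where
  collapse : IsCollapse X π
  inH : ∀ x, x ε X → InH κ (app π x)
  mem : κ ε X
  fix : app π κ = κ
  fix_coded : ∀ t f, t ε X → f ε X → Trans t → IsInj f t κ →
    app π t = t ∧ app π f = f ∧ ∀ a, a ε t → app π a = a

/-- Three closure operations are combined: `g` makes the `Δ₀`-formulas of `Φ` survive the collapse,
`g1` provides elements that separate distinct members of `X`, so that the collapse is injective, and
`g2` inverts the injections `f` in `X`. -/
theorem exists_isHull (hκ : Ord κ) (hω : Sub omega κ) {Y : M} (hY : Le Y κ)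
    (Φ : List AnyForm) (hΦ : ∀ φ ∈ Φ, IsDelta0 φ.2) :
    ∃ X π, IsHull κ X π ∧ Sub Y X ∧ ∀ φ ∈ Φ, Pres X π φ.2 := by
  -- Adjoining `suc κ` puts `κ` and all its elements in the hull.
  have hY' : Le (union Y (suc κ)) κ := le_union hκ hω hY (le_of_infinite hω)
  obtain ⟨T, hYT, ht, hT⟩ := exists_ambient (union Y (suc κ))
  obtain ⟨g, hg, H⟩ := byClos_pres_list hκ hω ht hT Φ hΦ
  obtain ⟨g1, hg1, H1⟩ := exists_skolem hω hT (fun p z => ¬ (z ε fst p ↔ z ε snd p))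
  obtain ⟨g2, hg2, H2⟩ := exists_skolem hω hT
    (fun p z => z ε fst p ∧ pr z (snd (snd p)) ε fst (snd p))
  obtain ⟨X, hYX, hXT, hX, hXp, hcl⟩ := exists_clos hκ hω hT hYT hY'
    ((hg.union hκ hω hg1).union hκ hω hg2)
  have hκX : κ ε X := hYX _ (mem_union.2 (Or.inr (mem_suc.2 (Or.inr rfl))))
  have hκX' : Sub κ X := fun z hz => hYX _ (mem_union.2 (Or.inr (mem_suc.2 (Or.inl hz))))
  obtain ⟨π, hπ⟩ := exists_isCollapse hXp fun x y hx hy hne => by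
    have : ∃ z, ¬ (z ε x ↔ z ε y) := by
      by_contra hc
      push Not at hc
      exact hne (ext fun z => by have := hc z; tauto)
    obtain ⟨z, hz⟩ := this
    obtain ⟨z, hz, hP⟩ := H1 (pr x y) ⟨z, by
      by_cases h : z ε x
      · exact ht x (hXT x hx) z h
      · exact ht y (hXT y hy) z (by tauto), by simpa only [fst_pr, snd_pr] using hz⟩
    exact ⟨z, hcl _ (hXp.pr hx hy) z (mem_union.2 (Or.inl (mem_union.2 (Or.inr hz)))),
      by simpa only [fst_pr, snd_pr] using hP⟩
  refine ⟨X, π, ⟨hπ, fun x hx => hπ.inH hX hx, hκX, ?_, fun t f htX hfX htt hf => ?_⟩,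
    fun z hz => hYX z (mem_union.2 (Or.inl hz)), ?_⟩
  · exact hπ.fix hκX fun z hz => ⟨hκX' z hz, hπ.fix_trans hκ.1 hκX' z hz⟩
  · have htX' : Sub t X := fun x hx => by
      obtain ⟨z, hz, hz'⟩ := H2 (pr t (pr f (app f x))) ⟨x, ht t (hXT t htX) x hx, by
        simpa only [fst_pr, snd_pr] using ⟨hx, (hf.app hx).2⟩⟩
      simp only [fst_pr, snd_pr] at hz'
      have : x = z := hf.2 x hx z hz'.1 _ (hf.app hx).1
        ⟨pairMem_iff.2 (hf.app hx).2, pairMem_iff.2 hz'.2⟩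
      rw [this]
      exact hcl _ (hXp.pr htX (hXp.pr hfX (hκX' _ (hf.app hx).1))) z (mem_union.2 (Or.inr hz))
    have hfix := hπ.fix_trans htt htX'
    refine ⟨hπ.fix htX fun z hz => ⟨htX' z hz, hfix z hz⟩, hπ.fix hfX fun z hz => ?_, hfix⟩
    obtain ⟨a, ha, c, hc, hp⟩ := hf.1.1.1 z hz
    obtain rfl := isPair_iff.1 hp
    exact ⟨hXp.pr (htX' a ha) (hκX' c hc), hπ.fix_pr (htX' a ha) (hκX' c hc) (hfix a ha)
      (hπ.fix_trans hκ.1 hκX' c hc)⟩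
  · exact H X π hπ hXT fun x hx z hz =>
      hcl x hx z (mem_union.2 (Or.inl (mem_union.2 (Or.inl hz))))

end Hull

/-! ### Recognizing `Δ₀`-formulas -/

section Delta

variable {α : Type} {n : ℕ}

/-- `IsDelta0` as a class, so that instance search recognizes `Δ₀`-formulas. -/
class Dz (φ : Lset.BoundedFormula α n) : Prop where
  out : IsDelta0 φ

instance : Dz (⊥ : Lset.BoundedFormula α n) := ⟨.falsum⟩
instance (y z : α ⊕ Fin n) : Dz (mem y z) := ⟨.mem y z⟩
instance (y z : α ⊕ Fin n) : Dz (eq y z) := ⟨.eq y z⟩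

variable (φ ψ : Lset.BoundedFormula α n) [hφ : Dz φ] [hψ : Dz ψ]

instance : Dz (φ.imp ψ) := ⟨.imp hφ.out hψ.out⟩
instance : Dz φ.not := ⟨.imp hφ.out .falsum⟩
instance : Dz (φ ⊓ ψ) := ⟨(inferInstance : Dz (φ.imp ψ.not).not).out⟩
instance : Dz (φ ⊔ ψ) := ⟨(inferInstance : Dz (φ.not.imp ψ)).out⟩

variable (φ : Lset.BoundedFormula α (n + 1)) [hφ : Dz φ] (φ₂ : Lset.BoundedFormula α (n + 2))
  [hφ₂ : Dz φ₂] (p q y z w : α ⊕ Fin n)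

instance : Dz (bAll y φ) := ⟨.bAll y hφ.out⟩
instance : Dz (bEx y φ) := by unfold bEx; infer_instance
instance : Dz (bAll2 y φ₂) := by unfold bAll2; infer_instance
instance : Dz (bEx2 y φ₂) := by unfold bEx2; infer_instance
instance : Dz (isEmpty y) := by unfold isEmpty; infer_instance
instance : Dz (subset y z) := by unfold subset; infer_instance
instance : Dz (isUPair p y z) := by unfold isUPair; infer_instance
instance : Dz (isPair p y z) := by unfold isPair; infer_instance
instance : Dz (isTriple q y z w) := by unfold isTriple; infer_instance
instance : Dz (isSucc y z) := by unfold isSucc; infer_instance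
instance : Dz (isTrans y) := by unfold isTrans; infer_instance
instance : Dz (isOrd y) := by unfold isOrd; infer_instance
instance : Dz (isOmega y) := by unfold isOmega; infer_instance
instance : Dz (pairMem p y z) := by unfold pairMem; infer_instance
instance : Dz (isFun p y z) := by unfold isFun; infer_instance
instance : Dz (isInj p y z) := by unfold isInj; infer_instance
instance : Dz (isBij p y z) := by unfold isBij; infer_instance

instance {m : ℕ} (q : α ⊕ Fin m) (φ : Lset.BoundedFormula α (m + 8)) [Dz φ] : Dz (exComp q φ) := by
  unfold exComp; infer_instance
instance {m : ℕ} (q : α ⊕ Fin m) (φ : Lset.BoundedFormula α (m + 8)) [Dz φ] :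
    Dz (allComp q φ) := by
  unfold allComp; infer_instance

theorem isDelta0_godel (i : Fin 10) : IsDelta0 (godel i).2 := by
  suffices Dz (godel i).2 from this.out
  fin_cases i
  · show Dz godel1; unfold godel1; infer_instance
  · show Dz godel2; unfold godel2; infer_instance
  · show Dz godel3; unfold godel3; infer_instance
  · show Dz godel4; unfold godel4; infer_instance
  · show Dz godel5; unfold godel5; infer_instance
  · show Dz godel6; unfold godel6; infer_instance
  · show Dz godel7; unfold godel7; infer_instance
  · show Dz godel8; unfold godel8; infer_instance
  · show Dz godel9; unfold godel9; infer_instance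
  · show Dz godel10; unfold godel10; infer_instance

/-- The function symbols of `∈_{Δ₀}` have `Δ₀` graphs. -/
theorem isDelta0_of_mem_D {m : ℕ} {φ : Lset.Formula (Fin (m + 1))} {i : Fin 2}
    (h : ((⟨m, φ⟩ : Form Lset), i) ∈ D) : IsDelta0 φ := by
  rcases h with (h | h | h) | ⟨j, hj⟩
  · exact h.1
  · obtain ⟨rfl, h⟩ := Sigma.mk.inj (Prod.mk.inj h).1
    obtain rfl := eq_of_heq h
    exact Dz.out
  · obtain ⟨rfl, h⟩ := Sigma.mk.inj (Prod.mk.inj h).1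
    obtain rfl := eq_of_heq h
    exact Dz.out
  · have h := (Prod.mk.inj hj).1
    have := isDelta0_godel j
    rwa [h] at this

end Delta

/-! ### Models of `R + T_{∈,A}` -/

section Morley

open Structure

variable {A : Set (Form Lset × Fin 2)} {M : Type u} [Lset.Structure M] [(expand A).Structure M]
  [(incl A).IsExpansionOn M]

variable (A M) in
/-- The symbols of `∈_A` have the intended meaning. -/
structure IsMorley : Prop where
  rel : ∀ {n : ℕ} (φ : Lset.Formula (Fin (n + 1))) (h : ((⟨n, φ⟩ : Form Lset), (0 : Fin 2)) ∈ A)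
    (v : Fin (n + 1) → M), RelMap (rSymb φ h) v ↔ φ.Realize v
  func : ∀ {n : ℕ} (φ : Lset.Formula (Fin (n + 1))) (h : ((⟨n, φ⟩ : Form Lset), (1 : Fin 2)) ∈ A)
    (v : Fin n → M), (∃! z : M, φ.Realize (Fin.cons z v : Fin (n + 1) → M)) → ∀ y : M,
      funMap (fSymb φ h) v = y ↔ φ.Realize (Fin.cons y v : Fin (n + 1) → M)
  const : ∀ (h : ∃ ψ : Form Lset, (ψ, (1 : Fin 2)) ∈ A) (v : Fin 0 → M),
    IsEmp (funMap (cSymb h) v)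

theorem isMorley_of_model {R : Lset.Theory} (hM : M ⊨ setTheory R A) : IsMorley A M := by
  rw [setTheory, Theory.model_iff] at hM
  refine ⟨fun φ h v => ?_, fun φ h v hu y => ?_, fun h v => ?_⟩
  · have := hM _ (Or.inl (Or.inr (Or.inl ⟨_, φ, h, rfl⟩)))
    have := (realize_close _).1 this v
    rw [Formula.realize_iff, LHom.realize_onFormula, Formula.realize_rel] at this
    exact this.symm
  · have := hM _ (Or.inl (Or.inr (Or.inr ⟨_, φ, h, rfl⟩)))
    have := ((realize_close _).1 this v)
    rw [Formula.Realize, BoundedFormula.realize_inf] at this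
    have h1 := this.1
    rw [BoundedFormula.realize_imp] at h1
    have h2 := h1 ((realize_exUniqueFirst _ v).2 (by simpa only [LHom.realize_onFormula] using hu))
    rw [BoundedFormula.realize_subst] at h2
    have h3 : (fun a => Term.realize v ((Fin.cons (Term.func (fSymb φ h) Term.var) Term.var :
        Fin _ → (expand A).Term _) a)) = Fin.cons (funMap (fSymb φ h) v) v := by
      funext a; refine Fin.cases ?_ (fun a => ?_) a <;> simp [Term.realize]
    rw [h3] at h2
    have h4 : φ.Realize (Fin.cons (funMap (fSymb φ h) v) v : Fin _ → M) :=
      (LHom.realize_onFormula (incl A) φ).1 h2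
    constructor
    · rintro rfl; exact h4
    · exact fun hy => hu.unique h4 hy
  · have := hM _ (Or.inr ⟨h, rfl⟩)
    have := (realize_close _).1 this (fun _ => funMap (cSymb h) v)
    rw [Formula.realize_iff, LHom.realize_onFormula, Formula.realize_equal] at this
    have h2 := this.2 (by
      simp only [Term.realize_func, Term.realize_var]
      congr; funext i; exact i.elim0)
    simpa [Formula.Realize] using h2

theorem nonempty_of_D (hA : D ⊆ A) (M : Type u) [(expand A).Structure M] : Nonempty M :=
  ⟨funMap (cSymb (A := A) ⟨_, hA (Or.inl (Or.inr (Or.inl rfl)))⟩) (Fin.elim0 : Fin 0 → M)⟩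

theorem reduct_model {R : Lset.Theory} (hM : M ⊨ setTheory R A) : M ⊨ R := by
  rw [← LHom.onTheory_model (incl A)]
  exact hM.mono fun σ hσ => Or.inl (Or.inl hσ)

theorem zfc_model {R : Lset.Theory} (hR : ∀ σ ∈ ZFC, R ⊨ᵇ σ) [Nonempty M] (hM : M ⊨ R) :
    ZFC.Model M :=
  (Theory.model_iff _).2 fun σ hσ => (hR σ hσ).realize_sentence M

end Morley

/-! ### The signature `∈_{A_κ}` -/

section Guard

variable {M : Type u} [Lset.Structure M]

/-- `ψ(u₁, …, uₙ)`, guarded by a transitive set `t ∋ u₁, …, uₙ` and an injection `f` of `t` into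
`κ`. The variables are `t, f, u₁, …, uₙ`. -/
def guard (φκ : Lset.Formula (Fin 1)) {n : ℕ} (ψ : Lset.Formula (Fin n)) :
    Lset.Formula (Fin (n + 2)) :=
  let κ : Fin (n + 2) ⊕ Fin 1 := b 0
  let ψ' : Lset.BoundedFormula (Fin (n + 2)) 1 :=
    BoundedFormula.relabel (fun i => x i.succ.succ : Fin n → Fin (n + 2) ⊕ Fin 1) ψ
  let φ' : Lset.BoundedFormula (Fin (n + 2)) 1 :=
    BoundedFormula.relabel (fun _ => κ : Fin 1 → Fin (n + 2) ⊕ Fin 1) φκ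
  (φ' ⊓ (isTrans (x 0) ⊓ (isInj (x 1) (x 0) κ ⊓
    (BoundedFormula.iInf (fun i : Fin n => mem (x i.succ.succ) (x 0)) ⊓ ψ')))).ex

theorem realize_guard (φκ : Lset.Formula (Fin 1)) {n : ℕ} (ψ : Lset.Formula (Fin n))
    (v : Fin (n + 2) → M) : (guard φκ ψ).Realize v ↔
      ∃ κ : M, φκ.Realize (fun _ => κ) ∧ Trans (v 0) ∧ IsInj (v 1) (v 0) κ ∧
        (∀ i : Fin n, v i.succ.succ ε v 0) ∧ ψ.Realize fun i => v i.succ.succ := by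
  simp only [guard, Formula.Realize, BoundedFormula.realize_ex, BoundedFormula.realize_inf,
    BoundedFormula.realize_iInf, realize_isTrans, realize_isInj, realize_mem, val_inl, val_inr]
  refine exists_congr fun κ => ?_
  have h0 : (Fin.snoc (default : Fin 0 → M) κ : Fin 1 → M) 0 = κ := rfl
  refine and_congr ?_ (and_congr Iff.rfl (and_congr (by rw [h0]) (and_congr Iff.rfl ?_)))
  · refine (BoundedFormula.realize_relabel (m := 1) (n := 0)).trans ?_
    rw [iff_iff_eq]
    congr 1
    funext i; exact i.elim0
  · refine (BoundedFormula.realize_relabel (m := 1) (n := 0)).trans ?_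
    rw [iff_iff_eq]
    congr 1
    funext i; exact i.elim0

theorem realize_inHFormula (φκ : Lset.Formula (Fin 1)) (y : M) :
    (inHFormula φκ).Realize (fun _ => y) ↔ ∃ κ : M, φκ.Realize (fun _ => κ) ∧ InH κ y := by
  simp only [inHFormula, Formula.Realize, BoundedFormula.realize_ex, BoundedFormula.realize_inf,
    realize_isInH, val_inl, val_inr]
  refine exists_congr fun κ => and_congr ?_ Iff.rfl
  refine (BoundedFormula.realize_relabel (m := 1) (n := 0)).trans ?_
  rw [iff_iff_eq]
  congr 1
  funext i; exact i.elim0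

/-- `φκ` defines `κ`. -/
def Defines (φκ : Lset.Formula (Fin 1)) (κ : M) : Prop :=
  ∀ z : M, φκ.Realize (fun _ => z) ↔ z = κ

theorem Defines.realize_guard {φκ : Lset.Formula (Fin 1)} {κ : M} (h : Defines φκ κ) {n : ℕ}
    (ψ : Lset.Formula (Fin n)) (v : Fin (n + 2) → M) : (guard φκ ψ).Realize v ↔
      Trans (v 0) ∧ IsInj (v 1) (v 0) κ ∧
        (∀ i : Fin n, v i.succ.succ ε v 0) ∧ ψ.Realize fun i => v i.succ.succ := by
  rw [AMC.realize_guard]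
  constructor
  · rintro ⟨c, hc, h'⟩
    rwa [(h c).1 hc] at h'
  · exact fun h' => ⟨κ, (h κ).2 rfl, h'⟩

theorem Defines.realize_inHFormula {φκ : Lset.Formula (Fin 1)} {κ : M} (h : Defines φκ κ)
    (y : M) : (inHFormula φκ).Realize (fun _ => y) ↔ InH κ y := by
  rw [AMC.realize_inHFormula]
  constructor
  · rintro ⟨c, hc, h'⟩
    rwa [(h c).1 hc] at h'
  · exact fun h' => ⟨κ, (h κ).2 rfl, h'⟩

theorem exists_defines {R : Lset.Theory} {φκ : Lset.Formula (Fin 1)} (h : IsDefinableInfCard R φκ)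
    [Nonempty M] [ZFC.Model M] (hM : M ⊨ R) :
    ∃ κ : M, Defines φκ κ ∧ Ord κ ∧ Sub omega κ := by
  have h1 := h.1.realize_sentence M
  rw [Sentence.Realize, Formula.realize_iExsUnique] at h1
  obtain ⟨i, hi, hu⟩ := h1
  have key : ∀ j : Fin 1 → M, (Formula.relabel Sum.inr φκ : Lset.Formula (Empty ⊕ Fin 1)).Realize
      (Sum.elim default j) ↔ φκ.Realize j := fun j => by
    rw [Formula.realize_relabel]; rfl
  simp only [key] at hi hu
  have hi0 : i = fun _ => i 0 := funext fun j => by rw [Subsingleton.elim j 0]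
  have h2 := (realize_close _).1 (h.2.realize_sentence M) i
  rw [Formula.realize_imp] at h2
  have h3 := h2 hi
  simp only [Formula.Realize, realize_isInfCard, val_inl] at h3
  obtain ⟨⟨ho, -⟩, w, hw, hs⟩ := h3
  rw [hw.eq isOmega_omega] at hs
  refine ⟨i 0, fun z => ⟨fun hz => congrFun (hu _ hz) 0, ?_⟩, ho, hs⟩
  rintro rfl
  rwa [← hi0]

/-- The set `A_κ`. -/
def Aκ (φκ : Lset.Formula (Fin 1)) : Set (Form Lset × Fin 2) :=
  D ∪ {p | ∃ (n : ℕ) (ψ : Lset.Formula (Fin n)), p = ((⟨n + 1, guard φκ ψ⟩ : Form Lset), 0)}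

theorem subset_Aκ (φκ : Lset.Formula (Fin 1)) : D ⊆ Aκ φκ := fun _ h => Or.inl h

theorem mem_D_of_mem_Aκ {φκ : Lset.Formula (Fin 1)} {φ : Form Lset} (h : (φ, (1 : Fin 2)) ∈ Aκ φκ) :
    (φ, (1 : Fin 2)) ∈ D := by
  rcases h with h | ⟨n, ψ, h⟩
  · exact h
  · exact absurd (Prod.mk.inj h).2 one_ne_zero

theorem guard_mem_Aκ (φκ : Lset.Formula (Fin 1)) {n : ℕ} (ψ : Lset.Formula (Fin n)) :
    ((⟨n + 1, guard φκ ψ⟩ : Form Lset), (0 : Fin 2)) ∈ Aκ φκ := Or.inr ⟨n, ψ, rfl⟩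

end Guard

/-! ### Properties of large hulls -/

section Eventually

variable {M : Type u} [Lset.Structure M] [hM : ZFC.Model M]

/-- `P` holds of all sufficiently closed hulls. -/
def Ev (κ : M) (P : M → M → Prop) : Prop :=
  ∃ (Y : M) (Φ : List AnyForm), Le Y κ ∧ (∀ φ ∈ Φ, IsDelta0 φ.2) ∧
    ∀ X π, IsHull κ X π → Sub Y X → (∀ φ ∈ Φ, Pres X π φ.2) → P X π

variable {κ : M}

theorem Ev.exists (hκ : Ord κ) (hω : Sub omega κ) {P : M → M → Prop} (h : Ev κ P) :
    ∃ X π, IsHull κ X π ∧ P X π := by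
  obtain ⟨Y, Φ, hY, hΦ, h⟩ := h
  obtain ⟨X, π, hX, hYX, hP⟩ := exists_isHull hκ hω hY Φ hΦ
  exact ⟨X, π, hX, h X π hX hYX hP⟩

theorem Ev.mono {P Q : M → M → Prop} (h : Ev κ P) (hPQ : ∀ X π, IsHull κ X π → P X π → Q X π) :
    Ev κ Q := by
  obtain ⟨Y, Φ, hY, hΦ, h⟩ := h
  exact ⟨Y, Φ, hY, hΦ, fun X π hX hYX hP => hPQ X π hX (h X π hX hYX hP)⟩

/-- The requirements of two properties combine into one of the same kind, so a formula can be
handled symbol by symbol before any hull is chosen. -/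
theorem Ev.and (hκ : Ord κ) (hω : Sub omega κ) {P Q : M → M → Prop} (h : Ev κ P) (h' : Ev κ Q) :
    Ev κ fun X π => P X π ∧ Q X π := by
  obtain ⟨Y, Φ, hY, hΦ, h⟩ := h
  obtain ⟨Y', Φ', hY', hΦ', h'⟩ := h'
  refine ⟨union Y Y', Φ ++ Φ', le_union hκ hω hY hY', fun φ hφ => ?_, fun X π hX hYX hP => ?_⟩
  · exact (List.mem_append.1 hφ).elim (hΦ φ) (hΦ' φ)
  · exact ⟨h X π hX (fun z hz => hYX z (mem_union.2 (Or.inl hz)))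
      fun φ hφ => hP φ (List.mem_append.2 (Or.inl hφ)),
      h' X π hX (fun z hz => hYX z (mem_union.2 (Or.inr hz)))
      fun φ hφ => hP φ (List.mem_append.2 (Or.inr hφ))⟩

theorem Ev.mem (hω : Sub omega κ) (a : M) : Ev κ fun X _ => a ε X :=
  ⟨upair a a, [], le_upair hω a a, by simp, fun X π _ h _ => h a (mem_upair.2 (Or.inl rfl))⟩

theorem Ev.pres (hω : Sub omega κ) {k : ℕ} {φ : Lset.Formula (Fin k)} (hφ : IsDelta0 φ) :
    Ev κ fun X π => ∀ v, (∀ i, v i ε X) → (φ.Realize v ↔ φ.Realize fun i => app π (v i)) := by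
  refine ⟨upair emp emp, [⟨k, φ⟩], le_upair hω _ _, by simpa using hφ, fun X π _ _ h v hv => ?_⟩
  have := h ⟨k, φ⟩ (by simp) v default hv fun i => i.elim0
  rw [Subsingleton.elim (fun i => app π ((default : Fin 0 → M) i)) default] at this
  exact this

theorem Ev.true (hω : Sub omega κ) {P : M → M → Prop} (h : ∀ X π, IsHull κ X π → P X π) : Ev κ P :=
  (Ev.mem hω emp).mono fun X π hX _ => h X π hX

theorem Ev.forall (hκ : Ord κ) (hω : Sub omega κ) : ∀ {n : ℕ} {P : Fin n → M → M → Prop},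
    (∀ i, Ev κ (P i)) → Ev κ fun X π => ∀ i, P i X π
  | 0, _, _ => Ev.true hω fun _ _ _ i => i.elim0
  | _ + 1, _, h => ((h 0).and hκ hω (Ev.forall hκ hω fun i => h i.succ)).mono
      fun _ _ _ h => Fin.forall_fin_succ.2 h

end Eventually

/-! ### Universal sentences in `M` and in `H_{κ⁺}` -/

section Transfer

open Structure

variable {φκ : Lset.Formula (Fin 1)} {M : Type u} [Lset.Structure M]
  [(expand (Aκ φκ)).Structure M] [hM : ZFC.Model M]

theorem existsUnique_of_mem_Aκ {n : ℕ} {φ : Lset.Formula (Fin (n + 1))}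
    (h : ((⟨n, φ⟩ : Form Lset), (1 : Fin 2)) ∈ Aκ φκ) (v : Fin n → M) :
    ∃! z : M, φ.Realize (Fin.cons z v : Fin (n + 1) → M) := by
  obtain ⟨y, hy, -⟩ := isOp_of_mem_D (mem_D_of_mem_Aκ h) v
  exact ⟨y, (hy y).2 rfl, fun z hz => (hy z).1 hz⟩

variable [(incl (Aκ φκ)).IsExpansionOn M] {κ : M}

theorem relMap_mem_iff (R : SetRel 2) (v : Fin 2 → M) :
    RelMap (L := expand (Aκ φκ)) (M := M) (Sum.inl R) v ↔ v 0 ε v 1 := by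
  have h := LHom.map_onRelation (incl (Aκ φκ)) (M := M) (R : Lset.Relations 2) v
  cases R
  have hv : v = ![v 0, v 1] := by funext i; fin_cases i <;> rfl
  rw [E, ← hv]
  exact iff_of_eq h

theorem exists_substructure (hS : IsMorley (Aκ φκ) M) (hκ : Ord κ) (hω : Sub omega κ)
    (hφ : Defines φκ κ) :
    ∃ H : (expand (Aκ φκ)).Substructure M, (H : Set M) = Hset (Aκ φκ) φκ M := by
  have hmem : ∀ y, y ∈ Hset (Aκ φκ) φκ M ↔ InH κ y := fun y => by
    rw [← hφ.realize_inHFormula, ← LHom.realize_onFormula (incl (Aκ φκ))]; rfl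
  refine ⟨⟨Hset (Aκ φκ) φκ M, fun {n} f v hv => ?_⟩, rfl⟩
  rw [hmem]
  simp only [hmem] at hv
  rcases f with f | f
  · exact f.elim
  · cases f with
    | f φ h =>
      obtain ⟨y, hy, hH⟩ := isOp_of_mem_D (mem_D_of_mem_Aκ h) v
      have := (hS.func φ h v (existsUnique_of_mem_Aκ h v) y).2 ((hy y).2 rfl)
      change InH κ (funMap (fSymb φ h) v)
      rw [this]
      exact hH κ hκ hω hv
    | c h =>
      have := isEmp_iff.1 (hS.const h v)
      change InH κ (funMap (cSymb h) v)
      rw [this]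
      exact inH_emp hω

/-- The value of each subterm is put into the hull. Function symbols have `Δ₀` graphs, which the
collapse preserves, and values are unique, so the collapse commutes with them. -/
theorem ev_term (hS : IsMorley (Aκ φκ) M) (hκ : Ord κ) (hω : Sub omega κ) {β : Type}
    (t : (expand (Aκ φκ)).Term β) (v : β → M) :
    Ev κ fun X π => (∀ i, v i ε X) → t.realize v ε X ∧
      t.realize (fun i => app π (v i)) = app π (t.realize v) := by
  induction t with
  | var i => exact Ev.true hω fun X π _ h => ⟨h i, rfl⟩
  | @func l f ts ih =>
    rcases f with f | f
    · exact f.elim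
    · cases f with
      | f φ h =>
        have hu := fun v : Fin l → M => hS.func φ h v (existsUnique_of_mem_Aκ h v)
        set y := (Term.func (Sum.inr (NewFun.f φ h)) ts : (expand (Aκ φκ)).Term β).realize v
          with hy
        have h1 : φ.Realize (Fin.cons y (fun i => (ts i).realize v) : Fin (l + 1) → M) :=
          (hu _ y).1 rfl
        refine ((Ev.mem hω y).and hκ hω ((Ev.forall hκ hω ih).and hκ hω
          (Ev.pres hω (isDelta0_of_mem_D (mem_D_of_mem_Aκ h))))).mono ?_
        rintro X π hX ⟨hyX, hts, hp⟩ hv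
        refine ⟨hyX, ?_⟩
        have h2 := (hp _ (fun i => by
          refine Fin.cases ?_ (fun i => ?_) i
          · exact hyX
          · exact (hts i hv).1)).1 h1
        have h3 : (fun i => app π ((Fin.cons y (fun i => (ts i).realize v) : Fin (l + 1) → M) i))
            = Fin.cons (app π y) (fun i => (ts i).realize fun i => app π (v i)) := by
          funext i
          refine Fin.cases rfl (fun i => ?_) i
          simp [(hts i hv).2]
        rw [h3] at h2
        exact (hu _ _).2 h2
      | c h =>
        have h2 : ∀ w : Fin 0 → M,
            funMap (cSymb h) w = emp :=
          fun w => isEmp_iff.1 (hS.const h w)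
        refine Ev.true hω fun X π hX _ => ?_
        change funMap (cSymb h) _ ε X ∧ funMap (cSymb h) _ = app π (funMap (cSymb h) _)
        rw [h2, h2]
        exact ⟨hX.collapse.pair.1, (hX.collapse.fix hX.collapse.pair.1
          fun z hz => absurd hz (not_mem_emp z)).symm⟩

/-- Since `ψ` is arbitrary, the collapse has no reason to preserve it; the guard ensures that
nothing moves. That `(t, f)` is a guard is a `Δ₀` statement about `t, f, κ`, so it holds for `(t,
f)` exactly when it holds for the images, `κ` being fixed. If it fails, both sides are false. If it
holds, then `t`, `f` and all elements of `t` are fixed, and `ψ` is evaluated at the same tuple on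
both sides. -/
theorem ev_guard (hω : Sub omega κ) (hφ : Defines φκ κ) {n : ℕ}
    (ψ : Lset.Formula (Fin n)) (v : Fin (n + 2) → M) :
    Ev κ fun X π => (∀ i, v i ε X) →
      ((guard φκ ψ).Realize (fun i => app π (v i)) ↔ (guard φκ ψ).Realize v) := by
  have hΔ : IsDelta0 (isTrans (x 0) ⊓ isInj (x 1) (x 0) (x 2) : Lset.Formula (Fin 3)) := Dz.out
  refine (Ev.pres hω hΔ).mono fun X π hX h hv => ?_
  have h1 := h ![v 0, v 1, κ] (fun i => by
    fin_cases i
    · exact hv 0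
    · exact hv 1
    · exact hX.mem)
  simp only [Formula.Realize, BoundedFormula.realize_inf, realize_isTrans, realize_isInj, val_inl,
    Matrix.cons_val, hX.fix] at h1
  rw [hφ.realize_guard, hφ.realize_guard]
  by_cases hc : Trans (v 0) ∧ IsInj (v 1) (v 0) κ
  · obtain ⟨h2, h3, h4⟩ := hX.fix_coded _ _ (hv 0) (hv 1) hc.1 hc.2
    rw [h2, h3]
    refine and_congr_right fun _ => and_congr_right fun _ => ?_
    constructor
    · rintro ⟨h5, h6⟩
      have h7 : ∀ i : Fin n, v i.succ.succ ε v 0 := fun i => by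
        have := h5 i
        rwa [← h2, hX.collapse.mem_iff (hv _) (hv 0)] at this
      exact ⟨h7, by simpa only [h4 _ (h7 _)] using h6⟩
    · rintro ⟨h5, h6⟩
      simp only [h4 _ (h5 _)]
      exact ⟨h5, h6⟩
  · constructor
    · exact fun h' => absurd (h1.2 ⟨h'.1, h'.2.1⟩) hc
    · exact fun h' => absurd ⟨h'.1, h'.2.1⟩ hc

theorem ev_rel (hS : IsMorley (Aκ φκ) M) (hω : Sub omega κ) (hφ : Defines φκ κ)
    {l : ℕ} (R : (expand (Aκ φκ)).Relations l) (v : Fin l → M) :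
    Ev κ fun X π => (∀ i, v i ε X) → (RelMap R (fun i => app π (v i)) ↔ RelMap R v) := by
  rcases R with R | R
  · cases R with
    | mem =>
      refine Ev.true hω fun X π hX hv => ?_
      rw [relMap_mem_iff, relMap_mem_iff]
      exact hX.collapse.mem_iff (hv 0) (hv 1)
  · cases R with
    | @R l φ h =>
      have h1 := hS.rel φ h
      suffices H : Ev κ fun X π => (∀ i, v i ε X) →
          (φ.Realize (fun i => app π (v i)) ↔ φ.Realize v) from
        H.mono fun X π _ hH hv => (h1 _).trans ((hH hv).trans (h1 _).symm)
      rcases h with h | ⟨n, ψ, h⟩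
      · exact (Ev.pres hω (isDelta0_of_mem_D h)).mono fun X π _ hp hv => (hp v hv).symm
      · obtain ⟨rfl, h⟩ := Sigma.mk.inj (Prod.mk.inj h).1
        obtain rfl := eq_of_heq h
        exact ev_guard hω hφ ψ v

theorem ev_isQF (hS : IsMorley (Aκ φκ) M) (hκ : Ord κ) (hω : Sub omega κ) (hφ : Defines φκ κ)
    {α : Type} {n : ℕ} {θ : (expand (Aκ φκ)).BoundedFormula α n} (hθ : θ.IsQF) (v : α → M)
    (xs : Fin n → M) :
    Ev κ fun X π => (∀ i, v i ε X) → (∀ i, xs i ε X) →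
      (θ.Realize (fun i => app π (v i)) (fun i => app π (xs i)) ↔ θ.Realize v xs) := by
  have hel : ∀ π, Sum.elim (fun i => app π (v i)) (fun i => app π (xs i)) =
      fun i => app π (Sum.elim v xs i) := fun π => by funext i; rcases i with i | i <;> rfl
  have hel' : ∀ {X : M}, (∀ i, v i ε X) → (∀ i, xs i ε X) → ∀ i, Sum.elim v xs i ε X :=
    fun h h' i => by rcases i with i | i; exacts [h i, h' i]
  induction hθ with
  | falsum => exact Ev.true hω fun X π _ _ _ => Iff.rfl
  | of_isAtomic ha =>
    cases ha with
    | equal t s =>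
      refine ((ev_term hS hκ hω t (Sum.elim v xs)).and hκ hω
        (ev_term hS hκ hω s (Sum.elim v xs))).mono fun X π hX h hv hxs => ?_
      obtain ⟨h1, h2⟩ := h.1 (hel' hv hxs)
      obtain ⟨h3, h4⟩ := h.2 (hel' hv hxs)
      rw [BoundedFormula.realize_bdEqual, BoundedFormula.realize_bdEqual, hel, h2, h4]
      exact ⟨fun h => hX.collapse.inj _ _ h1 h3 h, fun h => by rw [h]⟩
    | @rel l R ts =>
      refine ((Ev.forall hκ hω fun i => ev_term hS hκ hω (ts i) (Sum.elim v xs)).and hκ hω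
        (ev_rel hS hω hφ R fun i => (ts i).realize (Sum.elim v xs))).mono
        fun X π hX h hv hxs => ?_
      have h1 := fun i => h.1 i (hel' hv hxs)
      rw [BoundedFormula.realize_rel, BoundedFormula.realize_rel, hel]
      simp only [(h1 _).2]
      exact h.2 fun i => (h1 i).1
  | imp _ _ ih1 ih2 =>
    refine (ih1.and hκ hω ih2).mono fun X π _ h hv hxs => ?_
    rw [BoundedFormula.realize_imp, BoundedFormula.realize_imp, h.1 hv hxs, h.2 hv hxs]

/-- The witnesses to failure in `M` are put into the hull one quantifier at a time; their images
under the collapse lie in `H` and witness failure there. -/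
theorem ev_isUniversal (hS : IsMorley (Aκ φκ) M) (hκ : Ord κ) (hω : Sub omega κ)
    (hφ : Defines φκ κ) {H : (expand (Aκ φκ)).Substructure M} (hH : ∀ y, y ∈ H ↔ InH κ y) {n : ℕ}
    {θ : (expand (Aκ φκ)).BoundedFormula Empty n} (hθ : θ.IsUniversal) (xs : Fin n → M)
    (h : ¬ θ.Realize default xs) :
    Ev κ fun X π => ∀ ys : Fin n → H, (∀ i, xs i ε X ∧ (ys i : M) = app π (xs i)) →
      ¬ θ.Realize default ys := by
  induction hθ with
  | of_isQF hq =>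
    refine (ev_isQF hS hκ hω hφ hq default xs).mono fun X π hX hq' ys hys => ?_
    have h1 := hq' (fun i => i.elim) fun i => (hys i).1
    have h2 := hq.realize_embedding H.subtype (v := default) (xs := ys)
    have h3 : (H.subtype ∘ ys) = fun i => app π (xs i) := funext fun i => (hys i).2
    rw [← h2, h3, Subsingleton.elim (H.subtype ∘ (default : Empty → H))
      (fun i => app π ((default : Empty → M) i)), h1]
    exact h
  | all _ ih =>
    rw [BoundedFormula.realize_all] at h
    push Not at h
    obtain ⟨z, hz⟩ := h
    refine ((ih _ hz).and hκ hω (Ev.mem hω z)).mono fun X π hX h' ys hys => ?_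
    rw [BoundedFormula.realize_all]
    push Not
    refine ⟨⟨app π z, (hH _).2 (hX.inH z h'.2)⟩, h'.1 _ fun i => ?_⟩
    refine Fin.lastCases ?_ (fun i => ?_) i
    · simpa using h'.2
    · simpa using hys i

/-- Universal sentences pass from `M` to the substructure `H`. A failure in `M` passes to `H`
through a hull. As this is an equivalence for each universal sentence, it extends to Boolean
combinations. -/
theorem realize_iff_of_isBoolUniversal (hS : IsMorley (Aκ φκ) M) (hκ : Ord κ) (hω : Sub omega κ)
    (hφ : Defines φκ κ) {H : (expand (Aκ φκ)).Substructure M} (hH : ∀ y, y ∈ H ↔ InH κ y)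
    {σ : (expand (Aκ φκ)).Sentence} (hσ : IsBoolUniversal σ) : H ⊨ σ ↔ M ⊨ σ := by
  induction hσ with
  | of_isUniversal σ hσ =>
    constructor
    · intro h
      by_contra hn
      obtain ⟨X, π, -, hX⟩ := (ev_isUniversal hS hκ hω hφ hH hσ default hn).exists hκ hω
      exact hX default (fun i => i.elim0) h
    · intro h
      refine hσ.realize_embedding H.subtype ?_
      rw [Subsingleton.elim (H.subtype ∘ (default : Empty → H)) default,
        Subsingleton.elim (H.subtype ∘ (default : Fin 0 → H)) default]
      exact h
  | falsum => exact Iff.rfl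
  | imp σ τ _ _ ih1 ih2 => exact imp_congr ih1 ih2

end Transfer

/-! ### Truth in `H_{κ⁺}` as an `∈`-formula over `M` -/

section Translation

open Structure

/-- The language `{∈}` has no function symbols, so composition is done with graphs: existentially
quantify the intermediate values `u`, each pinned down by its graph `γ i`. -/
theorem exists_comp {l : ℕ} {β δ : Type} (γ : Fin l → Lset.Formula (β ⊕ Unit))
    (ρ : Lset.Formula (δ ⊕ Fin l)) : ∃ ψ : Lset.Formula (β ⊕ δ),
      ∀ (M : Type) [Lset.Structure M] (v : β → M) (w : δ → M) (u : Fin l → M),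
        (∀ i y, (γ i).Realize (Sum.elim v fun _ => y) ↔ u i = y) →
        (ψ.Realize (Sum.elim v w) ↔ ρ.Realize (Sum.elim w u)) := by
  refine ⟨Formula.iExs (Fin l) ((Formula.iInf fun i : Fin l => (γ i).relabel
    (Sum.elim (fun j => Sum.inl (Sum.inl j)) (fun _ => Sum.inr i) :
      β ⊕ Unit → (β ⊕ δ) ⊕ Fin l)) ⊓
      ρ.relabel (Sum.map Sum.inr id : δ ⊕ Fin l → (β ⊕ δ) ⊕ Fin l)), fun M _ v w u hu => ?_⟩
  have h1 : ∀ (u' : Fin l → M) (i : Fin l), (Sum.elim (Sum.elim v w) u' ∘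
      (Sum.elim (fun j => Sum.inl (Sum.inl j)) (fun _ => Sum.inr i) :
        β ⊕ Unit → (β ⊕ δ) ⊕ Fin l)) = Sum.elim v fun _ => u' i := fun u' i => by
    funext j; rcases j with j | j <;> rfl
  have h2 : ∀ u' : Fin l → M, Sum.elim (Sum.elim v w) u' ∘
      (Sum.map Sum.inr id : δ ⊕ Fin l → (β ⊕ δ) ⊕ Fin l) = Sum.elim w u' := fun u' => by
    funext j; rcases j with j | j <;> rfl
  rw [Formula.realize_iExs]
  refine (exists_congr fun u' => BoundedFormula.realize_inf.trans (and_congr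
    (BoundedFormula.realize_iInf.trans (forall_congr' fun i => Formula.realize_relabel))
    Formula.realize_relabel)).trans ?_
  simp only [h1, h2]
  simp only [hu]
  constructor
  · rintro ⟨u', h, h'⟩
    rwa [funext h]
  · exact fun h => ⟨u, fun _ => rfl, h⟩

variable {φκ : Lset.Formula (Fin 1)}

theorem exists_graph {β : Type} (t : (expand (Aκ φκ)).Term β) :
    ∃ γ : Lset.Formula (β ⊕ Unit), ∀ (M : Type) [Lset.Structure M] [(expand (Aκ φκ)).Structure M]
      [ZFC.Model M] [(incl (Aκ φκ)).IsExpansionOn M], IsMorley (Aκ φκ) M → ∀ (v : β → M) (y : M),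
        γ.Realize (Sum.elim v fun _ => y) ↔ t.realize v = y := by
  induction t with
  | var i =>
    exact ⟨Term.equal (Term.var (Sum.inl i)) (Term.var (Sum.inr ())), fun M _ _ _ _ _ v y => by
      rw [Formula.realize_equal]; rfl⟩
  | @func l f ts ih =>
    choose γ hγ using ih
    rcases f with f | f
    · exact f.elim
    · cases f with
      | f φ h =>
        obtain ⟨ψ, hψ⟩ := exists_comp γ
          (φ.relabel (Fin.cons (Sum.inl ()) Sum.inr : Fin (l + 1) → Unit ⊕ Fin l))
        refine ⟨ψ, fun M _ _ _ _ hS v y => ?_⟩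
        rw [hψ M v (fun _ => y) (fun i => (ts i).realize v) fun i y => hγ i M hS v y,
          Formula.realize_relabel]
        refine Iff.trans ?_ (hS.func φ h (fun i => (ts i).realize v)
          (existsUnique_of_mem_Aκ h _) y).symm
        rw [iff_iff_eq]
        congr 1
        funext j; refine Fin.cases rfl (fun j => rfl) j
      | c h =>
        refine ⟨isEmpty (x (Sum.inr ())), fun M _ _ _ _ hS v y => ?_⟩
        simp only [Formula.Realize, realize_isEmpty, val_inl, Sum.elim_inr]
        change IsEmp y ↔ funMap (cSymb h) _ = y
        rw [isEmp_iff, isEmp_iff.1 (hS.const h _), eq_comm]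

theorem exists_rel_formula {l : ℕ} (R : (expand (Aκ φκ)).Relations l) :
    ∃ ρ : Lset.Formula (Fin l), ∀ (M : Type) [Lset.Structure M] [(expand (Aκ φκ)).Structure M]
      [(incl (Aκ φκ)).IsExpansionOn M], IsMorley (Aκ φκ) M → ∀ v : Fin l → M,
        ρ.Realize v ↔ RelMap R v := by
  rcases R with R | R
  · refine ⟨Relations.formula R Term.var, fun M _ _ _ _ v => ?_⟩
    rw [Formula.realize_rel]
    exact iff_of_eq (LHom.map_onRelation (incl (Aκ φκ)) R v).symm
  · cases R with
    | @R l φ h => exact ⟨φ, fun M _ _ _ hS v => (hS.rel φ h v).symm⟩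

/-- `H` is the substructure `H_{κ⁺}` of `M`. -/
def IsHSub (φκ : Lset.Formula (Fin 1)) {M : Type} [Lset.Structure M]
    [(expand (Aκ φκ)).Structure M] (H : (expand (Aκ φκ)).Substructure M) : Prop :=
  ∀ y, y ∈ H ↔ (inHFormula φκ).Realize fun _ => y

/-- Quantifiers are relativized to `H`, which `inHFormula` defines, and atomic formulas are replaced
by the definitions of their symbols in `M`. One formula `ψ` serves all models `M`, so it can index a
symbol of the signature. -/
theorem exists_translation {α : Type} {n : ℕ} (φ : (expand (Aκ φκ)).BoundedFormula α n) :
    ∃ ψ : Lset.BoundedFormula α n, ∀ (M : Type) [Lset.Structure M]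
      [(expand (Aκ φκ)).Structure M] [ZFC.Model M] [(incl (Aκ φκ)).IsExpansionOn M],
      IsMorley (Aκ φκ) M → ∀ H : (expand (Aκ φκ)).Substructure M, IsHSub φκ H →
        ∀ (v : α → H) (xs : Fin n → H), φ.Realize v xs ↔
          ψ.Realize (fun i => (v i : M)) (fun i => (xs i : M)) := by
  have atom : ∀ {n l : ℕ} (ts : Fin l → (expand (Aκ φκ)).Term (α ⊕ Fin n))
      (ρ : Lset.Formula (Fin l)), ∃ ψ : Lset.BoundedFormula α n, ∀ (M : Type) [Lset.Structure M]
      [(expand (Aκ φκ)).Structure M] [ZFC.Model M] [(incl (Aκ φκ)).IsExpansionOn M],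
      IsMorley (Aκ φκ) M → ∀ H : (expand (Aκ φκ)).Substructure M,
        ∀ (v : α → H) (xs : Fin n → H),
          ψ.Realize (fun i => (v i : M)) (fun i => (xs i : M)) ↔
            ρ.Realize fun i => (((ts i).realize (Sum.elim v xs) : H) : M) := by
    intro n l ts ρ
    choose γ hγ using fun i => exists_graph (ts i)
    obtain ⟨ψ, hψ⟩ := exists_comp γ (ρ.relabel (Sum.inr : Fin l → Empty ⊕ Fin l))
    refine ⟨BoundedFormula.relabel (n := n) (k := 0) (Sum.elim id Empty.elim :
      (α ⊕ Fin n) ⊕ Empty → α ⊕ Fin n) ψ, fun M _ _ _ _ hS H v xs => ?_⟩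
    refine (BoundedFormula.realize_relabel (m := n) (n := 0)).trans ?_
    rw [Formula.boundedFormula_realize_eq_realize]
    have h1 := hψ M (Sum.elim (fun i => (v i : M)) fun i => (xs i : M)) (fun e => e.elim)
      (fun i => (ts i).realize (Sum.elim (fun i => (v i : M)) fun i => (xs i : M)))
      fun i y => hγ i M hS _ y
    have h2 : ∀ i, (((ts i).realize (Sum.elim v xs) : H) : M) =
        (ts i).realize (Sum.elim (fun i => (v i : M)) fun i => (xs i : M)) := fun i => by
      have := HomClass.realize_term H.subtype (t := ts i) (v := Sum.elim v xs)
      refine Eq.trans this.symm ?_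
      congr 1
      funext j; rcases j with j | j <;> rfl
    simp only [h2]
    rw [Formula.realize_relabel] at h1
    refine Iff.trans ?_ h1
    rw [iff_iff_eq]
    congr 1
    funext j; rcases j with (j | j) | j
    · rfl
    · rfl
    · exact j.elim
  induction φ with
  | falsum => exact ⟨⊥, fun M _ _ _ _ _ H _ v xs => Iff.rfl⟩
  | equal t s =>
    obtain ⟨ψ, hψ⟩ := atom ![t, s] (Term.equal (Term.var 0) (Term.var 1))
    refine ⟨ψ, fun M _ _ _ _ hS H _ v xs => ?_⟩
    rw [hψ M hS H v xs, Formula.realize_equal, Term.realize_var, Term.realize_var]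
    exact Subtype.ext_iff
  | rel R ts =>
    obtain ⟨ρ, hρ⟩ := exists_rel_formula R
    obtain ⟨ψ, hψ⟩ := atom ts ρ
    refine ⟨ψ, fun M _ _ _ _ hS H _ v xs => ?_⟩
    rw [hψ M hS H v xs, hρ M hS]
    exact Iff.rfl
  | imp φ₁ φ₂ ih₁ ih₂ =>
    obtain ⟨ψ₁, h₁⟩ := ih₁
    obtain ⟨ψ₂, h₂⟩ := ih₂
    exact ⟨ψ₁.imp ψ₂, fun M _ _ _ _ hS H hH v xs =>
      imp_congr (h₁ M hS H hH v xs) (h₂ M hS H hH v xs)⟩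
  | @all n φ ih =>
    obtain ⟨ψ, hψ⟩ := ih
    let χ : Lset.BoundedFormula α (n + 1) :=
      BoundedFormula.relabel (fun _ => nw : Fin 1 → α ⊕ Fin (n + 1)) (inHFormula φκ)
    refine ⟨(χ.imp ψ).all, fun M _ _ _ _ hS H hH v xs => ?_⟩
    rw [BoundedFormula.realize_all, BoundedFormula.realize_all]
    have hχ : ∀ y : M, χ.Realize (fun i => (v i : M)) (Fin.snoc (fun i => (xs i : M)) y) ↔
        y ∈ H := fun y => by
      rw [hH y]
      refine (BoundedFormula.realize_relabel (m := n + 1) (n := 0)).trans ?_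
      rw [Formula.boundedFormula_realize_eq_realize, iff_iff_eq]
      congr 1
      funext j
      simp [nw]
    have hsn : ∀ y : H, (fun i => (((Fin.snoc xs y : Fin (n + 1) → H) i : H) : M)) =
        Fin.snoc (fun i => (xs i : M)) (y : M) := fun y => by
      funext i; refine Fin.lastCases ?_ (fun i => ?_) i <;> simp
    constructor
    · intro h y
      rw [BoundedFormula.realize_imp, hχ]
      intro hy
      have := (hψ M hS H hH v _).1 (h ⟨y, hy⟩)
      rwa [hsn] at this
    · intro h y
      rw [hψ M hS H hH v, hsn]
      have := h y
      rw [BoundedFormula.realize_imp, hχ] at this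
      exact this y.2

end Translation

/-! ### The theory of `H_{κ⁺}` is the absolute model companion -/

section Companion

open Structure

variable {M : Type u} [Lset.Structure M] [hM : ZFC.Model M] {κ : M}

theorem exists_mem_inH (hκ : Ord κ) (hω : Sub omega κ) : ∀ {n : ℕ} (v : Fin n → M),
    (∀ i, InH κ (v i)) → ∃ s, InH κ s ∧ ∀ i, v i ε s
  | 0, _, _ => ⟨emp, inH_emp hω, fun i => i.elim0⟩
  | n + 1, v, hv => by
    obtain ⟨s, hs, h⟩ := exists_mem_inH hκ hω (fun i => v i.succ) fun i => hv i.succ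
    refine ⟨union s (upair (v 0) (v 0)),
      (inH_upair hκ hω hs (inH_upair hκ hω (hv 0) (hv 0))).sUnion, fun i => ?_⟩
    rw [mem_union]
    refine Fin.cases (Or.inr (mem_upair.2 (Or.inl rfl))) (fun i => Or.inl (h i)) i

/-- Take for `t` the transitive closure of a member of `H` that contains the tuple. An injection of
`t` into `κ` is a subset of `t × κ`, hence is itself in `H`. -/
theorem exists_guard_witness (hκ : Ord κ) (hω : Sub omega κ) {n : ℕ} (v : Fin n → M)
    (hv : ∀ i, InH κ (v i)) :
    ∃ t f, InH κ t ∧ InH κ f ∧ Trans t ∧ IsInj f t κ ∧ ∀ i, v i ε t := by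
  obtain ⟨s, hs, h⟩ := exists_mem_inH hκ hω v hv
  have hle := inH_iff_le.1 hs
  obtain ⟨f, hf⟩ := le_iff_isInj.1 hle
  refine ⟨tc s, f, hs.tc, ?_, trans_tc s, hf, fun i => sub_tc s _ (h i)⟩
  have hκH : InH κ κ := InH.of_trans_sub hκ.1 (Le.of_sub (sub_refl κ)) (sub_refl κ)
  refine (inH_prod hκ hω hs.tc hκH).sub fun p hp => ?_
  obtain ⟨a, ha, c, hc, h⟩ := hf.1.1.1 p hp
  obtain rfl := isPair_iff.1 h
  exact pr_mem_prod.2 ⟨ha, hc⟩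

variable {φκ : Lset.Formula (Fin 1)} {R : Lset.Theory}

theorem exists_Hset_substructure (hR : ∀ σ ∈ ZFC, R ⊨ᵇ σ) (hφ : IsDefinableInfCard R φκ)
    {M : Type u} [(expand (Aκ φκ)).Structure M] (hM : M ⊨ setTheory R (Aκ φκ)) :
    ∃ H : (expand (Aκ φκ)).Substructure M, (H : Set M) = Hset (Aκ φκ) φκ M := by
  let _ := (incl (Aκ φκ)).reduct M
  have := nonempty_of_D (subset_Aκ φκ) M
  have hMR := reduct_model hM
  have := zfc_model hR hMR
  obtain ⟨κ, h, hκ, hω⟩ := exists_defines hφ hMR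
  exact exists_substructure (isMorley_of_model hM) hκ hω h

theorem isHSub_of_eq [(expand (Aκ φκ)).Structure M] [(incl (Aκ φκ)).IsExpansionOn M]
    {H : (expand (Aκ φκ)).Substructure M} (hH : (H : Set M) = Hset (Aκ φκ) φκ M) (y : M) :
    y ∈ H ↔ (inHFormula φκ).Realize fun _ => y := by
  rw [← SetLike.mem_coe, hH, ← LHom.realize_onFormula (incl (Aκ φκ))]
  rfl

theorem realize_iff_of_eq_Hset (hR : ∀ σ ∈ ZFC, R ⊨ᵇ σ) (hφ : IsDefinableInfCard R φκ)
    {M : Type u} [(expand (Aκ φκ)).Structure M] (hM : M ⊨ setTheory R (Aκ φκ))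
    {H : (expand (Aκ φκ)).Substructure M} (hH : (H : Set M) = Hset (Aκ φκ) φκ M)
    {σ : (expand (Aκ φκ)).Sentence} (hσ : IsBoolUniversal σ) : H ⊨ σ ↔ M ⊨ σ := by
  let _ := (incl (Aκ φκ)).reduct M
  have := nonempty_of_D (subset_Aκ φκ) M
  have hMR := reduct_model hM
  have := zfc_model hR hMR
  obtain ⟨κ, h, hκ, hω⟩ := exists_defines hφ hMR
  refine realize_iff_of_isBoolUniversal (isMorley_of_model hM) hκ hω h (fun y => ?_) hσ
  rw [isHSub_of_eq hH, h.realize_inHFormula]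

/-- Each such sentence has the same truth value in `M` and in its `H`. One inclusion uses that `H`
is a model of `HTheory`; for the other, a sentence true in every `H` belongs to `HTheory` by
definition. -/
theorem boolUnivConsequences_HTheory (hR : ∀ σ ∈ ZFC, R ⊨ᵇ σ) (hφ : IsDefinableInfCard R φκ) :
    boolUnivConsequences (HTheory R (Aκ φκ) φκ) = boolUnivConsequences (setTheory R (Aκ φκ)) := by
  ext σ
  refine and_congr_right fun hσ => ⟨fun h => ?_, fun h => ?_⟩
  · rw [Theory.models_sentence_iff]
    intro M
    obtain ⟨H, hH⟩ := exists_Hset_substructure hR hφ M.is_model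
    have := nonempty_of_D (subset_Aκ φκ) H
    have : H ⊨ HTheory R (Aκ φκ) φκ := (Theory.model_iff _).2 fun τ hτ => hτ M M.is_model H hH
    exact (realize_iff_of_eq_Hset hR hφ M.is_model hH hσ).1 (h.realize_sentence H)
  · refine Theory.models_sentence_of_mem fun M _ hM H hH => ?_
    have := nonempty_of_D (subset_Aκ φκ) M
    exact (realize_iff_of_eq_Hset hR hφ hM hH hσ).2 (h.realize_sentence M)

/-- In models of the theory of `H_{κ⁺}` every formula is equivalent to an existential one. -/
theorem exists_equiv_rel (hR : ∀ σ ∈ ZFC, R ⊨ᵇ σ) (hφ : IsDefinableInfCard R φκ) {n : ℕ}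
    (φ : (expand (Aκ φκ)).Formula (Fin n)) :
    ∃ r : (expand (Aκ φκ)).Relations (n + 2), ∀ (N : Type) [(expand (Aκ φκ)).Structure N],
      N ⊨ HTheory R (Aκ φκ) φκ → ∀ v : Fin n → N, φ.Realize v ↔
        ∃ t f : N, RelMap r (Fin.cons t (Fin.cons f v : Fin (n + 1) → N) : Fin (n + 2) → N) := by
  obtain ⟨ψ, hψ⟩ := exists_translation φ
  let r := rSymb _ (guard_mem_Aκ φκ ψ)
  let var : Fin (n + 2) → Fin n ⊕ Fin 2 := Fin.cons (Sum.inr 0) (Fin.cons (Sum.inr 1) Sum.inl)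
  let χ : (expand (Aκ φκ)).Formula (Fin n) :=
    φ.iff (Formula.iExs (Fin 2) (r.formula fun i => Term.var (var i)))
  have hχ : ∀ (N : Type) [(expand (Aκ φκ)).Structure N] (v : Fin n → N), χ.Realize v ↔
      (φ.Realize v ↔ ∃ t f : N,
        RelMap r (Fin.cons t (Fin.cons f v : Fin (n + 1) → N) : Fin (n + 2) → N)) := by
    intro N _ v
    have hv : ∀ i : Fin 2 → N, (fun j => Term.realize (Sum.elim v i)
        (Term.var (var j) : (expand (Aκ φκ)).Term (Fin n ⊕ Fin 2))) =
        (Fin.cons (i 0) (Fin.cons (i 1) v : Fin (n + 1) → N) : Fin (n + 2) → N) := fun i => by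
      funext j
      refine Fin.cases rfl (fun j => ?_) j
      refine Fin.cases rfl (fun j => rfl) j
    rw [Formula.realize_iff, Formula.realize_iExs]
    simp only [Formula.realize_rel, hv]
    refine iff_congr Iff.rfl ⟨fun ⟨i, h⟩ => ⟨i 0, i 1, h⟩, fun ⟨t, f, h⟩ => ⟨![t, f], h⟩⟩
  -- The equivalence is a single sentence, so checking it in the structures `H_{κ⁺}^M` gives it in
  -- every model of their common theory, whether or not that model has this form.
  suffices H : close χ ∈ HTheory R (Aκ φκ) φκ by
    refine ⟨r, fun N _ hN v => ?_⟩
    rw [← hχ]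
    exact (realize_close χ).1 ((Theory.model_iff _).1 hN _ H) v
  intro M _ hM H hH
  rw [realize_close]
  intro v
  rw [hχ]
  let _ := (incl (Aκ φκ)).reduct M
  have := nonempty_of_D (subset_Aκ φκ) M
  have hMR := reduct_model hM
  have := zfc_model hR hMR
  have hS := isMorley_of_model hM
  obtain ⟨κ, hd, hκ, hω⟩ := exists_defines hφ hMR
  have hmem : ∀ y, y ∈ H ↔ InH κ y := fun y => by
    rw [isHSub_of_eq hH, hd.realize_inHFormula]
  have h0 : (fun i => ((default : Fin 0 → H) i : M)) = default := Subsingleton.elim _ _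
  have h1 : φ.Realize v ↔ ψ.Realize (fun i => (v i : M)) default := by
    rw [← h0]
    exact hψ M hS H (isHSub_of_eq hH) v default
  have h2 : ∀ t f : H, RelMap r (Fin.cons t (Fin.cons f v : Fin (n + 1) → H) : Fin (n + 2) → H) ↔
      Trans (t : M) ∧ IsInj (f : M) (t : M) κ ∧ (∀ i, (v i : M) ε t) ∧
        ψ.Realize (fun i => (v i : M)) default := fun t f => by
    have h3 := hS.rel _ (guard_mem_Aκ φκ ψ) fun i =>
      ((Fin.cons t (Fin.cons f v : Fin (n + 1) → H) : Fin (n + 2) → H) i : M)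
    rw [hd.realize_guard] at h3
    exact h3
  rw [h1]
  simp only [h2]
  constructor
  · intro h
    obtain ⟨t, f, ht, hf, h3⟩ := exists_guard_witness hκ hω (fun i => (v i : M))
      fun i => (hmem _).1 (v i).2
    exact ⟨⟨t, (hmem _).2 ht⟩, ⟨f, (hmem _).2 hf⟩, h3.1, h3.2.1, h3.2.2, h⟩
  · rintro ⟨t, f, -, -, -, h⟩
    exact h

/-- Existential formulas persist from a substructure to the larger model. Every formula is
equivalent to one of them in both models, so both `φ` and its negation persist. -/
theorem isModelComplete_HTheory (hR : ∀ σ ∈ ZFC, R ⊨ᵇ σ) (hφ : IsDefinableInfCard R φκ) :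
    IsModelComplete (HTheory R (Aκ φκ) φκ) := by
  intro N _ S _ hN hS n φ v
  have key : ∀ φ : (expand (Aκ φκ)).Formula (Fin n), φ.Realize v →
      φ.Realize fun i => (v i : N) := by
    intro φ h
    obtain ⟨r, hr⟩ := exists_equiv_rel hR hφ φ
    rw [hr S hS] at h
    obtain ⟨t, f, h⟩ := h
    refine (hr N hN _).2 ⟨t, f, ?_⟩
    have h3 : (fun i => ((Fin.cons t (Fin.cons f v : Fin (n + 1) → S) : Fin (n + 2) → S) i : N)) =
        Fin.cons (t : N) (Fin.cons (f : N) (fun i => (v i : N)) : Fin (n + 1) → N) := by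
      funext i
      refine Fin.cases rfl (fun i => ?_) i
      refine Fin.cases rfl (fun i => rfl) i
    rw [← h3]
    exact h
  refine ⟨fun h => ?_, key φ⟩
  by_contra hn
  exact key φ.not hn h

theorem isAMC_HTheory (hR : ∀ σ ∈ ZFC, R ⊨ᵇ σ) (hφ : IsDefinableInfCard R φκ) :
    IsAMC (HTheory R (Aκ φκ) φκ) (setTheory R (Aκ φκ)) :=
  ⟨boolUnivConsequences_HTheory hR hφ, isModelComplete_HTheory hR hφ⟩

end Companion

/-! ### Embedding a model of the universal consequences of a theory in a model of the theory -/

section Embed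

open Structure BoundedFormula

variable {L : FirstOrder.Language.{0, 0}}

/-- The formulas with parameters that are true in `M` and equivalent to a quantifier-free formula
in finitely many parameters. -/
def qfDiagram (L : FirstOrder.Language.{0, 0}) (M : Type) [L.Structure M] : Set (L.Formula M) :=
  {χ | ∃ (F : Finset M) (φ : L.Formula F), φ.IsQF ∧ φ.Realize (fun i => (i : M)) ∧
    ∀ (N : Type) [L.Structure N] (g : M → N), φ.Realize (fun i => g i) ↔ χ.Realize g}

variable {M : Type} [L.Structure M]

theorem relabel_mem_qfDiagram {n : ℕ} {φ : L.Formula (Fin n)} (hφ : φ.IsQF) {v : Fin n → M}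
    (h : φ.Realize v) : φ.relabel v ∈ qfDiagram L M := by
  classical
  have hv : ∀ i, v i ∈ Finset.univ.image v := fun i => Finset.mem_image_of_mem _ (Finset.mem_univ i)
  refine ⟨Finset.univ.image v, Formula.relabel (fun i => (⟨v i, hv i⟩ : Finset.univ.image v)) φ,
    IsQF.relabel hφ _, ?_, fun N _ g => ?_⟩
  · rw [Formula.realize_relabel]; exact h
  · rw [Formula.realize_relabel, Formula.realize_relabel]; rfl

theorem exists_conj_qfDiagram (T : Finset (L.Formula M)) :
    (∀ χ ∈ T, χ ∈ qfDiagram L M) → ∃ (F : Finset M) (φ : L.Formula F), φ.IsQF ∧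
      φ.Realize (fun i => (i : M)) ∧ ∀ (N : Type) [L.Structure N] (g : M → N),
        φ.Realize (fun i => g i) → ∀ χ ∈ T, χ.Realize g := by
  classical
  induction T using Finset.induction_on with
  | empty => exact fun _ => ⟨∅, ⊤, IsQF.top, fun h => h, fun N _ g _ χ hχ => by simp at hχ⟩
  | insert χ T _ ih =>
    intro hT
    obtain ⟨F, φ, hq, hr, h⟩ := ih fun χ hχ => hT χ (Finset.mem_insert_of_mem hχ)
    obtain ⟨F', φ', hq', hr', h'⟩ := hT χ (Finset.mem_insert_self _ _)
    have h1 : ∀ i ∈ F, i ∈ F ∪ F' := fun i hi => Finset.mem_union_left _ hi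
    have h2 : ∀ i ∈ F', i ∈ F ∪ F' := fun i hi => Finset.mem_union_right _ hi
    refine ⟨F ∪ F', Formula.relabel (fun i : F => (⟨i, h1 i i.2⟩ : ↥(F ∪ F'))) φ ⊓
      Formula.relabel (fun i : F' => (⟨i, h2 i i.2⟩ : ↥(F ∪ F'))) φ',
      IsQF.inf (IsQF.relabel hq _) (IsQF.relabel hq' _), ?_, fun N _ g hg => ?_⟩
    · exact BoundedFormula.realize_inf.2
        ⟨Formula.realize_relabel.2 hr, Formula.realize_relabel.2 hr'⟩
    · obtain ⟨hg1, hg2⟩ := BoundedFormula.realize_inf.1 hg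
      rw [Finset.forall_mem_insert]
      have hg1' := Formula.realize_relabel.1 hg1
      have hg2' := Formula.realize_relabel.1 hg2
      exact ⟨(h' N g).1 hg2', h N g hg1'⟩

theorem isUniversal_alls : ∀ {n : ℕ} {φ : L.BoundedFormula Empty n}, φ.IsUniversal →
    φ.alls.IsUniversal
  | 0, _, h => h
  | _ + 1, φ, h => isUniversal_alls (φ := φ.all) h.all

/-- A quantifier-free type realized in a model of the universal consequences of `S` is realized
in a model of `S`. -/
theorem exists_realize_qf {S : L.Theory} [Nonempty M] (hM : ∀ σ ∈ univConsequences S, M ⊨ σ)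
    {F : Finset M} {φ : L.Formula F} (hq : φ.IsQF) (h : φ.Realize (fun i => (i : M))) :
    ∃ (N : Theory.ModelType.{0, 0, 0} S) (w : F → N), φ.Realize w := by
  by_contra hc
  push Not at hc
  let e := F.equivFin
  let θ : L.BoundedFormula Empty F.card :=
    BoundedFormula.relabel (k := 0) (fun i => (Sum.inr (e i) : Empty ⊕ Fin F.card)) φ
  have hθ : ∀ (N : Type) [L.Structure N] (w : Fin F.card → N), θ.Realize default w ↔
      φ.Realize fun i => w (e i) := fun N _ w => by
    refine (BoundedFormula.realize_relabel (m := F.card) (n := 0)).trans ?_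
    rw [Formula.boundedFormula_realize_eq_realize]
    rfl
  have hS : S ⊨ᵇ θ.not.alls := by
    rw [Theory.models_sentence_iff]
    intro N
    rw [Sentence.Realize, realize_alls]
    intro w
    rw [BoundedFormula.realize_not, hθ N]
    exact hc N _
  have h2 := hM _ ⟨isUniversal_alls (IsQF.isUniversal (IsQF.relabel hq _).not), hS⟩
  rw [Sentence.Realize, realize_alls] at h2
  have h3 := h2 fun i => ((e.symm i : F) : M)
  rw [BoundedFormula.realize_not, hθ M] at h3
  simp only [Equiv.symm_apply_apply] at h3
  exact h3 h

/-- Compactness for `S` together with the quantifier-free diagram of `M`. Finitely many diagram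
formulas amount to one quantifier-free formula in finitely many parameters; were it realized in no
model of `S`, its negation would give a universal consequence of `S` that fails in `M`. -/
theorem exists_embedding {S : L.Theory} [Nonempty M] (hM : ∀ σ ∈ univConsequences S, M ⊨ σ) :
    ∃ N : Theory.ModelType.{0, 0, 0} S, Nonempty (M ↪[L] N) := by
  classical
  let S' : L[[M]].Theory := (L.lhomWithConstants M).onTheory S
  let D' : L[[M]].Theory := Formula.equivSentence '' qfDiagram L M
  have hsat : (S' ∪ D').IsSatisfiable := by
    rw [Theory.isSatisfiable_iff_isFinitelySatisfiable]
    intro T hT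
    obtain ⟨F, φ, hq, hr, hφ⟩ := exists_conj_qfDiagram
      ((T.filter (· ∈ D')).image Formula.equivSentence.symm) (by
        intro χ hχ
        obtain ⟨τ, hτ, rfl⟩ := Finset.mem_image.1 hχ
        obtain ⟨χ, hχ, rfl⟩ := (Finset.mem_filter.1 hτ).2
        rwa [Equiv.symm_apply_apply])
    obtain ⟨N, w, hw⟩ := exists_realize_qf hM hq hr
    -- The constants not in `F` may be interpreted arbitrarily, since the finitely many diagram
    -- formulas at hand follow from `φ` alone.
    obtain ⟨g, hg⟩ : ∃ g : M → N, ∀ i : F, g i = w i :=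
      ⟨fun m => if hm : m ∈ F then w ⟨m, hm⟩ else Classical.arbitrary N, fun i => by simp⟩
    have hgN := hφ N g (by simpa only [hg] using hw)
    let _ : (constantsOn M).Structure N := constantsOn.structure g
    have : N ⊨ (T : L[[M]].Theory) := by
      refine (Theory.model_iff _).2 fun τ hτ => ?_
      rcases hT hτ with h | h
      · have : N ⊨ S' := (LHom.onTheory_model _ _).2 N.is_model
        exact (Theory.model_iff _).1 this τ h
      · have := hgN _ (Finset.mem_image_of_mem _ (Finset.mem_filter.2 ⟨hτ, h⟩))
        rw [← Equiv.apply_symm_apply Formula.equivSentence τ]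
        exact (Formula.realize_equivSentence _ _).2 this
    exact Theory.Model.isSatisfiable N
  obtain ⟨N⟩ := hsat
  let _ : L.Structure N := (L.lhomWithConstants M).reduct N
  have hNS : N ⊨ S := (LHom.onTheory_model (L.lhomWithConstants M) S).1
    (N.is_model.mono Set.subset_union_left)
  let g : M → N := fun m => (L.con m : N)
  have key : ∀ {n : ℕ} {φ : L.Formula (Fin n)}, φ.IsQF → ∀ {v : Fin n → M}, φ.Realize v →
      φ.Realize fun i => g (v i) := by
    intro n φ hφ v h
    have h1 : N ⊨ Formula.equivSentence (φ.relabel v) :=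
      (Theory.model_iff _).1 N.is_model _
        (Or.inr (Set.mem_image_of_mem _ (relabel_mem_qfDiagram hφ h)))
    have h2 := (Formula.realize_equivSentence N _).1 h1
    exact Formula.realize_relabel.1 h2
  have hinj : Function.Injective g := fun a c h => by
    by_contra hne
    have := key (φ := (Term.equal (Term.var 0) (Term.var 1) : L.Formula (Fin 2)).not)
      (IsAtomic.equal _ _).isQF.not (v := ![a, c]) (by
        rw [Formula.realize_not, Formula.realize_equal]; exact hne)
    rw [Formula.realize_not, Formula.realize_equal] at this
    exact this h
  refine ⟨Theory.ModelType.of S N, ⟨⟨⟨g, hinj⟩, fun {n} f v => ?_, fun {n} r v => ?_⟩⟩⟩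
  · have := key (φ := (Term.equal (Term.func f fun i => Term.var i.succ) (Term.var 0) :
        L.Formula (Fin (n + 1)))) (IsAtomic.equal _ _).isQF (v := Fin.cons (funMap f v) v) (by
        rw [Formula.realize_equal]; rfl)
    rw [Formula.realize_equal] at this
    exact this.symm
  · constructor
    · intro h
      by_contra hn
      have := key (φ := (r.formula Term.var : L.Formula (Fin n)).not)
        (IsAtomic.rel _ _).isQF.not (v := v) (by
          rw [Formula.realize_not, Formula.realize_rel]; exact hn)
      rw [Formula.realize_not, Formula.realize_rel] at this
      exact this h
    · intro h
      have := key (φ := (r.formula Term.var : L.Formula (Fin n)))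
        (IsAtomic.rel _ _).isQF (v := v) (by rw [Formula.realize_rel]; exact h)
      rw [Formula.realize_rel] at this
      exact this

/-- A model of the model companion `T` of `S` is sandwiched: it embeds in a model of `S` that
embeds in an elementary extension of it. -/
theorem exists_sandwich {T S : L.Theory} (hTS : IsModelCompanion T S) [Nonempty M] (hM : M ⊨ T) :
    ∃ (N : Theory.ModelType.{0, 0, 0} S) (M' : Theory.ModelType.{0, 0, 0} T)
      (f : M ↪[L] N) (g : N ↪[L] M'),
      ∀ (α : Type) (φ : L.Formula α) (v : α → M), φ.Realize (fun i => g (f (v i))) ↔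
        φ.Realize v := by
  obtain ⟨N, ⟨f⟩⟩ := exists_embedding (S := S) (M := M) fun σ hσ => by
    rw [← hTS.1] at hσ
    exact hσ.2.realize_sentence M
  obtain ⟨M', ⟨g⟩⟩ := exists_embedding (S := T) (M := N) fun σ hσ => by
    rw [hTS.1] at hσ
    exact hσ.2.realize_sentence N
  refine ⟨N, M', f, g, fun α φ v => ?_⟩
  let e := (g.comp f).equivRange
  have hT : (g.comp f).toHom.range ⊨ T := StrongHomClass.theory_model e
  have : Nonempty (g.comp f).toHom.range := e.toEquiv.nonempty_congr.1 ‹_›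
  -- The image of `M` in `M'` is isomorphic to `M`, hence a model of `T`, and model completeness
  -- makes it elementary.
  let E : L.ElementarySubstructure M' := ⟨_, hTS.2 M' _ M'.is_model hT⟩
  have h1 := E.subtype.map_formula φ fun i => e (v i)
  have h2 := StrongHomClass.realize_formula e φ (v := v)
  exact h1.trans h2

end Embed

/-! ### Models of the model companion -/

section Sandwich

open Structure

/-- The relation symbols of `∈_{Δ₀}` belong to formulas whose variables are all free and indexed by
`Fin (m + 1)`. This moves variables, bound indices included, to such a position while keeping the
formula `Δ₀`. -/
theorem IsDelta0.exists_relabel {α β : Type} {n m : ℕ} {φ : Lset.BoundedFormula α n}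
    (hφ : IsDelta0 φ) (s : α ⊕ Fin n → β ⊕ Fin m) : ∃ φ' : Lset.BoundedFormula β m,
      IsDelta0 φ' ∧ ∀ (M : Type u) [Lset.Structure M] (v : β → M) (xs : Fin m → M),
        φ'.Realize v xs ↔
          φ.Realize (fun i => val v xs (s (Sum.inl i))) (fun i => val v xs (s (Sum.inr i))) := by
  have hval : ∀ {n m : ℕ} (s : α ⊕ Fin n → β ⊕ Fin m) (M : Type u) (v : β → M)
      (xs : Fin m → M) (y : α ⊕ Fin n), val (fun i => val v xs (s (Sum.inl i)))
        (fun i => val v xs (s (Sum.inr i))) y = val v xs (s y) := fun s M v xs y => by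
    rcases y with y | y <;> rfl
  induction hφ generalizing m with
  | falsum => exact ⟨_, .falsum, fun M _ v xs => Iff.rfl⟩
  | mem y z =>
    exact ⟨_, .mem (s y) (s z), fun M _ v xs => by rw [realize_mem, realize_mem, hval, hval]⟩
  | eq y z =>
    exact ⟨_, .eq (s y) (s z), fun M _ v xs => by rw [realize_eq, realize_eq, hval, hval]⟩
  | imp _ _ ih1 ih2 =>
    obtain ⟨φ₁, h1, h1'⟩ := ih1 s
    obtain ⟨φ₂, h2, h2'⟩ := ih2 s
    exact ⟨_, .imp h1 h2, fun M _ v xs => imp_congr (h1' M v xs) (h2' M v xs)⟩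
  | @bAll n y φ _ ih =>
    obtain ⟨φ', h, h'⟩ := ih (m := m + 1) (Sum.elim (fun i => up (s (Sum.inl i)))
      (Fin.snoc (fun i => up (s (Sum.inr i))) nw))
    refine ⟨_, .bAll (s y) h, fun M _ v xs => ?_⟩
    rw [realize_bAll, realize_bAll, hval]
    refine forall_congr' fun z => imp_congr_right fun _ => (h' M v _).trans ?_
    rw [iff_iff_eq]
    congr 1
    · funext i; simp
    · funext i
      refine Fin.lastCases ?_ (fun i => ?_) i <;> simp

variable {A : Set (Form Lset × Fin 2)} (hA : D ⊆ A) {M N M' : Type} [(expand A).Structure M]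
  [(expand A).Structure N] [(expand A).Structure M'] [Lset.Structure M] [Lset.Structure N]
  [(incl A).IsExpansionOn M] [(incl A).IsExpansionOn N] (f : M ↪[expand A] N) (g : N ↪[expand A] M')
  (hel : ∀ (α : Type) (φ : (expand A).Formula α) (v : α → M), φ.Realize (fun i => g (f (v i))) ↔
    φ.Realize v) (hS : IsMorley A N)

include hA hel hS in
/-- Existential quantifiers over `Δ₀`-formulas can be witnessed in `M` if they can in `N`. -/
theorem reflect {α β : Type} {n m k : ℕ} {θ : Lset.BoundedFormula α n} (hθ : IsDelta0 θ)
    (e : α ⊕ Fin n ≃ Fin (m + 1)) (s : α ⊕ Fin n → β ⊕ Fin k) (v : β → M)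
    (h : ∃ w : Fin k → N, θ.Realize (fun i => val (fun i => f (v i)) w (s (Sum.inl i)))
      (fun i => val (fun i => f (v i)) w (s (Sum.inr i)))) :
    ∃ w : Fin k → M, θ.Realize (fun i => f (val v w (s (Sum.inl i))))
      (fun i => f (val v w (s (Sum.inr i)))) := by
  obtain ⟨θ', hθ', hr⟩ := hθ.exists_relabel.{0} (m := 0) fun i =>
    (Sum.inl (e i) : Fin (m + 1) ⊕ Fin 0)
  let r := rSymb (A := A) (n := m) θ' (hA (Or.inl (Or.inl ⟨hθ', rfl⟩)))
  have hrN : ∀ u : α ⊕ Fin n → N, RelMap r (fun i => u (e.symm i)) ↔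
      θ.Realize (fun i => u (Sum.inl i)) (fun i => u (Sum.inr i)) := fun u => by
    refine (hS.rel θ' _ _).trans ((hr N _ _).trans ?_)
    simp only [val_inl, Equiv.symm_apply_apply]
  let χ : (expand A).Formula β := Formula.iExs (Fin k) (r.formula fun i => Term.var (s (e.symm i)))
  have hχ : ∀ (K : Type) [(expand A).Structure K] (v : β → K), χ.Realize v ↔
      ∃ w : Fin k → K, RelMap r fun i => val v w (s (e.symm i)) := fun K _ v => by
    rw [Formula.realize_iExs]
    refine exists_congr fun w => ?_
    rw [Formula.realize_rel]
    rfl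
  obtain ⟨w, hw⟩ := h
  have h1 := (hrN fun i => val (fun i => f (v i)) w (s i)).2 hw
  -- Only in `N` is the symbol `r` known to mean `θ`. The bare existence of a tuple satisfying `r`
  -- goes up along `g` and down to `M` by elementarity; the meaning of `r` is then read off again in
  -- `N`.
  have h2 : χ.Realize fun i => g (f (v i)) := by
    refine (hχ M' _).2 ⟨fun i => g (w i), ?_⟩
    have := (g.map_rel r _).2 h1
    convert this using 1
    funext i
    simp only [Function.comp_apply]
    rcases s (e.symm i) with j | j <;> rfl
  obtain ⟨w, hw⟩ := (hχ M v).1 ((hel _ _ _).1 h2)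
  exact ⟨w, (hrN fun i => f (val v w (s i))).1 ((f.map_rel r _).2 hw)⟩

theorem map_mem_iff (a c : M) : f a ε f c ↔ a ε c := by
  have h1 := LHom.map_onRelation (incl A) (M := M) (SetRel.mem : Lset.Relations 2) ![a, c]
  have h2 := LHom.map_onRelation (incl A) (M := N) (SetRel.mem : Lset.Relations 2) ![f a, f c]
  have h3 := f.map_rel ((incl A).onRelation (SetRel.mem : Lset.Relations 2)) ![a, c]
  have h4 : f ∘ ![a, c] = ![f a, f c] := by funext i; fin_cases i <;> rfl
  rw [h4, iff_of_eq h1, iff_of_eq h2] at h3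
  exact h3

include hA hel hS in
-- The symbols are not yet known to have their intended meaning in `M`, so absoluteness is proved
-- for the formulas themselves. A counterexample in `N` to a bounded quantifier over parameters from
-- `M` is replaced by one in `M` through `reflect`, and the induction hypothesis translates it.
theorem delta0_iff {α : Type} [Fintype α] {n : ℕ} {φ : Lset.BoundedFormula α n} (hφ : IsDelta0 φ)
    (v : α → M) (xs : Fin n → M) :
    φ.Realize (fun i => f (v i)) (fun i => f (xs i)) ↔ φ.Realize v xs := by
  have hval : ∀ {n : ℕ} (xs : Fin n → M) (y : α ⊕ Fin n),
      val (fun i => f (v i)) (fun i => f (xs i)) y = f (val v xs y) := fun xs y => by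
    rcases y with y | y <;> rfl
  induction hφ with
  | falsum => exact Iff.rfl
  | mem y z => rw [realize_mem, realize_mem, hval, hval, map_mem_iff]
  | eq y z => rw [realize_eq, realize_eq, hval, hval, f.injective.eq_iff]
  | imp _ _ ih1 ih2 => exact imp_congr (ih1 xs) (ih2 xs)
  | @bAll n y φ hφ ih =>
    have hsn : ∀ z : M, (Fin.snoc (fun i => f (xs i)) (f z) : Fin (n + 1) → N) =
        fun i => f ((Fin.snoc xs z : Fin (n + 1) → M) i) := fun z => by
      funext i; refine Fin.lastCases ?_ (fun i => ?_) i <;> simp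
    rw [realize_bAll, realize_bAll, hval]
    constructor
    · intro h z hz
      refine (ih (Fin.snoc xs z)).1 ?_
      rw [← hsn]
      exact h _ ((map_mem_iff f _ _).2 hz)
    · intro h z hz
      by_contra hn
      have hθ : IsDelta0 (mem nw (up y) ⊓ φ.not) :=
        have : Dz φ := ⟨hφ⟩
        Dz.out
      -- Relation symbols have positive arity; the variable of the bounded quantifier guarantees at
      -- least one argument.
      have e : α ⊕ Fin (n + 1) ≃ Fin ((Fintype.card α + n) + 1) :=
        Fintype.equivFinOfCardEq (by simp [Fintype.card_sum, add_assoc])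
      let s : α ⊕ Fin (n + 1) → (α ⊕ Fin n) ⊕ Fin 1 := Sum.elim (fun i => Sum.inl (Sum.inl i))
        (Fin.snoc (fun i => Sum.inl (Sum.inr i)) (Sum.inr 0))
      have hs : ∀ {K : Type} (u : α ⊕ Fin n → K) (w : Fin 1 → K),
          (fun i => val u w (s (Sum.inr i))) = Fin.snoc (fun i => u (Sum.inr i)) (w 0) := by
        intro K u w
        funext i
        refine Fin.lastCases ?_ (fun i => ?_) i <;> simp [s]
      obtain ⟨w, hw⟩ := reflect hA f g hel hS hθ e s (Sum.elim v xs) ⟨fun _ => z, by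
        rw [hs]
        simp only [s, Sum.elim_inl, Sum.elim_inr, val_inl, BoundedFormula.realize_inf, realize_mem,
          val_nw, val_up, BoundedFormula.realize_not]
        exact ⟨by rw [hval]; exact hz, hn⟩⟩
      have hs' : (fun i => f (val (Sum.elim v xs) w (s (Sum.inr i)))) =
          Fin.snoc (fun i => f (xs i)) (f (w 0)) := by
        rw [hsn]
        exact congrArg (fun u i => f (u i)) (hs (Sum.elim v xs) w)
      rw [hs'] at hw
      simp only [s, Sum.elim_inl, val_inl, BoundedFormula.realize_inf, realize_mem, val_nw, val_up,
        BoundedFormula.realize_not] at hw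
      rw [hval, map_mem_iff, hsn] at hw
      exact hw.2 ((ih (Fin.snoc xs (w 0))).2 (h _ hw.1))

variable [hN : ZFC.Model N]

include hA hel hS

/-- The embedding commutes with the function symbol, `N` identifies its value by the graph formula,
and that `Δ₀`-formula is absolute between `M` and `N`. -/
theorem sandwich_closedUnderGodel : ClosedUnderGodel hA M := by
  intro i v y
  have hi : ((godel i, (1 : Fin 2)) : Form Lset × Fin 2) ∈ A := hA (Or.inr ⟨i, rfl⟩)
  have hu : ∃! z : N, (godel i).2.Realize (Fin.cons z fun j => f (v j) : _ → N) := by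
    obtain ⟨y, hy, -⟩ := isOp_godel i fun j => f (v j)
    exact ⟨y, (hy y).2 rfl, fun z hz => (hy z).1 hz⟩
  rw [LHom.realize_onFormula, Formula.Realize,
    ← delta0_iff hA f g hel hS (isDelta0_godel i) (Fin.cons y v) default,
    ← f.injective.eq_iff, f.map_fun]
  refine (hS.func (godel i).2 hi (fun j => f (v j)) hu (f y)).trans ?_
  rw [Formula.Realize, iff_iff_eq]
  congr 1
  · funext j; refine Fin.cases rfl (fun j => rfl) j
  · exact Subsingleton.elim _ _

theorem sandwich_extensionality : M ⊨ extensionality := by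
  suffices H : ∀ y z : M, (∀ w, w ε y ↔ w ε z) → y = z by
    simpa [extensionality, Sentence.Realize, Formula.Realize, Fin.snoc] using H
  intro y z h
  -- For fixed `y, z` the instance of Extensionality is `Δ₀`, once the equivalence is written as two
  -- inclusions, so it descends from `N`.
  have hφ : IsDelta0 ((subset (x 0) (x 1)).imp ((subset (x 1) (x 0)).imp (eq (x 0) (x 1))) :
      Lset.BoundedFormula (Fin 2) 0) := Dz.out
  have := (delta0_iff hA f g hel hS hφ ![y, z] default).1 (by
    simp only [BoundedFormula.realize_imp, realize_subset, realize_eq, val_inl]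
    exact fun h1 h2 => h1.antisymm h2)
  simp only [BoundedFormula.realize_imp, realize_subset, realize_eq, val_inl] at this
  exact this (fun w => (h w).1) fun w => (h w).2

theorem sandwich_foundation : M ⊨ foundation := by
  suffices H : ∀ y : M, IsEmp y ∨ ∃ z, z ε y ∧ ∀ w, w ε y → ¬ w ε z by
    simpa [foundation, Sentence.Realize, Formula.Realize, Fin.snoc] using H
  intro y
  have hφ : IsDelta0 (isEmpty (x 0) ⊔ bEx (x 0) (bAll (x 0) (mem (b 1) (b 0)).not) :
      Lset.BoundedFormula (Fin 1) 0) := Dz.out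
  have key : ∀ {K : Type} [Lset.Structure K] (y : K), BoundedFormula.Realize
      (isEmpty (x 0) ⊔ bEx (x 0) (bAll (x 0) (mem (b 1) (b 0)).not) :
        Lset.BoundedFormula (Fin 1) 0) (fun _ => y) default ↔
      (IsEmp y ∨ ∃ z, z ε y ∧ ∀ w, w ε y → ¬ w ε z) := by
    intro K _ y
    simp [Fin.snoc]
  have h1 := delta0_iff hA f g hel hS hφ (fun _ => y) default
  rw [key, Subsingleton.elim (fun i => f ((default : Fin 0 → M) i)) default, key] at h1
  exact h1.1 (found _)

/-- An existential statement with `Δ₀` matrix: `reflect` produces a witness in `M` and `delta0_iff`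
verifies it there. Choice is treated in the same way, with the set to be well-ordered as parameter.
-/
theorem sandwich_infinity : M ⊨ infinity := by
  have hφ : IsDelta0 (bEx (b 0) (isEmpty (b 1)) ⊓ bAll (b 0) (bEx (b 0) (isSucc (b 2) (b 1))) :
      Lset.BoundedFormula Empty 1) := Dz.out
  have hN : N ⊨ infinity := ZFC.realize_sentence_of_mem (by simp [ZFC])
  rw [infinity, Sentence.Realize, Formula.Realize, BoundedFormula.realize_ex] at hN ⊢
  obtain ⟨z, hz⟩ := hN
  obtain ⟨w, hw⟩ := reflect hA f g hel hS hφ (Equiv.emptySum Empty (Fin 1)) id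
    (default : Empty → M) ⟨fun _ => z, by
      convert hz using 1
      funext i
      rw [Subsingleton.elim (α := Fin 1) i 0]
      rfl⟩
  have := (delta0_iff hA f g hel hS hφ _ _).1 hw
  refine ⟨w 0, ?_⟩
  convert this using 1
  funext i
  rw [Subsingleton.elim (α := Fin 1) i 0]
  rfl

theorem sandwich_choice : M ⊨ choiceAx := by
  suffices H : ∀ y : M, ∃ h a, Ord a ∧ IsBij h y a by
    simpa [choiceAx, Sentence.Realize, Formula.Realize, Fin.snoc] using H
  intro y
  have hφ : IsDelta0 (isOrd (b 1) ⊓ isBij (b 0) (x 0) (b 1) : Lset.BoundedFormula (Fin 1) 2) :=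
    Dz.out
  obtain ⟨h, a, ha, hb⟩ := choice_ax (f y)
  obtain ⟨w, hw⟩ := reflect hA f g hel hS hφ (finSumFinEquiv : Fin 1 ⊕ Fin 2 ≃ Fin (2 + 1)) id
    (fun _ => y) ⟨![h, a], by simpa using ⟨ha, hb⟩⟩
  have := (delta0_iff hA f g hel hS hφ _ _).1 hw
  refine ⟨w 0, w 1, ?_⟩
  simpa using this

end Sandwich

/-! ### The axioms in models of the model companion, in every universe. -/

section ModelCompanion

variable {R : Lset.Theory} {A : Set (Form Lset × Fin 2)}

/-- The properties of models of the model companion, for models in the lowest universe. -/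
theorem modelCompanion_properties (hR : ∀ σ ∈ ZFC, R ⊨ᵇ σ) (hA : D ⊆ A)
    {T : (expand A).Theory} (hT : IsModelCompanion T (setTheory R A)) {M : Type}
    [(expand A).Structure M] (hM : M ⊨ T) :
    ClosedUnderGodel hA M ∧ M ⊨ (incl A).onSentence extensionality ∧
      M ⊨ (incl A).onSentence foundation ∧ M ⊨ (incl A).onSentence infinity ∧
      M ⊨ (incl A).onSentence choiceAx := by
  have := nonempty_of_D hA M
  obtain ⟨N, M', f, g, hel⟩ := exists_sandwich hT hM
  let _ : Lset.Structure M := (incl A).reduct M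
  let _ : Lset.Structure N := (incl A).reduct N
  have hS : IsMorley A N := isMorley_of_model N.is_model
  have : ZFC.Model N := zfc_model hR (reduct_model N.is_model)
  simp only [LHom.realize_onSentence]
  exact ⟨sandwich_closedUnderGodel hA f g hel hS, sandwich_extensionality hA f g hel hS,
    sandwich_foundation hA f g hel hS, sandwich_infinity hA f g hel hS,
    sandwich_choice hA f g hel hS⟩

/-- A sentence expressing closure under one Gödel operation. -/
def godelSentence (hA : D ⊆ A) (i : Fin 10) : (expand A).Sentence :=
  close ((Term.equal (Term.func (fSymb (A := A) (godel i).2 (hA (Or.inr ⟨i, rfl⟩)))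
    fun j => Term.var j.succ) (Term.var 0)).iff ((incl A).onFormula (godel i).2))

theorem closedUnderGodel_iff (hA : D ⊆ A) (M : Type u) [(expand A).Structure M] :
    ClosedUnderGodel hA M ↔ ∀ i, M ⊨ godelSentence hA i := by
  refine forall_congr' fun i => ?_
  rw [godelSentence, realize_close]
  constructor
  · intro h v
    have := h (fun j => v j.succ) (v 0)
    rw [Formula.realize_iff, Formula.realize_equal]
    refine this.trans ?_
    rw [show (Fin.cons (v 0) fun j => v j.succ : _ → M) = v from Fin.cons_self_tail v]
  · intro h v y
    have := h (Fin.cons y v)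
    rw [Formula.realize_iff, Formula.realize_equal] at this
    exact this

/-- Model completeness is tested on structures in `Type`. All the properties are given by sentences,
and a sentence entailed by `T` there holds in the models of `T` in every universe. -/
theorem modelCompanion_properties_univ (hR : ∀ σ ∈ ZFC, R ⊨ᵇ σ) (hA : D ⊆ A)
    {T : (expand A).Theory} (hT : IsModelCompanion T (setTheory R A)) {M : Type u}
    [(expand A).Structure M] (hM : M ⊨ T) :
    ClosedUnderGodel hA M ∧ M ⊨ (incl A).onSentence extensionality ∧
      M ⊨ (incl A).onSentence foundation ∧ M ⊨ (incl A).onSentence infinity ∧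
      M ⊨ (incl A).onSentence choiceAx := by
  have := nonempty_of_D hA M
  have key : ∀ {σ : (expand A).Sentence}, (∀ (K : Type) [(expand A).Structure K], K ⊨ T → K ⊨ σ) →
      M ⊨ σ := fun h =>
    Theory.ModelsBoundedFormula.realize_sentence
      (Theory.models_sentence_iff.2 fun K => h K K.is_model) M
  rw [closedUnderGodel_iff]
  exact ⟨fun i => key fun K _ hK =>
      (closedUnderGodel_iff hA K).1 (modelCompanion_properties hR hA hT hK).1 i,
    key fun K _ hK => (modelCompanion_properties hR hA hT hK).2.1,
    key fun K _ hK => (modelCompanion_properties hR hA hT hK).2.2.1,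
    key fun K _ hK => (modelCompanion_properties hR hA hT hK).2.2.2.1,
    key fun K _ hK => (modelCompanion_properties hR hA hT hK).2.2.2.2⟩

end ModelCompanion
end

end AMC

/-! ### The theorem. -/

theorem mainTheorem4 (R : AMC.Lset.Theory) (hR : ∀ σ ∈ AMC.ZFC, R ⊨ᵇ σ) :
    (∀ A ∈ AMC.SpecMC R, ∀ hA : AMC.D ⊆ A,
      ∀ T : (AMC.expand A).Theory, AMC.IsModelCompanion T (AMC.setTheory R A) →
        ∀ (M : Type*) [(AMC.expand A).Structure M], M ⊨ T →
          AMC.ClosedUnderGodel hA M ∧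
          M ⊨ (AMC.incl A).onSentence AMC.extensionality ∧
          M ⊨ (AMC.incl A).onSentence AMC.foundation ∧
          M ⊨ (AMC.incl A).onSentence AMC.infinity ∧
          M ⊨ (AMC.incl A).onSentence AMC.choiceAx) ∧
    (∀ φκ : AMC.Lset.Formula (Fin 1), AMC.IsDefinableInfCard R φκ →
      ∃ A ∈ AMC.SpecAMC R, AMC.D ⊆ A ∧
        (∀ (M : Type*) [(AMC.expand A).Structure M], M ⊨ AMC.setTheory R A →
          ∃ H : (AMC.expand A).Substructure M, (H : Set M) = AMC.Hset A φκ M) ∧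
        AMC.IsAMC (AMC.HTheory R A φκ) (AMC.setTheory R A)) :=
  ⟨fun _ _ hA _ hT _ _ hM => AMC.modelCompanion_properties_univ hR hA hT hM,
    fun φκ hφ => ⟨AMC.Aκ φκ, ⟨_, AMC.isAMC_HTheory hR hφ⟩, AMC.subset_Aκ φκ,
      fun _ _ hM => AMC.exists_Hset_substructure hR hφ hM, AMC.isAMC_HTheory hR hφ⟩⟩
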